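/- **Setting.** Let $K\ge 1$, let $G$ be an undirected graph on the arms $[K]$, and let $N_i$ be the set consisting of $i$ and of its neighbors. In every round a vector of rewards $r_t\in\mathbb R^K$ is drawn, independently over the rounds, from a fixed law with means $\mu\in[0,1]^K$; the learner, who knows $G$ but not the law, plays an arm $i_t$ (possibly at random) and observes $r_{t,j}$ for all $j\in N_{i_t}$. Put $\mu^*=\max_i\mu_i$, $\mathrm{Reg}(T)=\mu^*T-\mathbb E\big[\sum_{t\le T}r_{t,i_t}\big]$, $\Delta_i=\mu^*-\mu_i$, $I^*=\{i:\Delta_i=0\}$, and let $\Delta_{\min}$ be the smallest positive gap (some arm is assumed to be suboptimal). Let $\gamma(G)$ be the domination number of $G$, and $$c^*(G,\mu)=\min_{x\in\mathbb R_{\ge0}^K}\Big\{\sum_i x_i\Delta_i \;:\; \sum_{j\in N_i}x_j\ge \Delta_i^{-2}\ \ \forall i\notin I^*\Big\}.$$ For an integer $s\ge 0$ let $\Delta_s=2^{-s}$, $\Delta^s_i=\max(\Delta_s,\Delta_i)$, $\Gamma_s=\{i:\Delta_i\le 2\Delta_s\}$ and $$D(s)=\min_{x\in\mathbb R_{\ge0}^K}\Big\{\sum_i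 \Delta^s_ix_i \;:\; \sum_{j\in N_i}x_j\ge \Delta_s^{-2}\ \ \forall i\in\Gamma_s\Big\},\qquad d^*(G,\mu)=\max_{s\le\log_2(|I^*|/\Delta_{\min})}D(s).$$ **Theorem.** 1. There is a universal constant $C$ such that for every $K$ and $G$ there is an algorithm with the following property: for every law of the reward vector with means $\mu\in[0,1]^K$ not all equal, in which the reward of each arm is sub-Gaussian with variance proxy $1$, and for every $T\ge 0$ (with $\log 0:=0$), $$\mathrm{Reg}(T)\le C\Big(\max\{1,\log_2(1/\Delta_{\min})\}^2\,d^*(G,\mu)+\log(T)\,c^*(G,\mu)+\gamma(G)K\log K\Big).$$ 2. There are universal constants $c,C>0$ such that for all $K$, $G$, all $\mu\in[0,1]^K$ not all equal, and every (possibly randomized) algorithm: - there is a $\mu'\in[0,1]^K$ such that, when the rewards are independent Gaussians with means $\mu'$ and variance $1/\sqrt2$, $\mathrm{Reg}(T)\ge c\,d^*(G,\mu)$ for all $T\ge C\,d^*(G,\mu)\,|I^*|/\Delta_{\min}$; - for every integer $0\le s\le\log_2(|I^*|/\Delta_{\min})$ with $\mu^*\le 1-2\Delta_s$ there is a $\mu'\in[0,1]^K$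 with $\mu_i\le\mu_i'\le\mu_i+2\Delta_i^s$ for all $i$ such that, for the same Gaussian rewards, $\mathrm{Reg}(T)\ge c\,D(s)$ for all $T\ge C\,D(s)/\Delta_s$. -/

import Mathlib

open MeasureTheory ProbabilityTheory

noncomputable section

namespace FeedbackGraph

/-! ### Feedback graph -/

open scoped Classical in
/-- The neighborhood of arm `i`, with the self-loop: the arms observed when `i` is played. -/
def nbhd {K : ℕ} (G : SimpleGraph (Fin K)) (i : Fin K) : Finset (Fin K) :=
  {j | j = i ∨ G.Adj i j}

/-- `S` is dominating: every vertex outside `S` is adjacent to a vertex of `S`. -/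
def IsDominating {K : ℕ} (G : SimpleGraph (Fin K)) (S : Finset (Fin K)) : Prop :=
  ∀ i, i ∉ S → ∃ j ∈ S, G.Adj i j

/-- The domination number. -/
def domNumber {K : ℕ} (G : SimpleGraph (Fin K)) : ℕ :=
  sInf {n | ∃ S : Finset (Fin K), IsDominating G S ∧ S.card = n}

/-! ### Gaps and linear programs; `m` is the vector of mean rewards -/

/-- The largest mean. -/
def best {K : ℕ} (m : Fin K → ℝ) : ℝ := ⨆ i, m i

/-- The gap of arm `i` to the best mean. -/
def gap {K : ℕ} (m : Fin K → ℝ) (i : Fin K) : ℝ := best m - m i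

open scoped Classical in
/-- The set of optimal arms. -/
def optArms {K : ℕ} (m : Fin K → ℝ) : Finset (Fin K) := {i | m i = best m}

/-- The smallest positive gap. -/
def gapMin {K : ℕ} (m : Fin K → ℝ) : ℝ := sInf {d | ∃ i, 0 < gap m i ∧ d = gap m i}

/-- The scale of phase `s`, that is `2 ^ (-s)`. -/
def scale (s : ℕ) : ℝ := (2 ^ s)⁻¹

/-- The gap of arm `i` clipped from below at the scale of phase `s`. -/
def clippedGap {K : ℕ} (m : Fin K → ℝ) (s : ℕ) (i : Fin K) : ℝ := max (scale s) (gap m i)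

/-- The value of the LP that characterizes the asymptotic regret: minimize `∑ xᵢ Δᵢ` over `x ≥ 0`
so that every suboptimal arm `i` is observed `1 / Δᵢ²` times. -/
def cStar {K : ℕ} (G : SimpleGraph (Fin K)) (m : Fin K → ℝ) : ℝ :=
  sInf {v | ∃ x : Fin K → ℝ, (∀ i, 0 ≤ x i) ∧
    (∀ i, i ∉ optArms m → 1 / gap m i ^ 2 ≤ ∑ j ∈ nbhd G i, x j) ∧
    v = ∑ i, x i * gap m i}

/-- The value of the LP of phase `s`: minimize the cost of `x ≥ 0` under the clipped gaps so that
every arm with gap at most twice the scale is observed `1 / scale²` times. -/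
def phaseValue {K : ℕ} (G : SimpleGraph (Fin K)) (m : Fin K → ℝ) (s : ℕ) : ℝ :=
  sInf {v | ∃ x : Fin K → ℝ, (∀ i, 0 ≤ x i) ∧
    (∀ i, gap m i ≤ 2 * scale s → 1 / scale s ^ 2 ≤ ∑ j ∈ nbhd G i, x j) ∧
    v = ∑ i, clippedGap m s i * x i}

/-- The phases `s ≤ log₂ (|I*| / Δ_min)`. -/
def phases {K : ℕ} (m : Fin K → ℝ) : Set ℕ :=
  {s | (s : ℝ) ≤ Real.logb 2 ((optArms m).card / gapMin m)}

/-- The largest value of the phase LP over the (finitely many) phases `s ≤ log₂ (|I*| / Δ_min)`. -/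
def dStar {K : ℕ} (G : SimpleGraph (Fin K)) (m : Fin K → ℝ) : ℝ :=
  sSup (phaseValue G m '' phases m)

/-! ### Interaction of an algorithm with an environment -/

/-- What the learner knows about one round: the arm played, and the rewards of the observed arms
(the other coordinates are masked by `0`). -/
abbrev Round (K : ℕ) : Type := Fin K × (Fin K → ℝ)

/-- A randomized algorithm: a conditional law of the next arm given the past rounds. -/
structure Policy (K : ℕ) where
  /-- The law of the arm of round `t` (counted from `0`) given the previous `t` rounds. -/
  law : (t : ℕ) → Kernel (Fin t → Round K) (Fin K)
  isMarkov : ∀ t, IsMarkovKernel (law t)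

instance {K : ℕ} (π : Policy K) (t : ℕ) : IsMarkovKernel (π.law t) := π.isMarkov t

open scoped Classical in
/-- The outcome of playing an arm when `p.2` is the vector of all rewards of the round. -/
def feedback {K : ℕ} (G : SimpleGraph (Fin K)) (p : Fin K × (Fin K → ℝ)) : Round K :=
  (p.1, fun j => if j ∈ nbhd G p.1 then p.2 j else 0)

theorem measurable_feedback {K : ℕ} (G : SimpleGraph (Fin K)) : Measurable (feedback G) := by
  classical
  refine measurable_from_prod_countable_right fun i => ?_
  refine Measurable.prodMk measurable_const (measurable_pi_lambda _ fun j => ?_)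
  by_cases h : j ∈ nbhd G i
  · simpa [h] using measurable_pi_apply j
  · simp [h]

/-- The law of the next round given the past: the arm is drawn from the algorithm, and, independently
of it, the vector of all rewards is drawn from `ν`. -/
def stepKernel {K : ℕ} (G : SimpleGraph (Fin K)) (ν : Measure (Fin K → ℝ)) (π : Policy K) (t : ℕ) :
    Kernel (Fin t → Round K) (Round K) :=
  (π.law t ×ₖ Kernel.const _ ν).map (feedback G)

instance {K : ℕ} (G : SimpleGraph (Fin K)) (ν : Measure (Fin K → ℝ)) [IsProbabilityMeasure ν]
    (π : Policy K) (t : ℕ) : IsMarkovKernel (stepKernel G ν π t) :=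
  Kernel.IsMarkovKernel.map _ (measurable_feedback G)

/-- Appending a round to a history. -/
def appendRound {K t : ℕ} (p : (Fin t → Round K) × Round K) : Fin (t + 1) → Round K :=
  Fin.snoc p.1 p.2

theorem measurable_appendRound {K t : ℕ} :
    Measurable (appendRound : (Fin t → Round K) × Round K → Fin (t + 1) → Round K) := by
  refine measurable_pi_lambda _ fun i => ?_
  refine Fin.lastCases ?_ (fun j => ?_) i
  · simpa [appendRound] using measurable_snd
  · simpa [appendRound, Function.comp_def] using
      (measurable_pi_apply j).comp (measurable_fst (α := Fin t → Round K) (β := Round K))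

/-- The law of the first `T` rounds when the reward vectors are i.i.d. with law `ν`. -/
def historyLaw {K : ℕ} (G : SimpleGraph (Fin K)) (ν : Measure (Fin K → ℝ)) (π : Policy K) :
    (T : ℕ) → Measure (Fin T → Round K)
  | 0 => Measure.dirac Fin.elim0
  | T + 1 => (historyLaw G ν π T ⊗ₘ stepKernel G ν π T).map appendRound

instance {K : ℕ} (G : SimpleGraph (Fin K)) (ν : Measure (Fin K → ℝ)) [IsProbabilityMeasure ν]
    (π : Policy K) (T : ℕ) : IsProbabilityMeasure (historyLaw G ν π T) := by
  induction T with
  | zero => exact Measure.dirac.isProbabilityMeasure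
  | succ T ih => exact Measure.isProbabilityMeasure_map measurable_appendRound.aemeasurable

/-- The vector of mean rewards of an environment. -/
def means {K : ℕ} (ν : Measure (Fin K → ℝ)) (i : Fin K) : ℝ := ∫ r, r i ∂ν

/-- The pseudo-regret after `T` rounds: `T μ* - E[∑ₜ r_{t, iₜ}]`. The reward of the played arm is
always observed, so that it can be read off the history. -/
def regret {K : ℕ} (G : SimpleGraph (Fin K)) (ν : Measure (Fin K → ℝ)) (π : Policy K) (T : ℕ) : ℝ :=
  T * best (means ν) - ∫ h, ∑ t, (h t).2 (h t).1 ∂(historyLaw G ν π T)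

/-- The centered reward of every arm is sub-Gaussian with variance proxy `1`. -/
def IsSubGaussian {K : ℕ} (ν : Measure (Fin K → ℝ)) : Prop :=
  ∀ i, HasSubgaussianMGF (fun r => r i - means ν i) 1 ν

/-- Independent Gaussian rewards with means `m` and variance `1 / √2`. -/
def gaussianEnv {K : ℕ} (m : Fin K → ℝ) : Measure (Fin K → ℝ) :=
  Measure.pi fun i => gaussianReal (m i) (1 / NNReal.sqrt 2)

end FeedbackGraph

end

open FeedbackGraph

/-!
**Lower bound.** Fix a phase `s`. Raising the mean of an arm `i` of this phase above the best mean
by the scale makes every other arm suboptimal by half of its clipped gap at least, and this can be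
noticed only by observing `i`. The algorithm is run in an environment without a raised arm, and
stopped when the clipped cost of its plays exceeds a small multiple of the value `D` of the phase
LP. The expected numbers of plays, rescaled, cost less than `D`, so that they violate a constraint
of the LP: some arm `i` of the phase has been observed too rarely to notice that it is raised. Hence
most of that cost is also paid after raising `i`, where it is regret (`exists_raised_of_large`). If
`D` is not large against the inverse scale, it suffices to compare two arms of the phase
(`exists_raised_of_two`). The change of measure (`le_regret_raise`) uses Gibbs' variational
inequality in exponential form, which tolerates the random stopping: rewards come from the second
environment until the algorithm is stopped, and from the first one afterwards. The two items of the
statement differ in the base environment: raising above `best m` itself requires room below `1`, and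
halving all means provides it.

**Upper bound.** The algorithm is deterministic and works in batches. Stage `s` knows a level `l`
for every arm, meaning that its gap is about `2 ^ (-l)`; arms of level `s` are candidates for the
best arm. Its batch *refines*: it observes every candidate of order `s * 4 ^ s` times, at a cost that
is optimal for the gaps described by the levels. If the levels are correct, these LPs are comparable to
those that define `dStar`. At the stages `B * 4 ^ k`, where `4 ^ B` is of order `K`, the batch also
*verifies*: it observes the other arms of level `l` of order `s * 4 ^ l` times, at a cost governed
by `cStar` once the optimal arms have been identified. Verification keeps the failures harmless. A
batch of stage `s` fails with probability `2 * K * exp (-90 s)` at most, and the wrong levels that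
result are detected and erased at the next verification, not later than stage `4 s + 4`; until the
levels are correct again, this costs `256 ^ (4 s + 6)` at most. The value of the
algorithm is therefore bounded by downward induction over the stages, jointly for correct, erased
and arbitrary levels (`regret_stageAlg_le`), and the regret is at most the cost of the batches under
correct levels plus a constant.

These costs are summed in `exists_refineBound`, `exists_verifyBound` and `batchCost_start_le`.
* Up to the stage `p` at which the scale falls below the smallest positive gap, a refinement costs
  `O(s * dStar)`, which sums to `O(p ^ 2 * dStar)`. The refinements with lag, see below, may cost
  up to `O(B * s * dStar)`, but their costs grow geometrically with the stage.
* Later the candidates are the optimal arms, whose plays are free. A suboptimal arm is played only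
  while it seems cheaper than all optimal arms together, that is for `O(B)` more stages. As this
  number depends on `K`, the refinement assumes gaps of the candidates that are smaller than the
  scale by the factor `2 ^ lag`, with `lag` about `log₂ B`, while the other arms have large gaps;
  this gains a factor `B ^ 2`. If some other arm has a small gap, then `B = O(p)` and no lag is
  needed.
* Verifications occur at geometrically growing stages, so that their costs sum to
  `O(p ^ 2 * dStar + log T * cStar)`, up to a rounding error of `O(K)` for each. There is no
  rounding error once every suboptimal arm is known to have an optimal neighbor. Otherwise `cStar`
  is at least the smallest positive gap, and the rounding errors are absorbed by `log z ≤ z`.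
* The first batch plays a dominating set.
-/

namespace FeedbackGraph

/-! ### Laws of histories -/

/-- The law of the first `T` rounds when round `t` is drawn from `κ t` given the past. -/
noncomputable def pathLaw {K : ℕ} (κ : (t : ℕ) → Kernel (Fin t → Round K) (Round K)) :
    (T : ℕ) → Measure (Fin T → Round K)
  | 0 => Measure.dirac Fin.elim0
  | T + 1 => (pathLaw κ T ⊗ₘ κ T).map appendRound

instance {K : ℕ} (κ : (t : ℕ) → Kernel (Fin t → Round K) (Round K)) [∀ t, IsMarkovKernel (κ t)]
    (T : ℕ) : IsProbabilityMeasure (pathLaw κ T) := by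
  induction T with
  | zero => exact Measure.dirac.isProbabilityMeasure
  | succ T ih => exact Measure.isProbabilityMeasure_map measurable_appendRound.aemeasurable

theorem historyLaw_eq_pathLaw {K : ℕ} (G : SimpleGraph (Fin K)) (ν : Measure (Fin K → ℝ))
    (π : Policy K) (T : ℕ) : historyLaw G ν π T = pathLaw (stepKernel G ν π) T := by
  induction T with
  | zero => rfl
  | succ T ih => simp only [historyLaw, pathLaw, ih]

section PathLaw

variable {K : ℕ} {κ : (t : ℕ) → Kernel (Fin t → Round K) (Round K)} [∀ t, IsMarkovKernel (κ t)]

theorem integral_pathLaw_succ {T : ℕ} {f : (Fin (T + 1) → Round K) → ℝ} (hm : Measurable f)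
    (hf : Integrable f (pathLaw κ (T + 1))) :
    ∫ h, f h ∂(pathLaw κ (T + 1)) =
      ∫ h, ∫ r, f (appendRound (h, r)) ∂(κ T h) ∂(pathLaw κ T) := by
  have h1 : Integrable (f ∘ appendRound) (pathLaw κ T ⊗ₘ κ T) :=
    (integrable_map_measure hm.aestronglyMeasurable measurable_appendRound.aemeasurable).1 hf
  rw [pathLaw, integral_map measurable_appendRound.aemeasurable hm.aestronglyMeasurable]
  exact Measure.integral_compProd h1

theorem lintegral_pathLaw_succ {T : ℕ} {f : (Fin (T + 1) → Round K) → ENNReal}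
    (hm : Measurable f) :
    ∫⁻ h, f h ∂(pathLaw κ (T + 1)) =
      ∫⁻ h, ∫⁻ r, f (appendRound (h, r)) ∂(κ T h) ∂(pathLaw κ T) := by
  rw [pathLaw, lintegral_map hm measurable_appendRound,
    Measure.lintegral_compProd (f := fun p => f (appendRound p)) (hm.comp measurable_appendRound)]

theorem integrable_of_bound {α : Type*} [MeasurableSpace α] {μ : Measure α} [IsFiniteMeasure μ]
    {f : α → ℝ} (hm : Measurable f) {C : ℝ} (hb : ∀ x, |f x| ≤ C) : Integrable f μ :=
  Integrable.of_bound hm.aestronglyMeasurable C (Filter.Eventually.of_forall hb)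

end PathLaw

/-! ### One round -/

section Step

variable {K : ℕ} (G : SimpleGraph (Fin K)) (ν : Measure (Fin K → ℝ)) [IsProbabilityMeasure ν]
  (π : Policy K)

/-- The probability that the algorithm plays `a` after the history `h`. -/
noncomputable def playProb {t : ℕ} (h : Fin t → Round K) (a : Fin K) : ℝ := (π.law t h).real {a}

theorem playProb_nonneg {t : ℕ} (h : Fin t → Round K) (a : Fin K) : 0 ≤ playProb π h a :=
  measureReal_nonneg

theorem sum_playProb {t : ℕ} (h : Fin t → Round K) : ∑ a, playProb π h a = 1 := by
  have := sum_measureReal_singleton (μ := π.law t h) (Finset.univ : Finset (Fin K))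
  simp only [playProb, this]
  simp

theorem measurable_playProb {t : ℕ} (a : Fin K) :
    Measurable (fun h : Fin t → Round K => playProb π h a) :=
  (Kernel.measurable_coe (π.law t) (measurableSet_singleton a)).ennreal_toReal

theorem measurable_feedback_arm (a : Fin K) :
    Measurable (fun r : Fin K → ℝ => feedback G (a, r)) :=
  (measurable_feedback G).comp (measurable_const.prodMk measurable_id)

theorem lintegral_stepKernel {t : ℕ} (h : Fin t → Round K) {f : Round K → ENNReal}
    (hm : Measurable f) :
    ∫⁻ r, f r ∂(stepKernel G ν π t h) =
      ∑ a, (π.law t h) {a} * ∫⁻ r, f (feedback G (a, r)) ∂ν := by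
  rw [stepKernel, Kernel.map_apply _ (measurable_feedback G),
    lintegral_map hm (measurable_feedback G), Kernel.prod_apply, Kernel.const_apply,
    lintegral_prod (fun p => f (feedback G p)) (hm.comp (measurable_feedback G)).aemeasurable,
    lintegral_fintype]
  exact Finset.sum_congr rfl fun a _ => mul_comm _ _

theorem integrable_stepKernel {t : ℕ} (h : Fin t → Round K) {f : Round K → ℝ}
    (hm : Measurable f) (hf : ∀ a, Integrable (fun r => f (feedback G (a, r))) ν) :
    Integrable f (stepKernel G ν π t h) := by
  refine ⟨hm.aestronglyMeasurable, ?_⟩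
  rw [HasFiniteIntegral, lintegral_stepKernel G ν π h hm.enorm]
  refine ENNReal.sum_lt_top.2 fun a _ => ENNReal.mul_lt_top (measure_lt_top _ _) (hf a).2

theorem integral_stepKernel {t : ℕ} (h : Fin t → Round K) {f : Round K → ℝ}
    (hm : Measurable f) (hf : ∀ a, Integrable (fun r => f (feedback G (a, r))) ν) :
    ∫ r, f r ∂(stepKernel G ν π t h) =
      ∑ a, playProb π h a * ∫ r, f (feedback G (a, r)) ∂ν := by
  have h0 := integrable_stepKernel G ν π h hm hf
  rw [stepKernel, Kernel.map_apply _ (measurable_feedback G)] at h0 ⊢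
  have h1 := (integrable_map_measure hm.aestronglyMeasurable
    (measurable_feedback G).aemeasurable).1 h0
  rw [integral_map (measurable_feedback G).aemeasurable hm.aestronglyMeasurable]
  rw [Kernel.prod_apply, Kernel.const_apply] at h1 ⊢
  rw [integral_prod (fun p => f (feedback G p)) h1, integral_fintype (Integrable.of_finite)]
  rfl

theorem feedback_self (a : Fin K) (r : Fin K → ℝ) :
    (feedback G (a, r)).2 (feedback G (a, r)).1 = r a := by
  simp [feedback, nbhd]

theorem measurable_reward : Measurable (fun x : Round K => x.2 x.1) :=
  measurable_from_prod_countable_right fun i => measurable_pi_apply i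

theorem integrable_reward (hν : ∀ i, Integrable (fun r : Fin K → ℝ => r i) ν) (T : ℕ) :
    Integrable (fun h : Fin T → Round K => ∑ t, (h t).2 (h t).1) (historyLaw G ν π T) := by
  induction T with
  | zero => simp
  | succ T ih =>
    rw [historyLaw]
    have hm : Measurable (fun h : Fin (T + 1) → Round K => ∑ t, (h t).2 (h t).1) :=
      Finset.measurable_sum _ fun t _ => measurable_reward.comp (measurable_pi_apply t)
    rw [integrable_map_measure hm.aestronglyMeasurable measurable_appendRound.aemeasurable]
    have h2 : (fun h : Fin (T + 1) → Round K => ∑ t, (h t).2 (h t).1) ∘ appendRound =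
        fun p : (Fin T → Round K) × Round K => (∑ t, (p.1 t).2 (p.1 t).1) + p.2.2 p.2.1 := by
      funext p
      simp [appendRound, Fin.sum_univ_castSucc]
    rw [h2]
    have hr : Measurable fun p : (Fin T → Round K) × Round K => p.2.2 p.2.1 :=
      measurable_reward.comp measurable_snd
    refine Integrable.add ?_ ?_
    · exact (Measure.integrable_compProd_iff (by
        refine Measurable.aestronglyMeasurable ?_
        exact Finset.measurable_sum _ fun t _ =>
          measurable_reward.comp ((measurable_pi_apply t).comp measurable_fst))).2
        ⟨Filter.Eventually.of_forall fun h => by simp, by simpa using ih.norm⟩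
    · refine (Measure.integrable_compProd_iff hr.aestronglyMeasurable).2 ⟨?_, ?_⟩
      · refine Filter.Eventually.of_forall fun h => ?_
        refine integrable_stepKernel G ν π h measurable_reward fun a => ?_
        simpa [feedback_self] using hν a
      · have : ∀ h : Fin T → Round K, ∫ y : Round K, ‖y.2 y.1‖ ∂(stepKernel G ν π T h) =
            ∑ a, playProb π h a * ∫ r : Fin K → ℝ, ‖r a‖ ∂ν := by
          intro h
          rw [integral_stepKernel G ν π h measurable_reward.norm]
          · simp [feedback_self]
          · intro a
            simpa [feedback_self] using (hν a).norm
        simp only [this]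
        refine integrable_finsetSum _ fun a _ => Integrable.mul_const ?_ _
        refine integrable_of_bound (measurable_playProb π a) (C := 1) fun h => ?_
        rw [abs_of_nonneg (playProb_nonneg π h a)]
        exact measureReal_le_one

/-- One more round costs the mean gap of the arm played in it. -/
theorem regret_succ (hν : ∀ i, Integrable (fun r : Fin K → ℝ => r i) ν) (T : ℕ) :
    regret G ν π (T + 1) = regret G ν π T +
      ∫ h, ∑ a, playProb π h a * gap (means ν) a ∂(historyLaw G ν π T) := by
  have hm : Measurable (fun h : Fin (T + 1) → Round K => ∑ t, (h t).2 (h t).1) :=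
      Finset.measurable_sum _ fun t _ => measurable_reward.comp (measurable_pi_apply t)
  have hi := integrable_reward G ν π hν (T + 1)
  have key : ∫ h, ∑ t, (h t).2 (h t).1 ∂(historyLaw G ν π (T + 1)) =
      ∫ h, ((∑ t, (h t).2 (h t).1) + ∑ a, playProb π h a * means ν a)
        ∂(historyLaw G ν π T) := by
    rw [historyLaw_eq_pathLaw] at hi ⊢
    rw [integral_pathLaw_succ hm hi, ← historyLaw_eq_pathLaw]
    refine integral_congr_ae (Filter.Eventually.of_forall fun h => ?_)
    simp only [appendRound, Fin.sum_univ_castSucc, Fin.snoc_castSucc, Fin.snoc_last]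
    rw [integral_add (integrable_const _)
      (integrable_stepKernel G ν π h measurable_reward fun a => by
        simpa [feedback_self] using hν a),
      integral_stepKernel G ν π h measurable_reward fun a => by simpa [feedback_self] using hν a]
    simp [feedback_self, means]
  have hp : ∀ c : Fin K → ℝ, Integrable (fun h : Fin T → Round K => ∑ a, playProb π h a * c a)
      (historyLaw G ν π T) := fun c => by
    refine integrable_finsetSum _ fun a _ => Integrable.mul_const ?_ _
    refine integrable_of_bound (measurable_playProb π a) (C := 1) fun h => ?_
    rw [abs_of_nonneg (playProb_nonneg π h a)]
    exact measureReal_le_one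
  have hs : ∀ h : Fin T → Round K, ∑ a, playProb π h a * gap (means ν) a =
      best (means ν) - ∑ a, playProb π h a * means ν a := fun h => by
    simp only [gap, mul_sub, Finset.sum_sub_distrib, ← Finset.sum_mul, sum_playProb, one_mul]
  rw [regret, regret, key, integral_add (integrable_reward G ν π hν T) (hp _)]
  simp only [hs]
  rw [integral_sub (integrable_const _) (hp _)]
  simp
  ring

end Step

/-! ### Gibbs' inequality for laws of histories -/

section Gibbs

variable {K : ℕ} {P Q : (t : ℕ) → Kernel (Fin t → Round K) (Round K)}
  [∀ t, IsMarkovKernel (P t)] [∀ t, IsMarkovKernel (Q t)]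

theorem measurable_integral_append {T : ℕ} {f : (Fin (T + 1) → Round K) → ℝ} (hm : Measurable f) :
    Measurable fun h : Fin T → Round K => ∫ r, f (appendRound (h, r)) ∂(P T h) :=
  (StronglyMeasurable.integral_kernel_prod_right' (κ := P T)
    (f := fun p : (Fin T → Round K) × Round K => f (appendRound p))
    (hm.comp measurable_appendRound).stronglyMeasurable).measurable

theorem abs_integral_le_of_bound {α : Type*} [MeasurableSpace α] {μ : Measure α}
    [IsProbabilityMeasure μ] {f : α → ℝ} {C : ℝ} (hb : ∀ x, |f x| ≤ C) : |∫ x, f x ∂μ| ≤ C := by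
  have := norm_integral_le_of_norm_le_const (μ := μ) (f := f) (C := C)
    (Filter.Eventually.of_forall hb)
  simpa using this

/-- The Gibbs variational inequality for laws of histories: a lower bound for the exponential
moments under `Q` whose price is the sum of the one-step relative entropies `k`, averaged under
`P`. -/
theorem exp_integral_sub_le_pathLaw (k : (t : ℕ) → (Fin t → Round K) → ℝ)
    (hkm : ∀ t, Measurable (k t)) {M : ℝ} (hkb : ∀ t h, |k t h| ≤ M)
    (hstep : ∀ t h (f : Round K → ℝ) (C : ℝ), Measurable f → (∀ r, |f r| ≤ C) →
      Real.exp ((∫ r, f r ∂(P t h)) - k t h) ≤ ∫ r, Real.exp (f r) ∂(Q t h))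
    (T : ℕ) : ∀ (f : (Fin T → Round K) → ℝ) (C : ℝ), Measurable f → (∀ h, |f h| ≤ C) →
      Real.exp ((∫ h, f h ∂(pathLaw P T)) - ∑ t ∈ Finset.range T, ∫ h, k t h ∂(pathLaw P t)) ≤
        ∫ h, Real.exp (f h) ∂(pathLaw Q T) := by
  induction T with
  | zero =>
    intro f C hf _
    simp [pathLaw, integral_dirac' _ _ hf.stronglyMeasurable]
  | succ T ih =>
    intro f C hf hb
    set g : (Fin T → Round K) → ℝ := fun h => (∫ r, f (appendRound (h, r)) ∂(P T h)) - k T h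
      with hg
    have hgm : Measurable g := (measurable_integral_append hf).sub (hkm T)
    have hgb : ∀ h, |g h| ≤ C + M := fun h =>
      (abs_sub _ _).trans (add_le_add (abs_integral_le_of_bound fun r => hb _) (hkb T h))
    have hfexp : Measurable fun h => Real.exp (f h) := Real.measurable_exp.comp hf
    have hfeb : ∀ h, |Real.exp (f h)| ≤ Real.exp C := fun h => by
      rw [Real.abs_exp]; exact Real.exp_le_exp.2 ((le_abs_self _).trans (hb h))
    rw [integral_pathLaw_succ hfexp (integrable_of_bound hfexp hfeb),
      integral_pathLaw_succ hf (integrable_of_bound hf hb), Finset.sum_range_succ]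
    have h1 : ∫ h, Real.exp (g h) ∂(pathLaw Q T) ≤
        ∫ h, ∫ r, Real.exp (f (appendRound (h, r))) ∂(Q T h) ∂(pathLaw Q T) := by
      refine integral_mono (integrable_of_bound (Real.measurable_exp.comp hgm)
        (C := Real.exp (C + M)) fun h => ?_) (integrable_of_bound
          (measurable_integral_append hfexp) (C := Real.exp C)
          fun h => abs_integral_le_of_bound fun r => hfeb _) fun h => ?_
      · rw [Real.abs_exp]
        exact Real.exp_le_exp.2 ((le_abs_self _).trans (hgb h))
      · exact hstep T h (fun r => f (appendRound (h, r))) C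
          (hf.comp (measurable_appendRound.comp (measurable_const.prodMk measurable_id)))
          fun r => hb _
    refine le_trans (le_of_eq ?_) ((ih g (C + M) hgm hgb).trans h1)
    congr 1
    rw [hg, integral_sub (integrable_of_bound (measurable_integral_append hf)
      fun h => abs_integral_le_of_bound fun r => hb _) (integrable_of_bound (hkm T) (hkb T))]
    ring

end Gibbs

/-! ### Relative entropy of Gaussian rewards -/

section Gauss

open Real in
theorem gaussianPDFReal_shift (m θ x : ℝ) (v : NNReal) (hv : v ≠ 0) :
    gaussianPDFReal (m + θ) v x =
      gaussianPDFReal m v x * Real.exp ((θ * (x - m) - θ ^ 2 / 2) / v) := by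
  have hv' : (v : ℝ) ≠ 0 := by exact_mod_cast hv
  rw [gaussianPDFReal, gaussianPDFReal, mul_assoc (_⁻¹), ← Real.exp_add]
  congr 2
  field_simp
  ring

theorem exp_integral_sub_le_gaussianReal (m θ : ℝ) {v : NNReal} (hv : v ≠ 0) {f : ℝ → ℝ}
    (hf : Measurable f) {C : ℝ} (hb : ∀ x, |f x| ≤ C) :
    Real.exp ((∫ x, f x ∂(gaussianReal m v)) - θ ^ 2 / (2 * v)) ≤
      ∫ x, Real.exp (f x) ∂(gaussianReal (m + θ) v) := by
  have hv' : (v : ℝ) ≠ 0 := by exact_mod_cast hv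
  set l : ℝ → ℝ := fun x => (θ * (x - m) - θ ^ 2 / 2) / v with hl
  have hlm : Measurable l := by fun_prop
  have hid : Integrable (fun x : ℝ => x) (gaussianReal m v) :=
    (memLp_id_gaussianReal (μ := m) (v := v) 1).integrable le_rfl
  have hli : Integrable l (gaussianReal m v) :=
    (((hid.sub (integrable_const m)).const_mul θ).sub (integrable_const _)).div_const _
  have hlint : ∫ x, l x ∂(gaussianReal m v) = - (θ ^ 2 / (2 * v)) := by
    simp only [hl]
    have h1 : Integrable (fun x => x - m) (gaussianReal m v) := hid.sub (integrable_const m)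
    rw [integral_div, integral_sub (h1.const_mul θ) (integrable_const _), integral_const_mul,
      integral_sub hid (integrable_const _)]
    simp [integral_id_gaussianReal]
    field_simp
  have hfi : Integrable f (gaussianReal m v) := integrable_of_bound hf hb
  have hexp : ∫ x, Real.exp (f x) ∂(gaussianReal (m + θ) v) =
      ∫ x, Real.exp (f x + l x) ∂(gaussianReal m v) := by
    rw [integral_gaussianReal_eq_integral_smul hv, integral_gaussianReal_eq_integral_smul hv]
    refine integral_congr_ae (Filter.Eventually.of_forall fun x => ?_)
    simp only [smul_eq_mul]
    rw [gaussianPDFReal_shift m θ x v hv, Real.exp_add]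
    ring
  have hexpi : Integrable (fun x => Real.exp (f x + l x)) (gaussianReal m v) := by
    have h1 : Integrable (fun x => Real.exp (θ / v * x)) (gaussianReal m v) :=
      integrable_exp_mul_gaussianReal _
    refine (h1.const_mul (Real.exp (C + (-(θ * m) - θ ^ 2 / 2) / v))).mono'
      (Real.measurable_exp.comp (hf.add hlm)).aestronglyMeasurable
      (Filter.Eventually.of_forall fun x => ?_)
    rw [Real.norm_eq_abs, Real.abs_exp, ← Real.exp_add]
    refine Real.exp_le_exp.2 ?_
    have := (le_abs_self _).trans (hb x)
    have h2 : l x = (-(θ * m) - θ ^ 2 / 2) / v + θ / v * x := by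
      simp only [hl]; field_simp; ring
    linarith
  rw [hexp, sub_eq_add_neg, ← hlint, ← integral_add hfi hli]
  exact convexOn_exp.map_integral_le Real.continuous_exp.continuousOn isClosed_univ
    (Filter.Eventually.of_forall fun x => Set.mem_univ _) (hfi.add hli) hexpi

theorem integral_gaussianEnv {K : ℕ} (m : Fin (K + 1) → ℝ) (i : Fin (K + 1))
    {f : (Fin (K + 1) → ℝ) → ℝ} (hf : Measurable f) {C : ℝ} (hb : ∀ x, |f x| ≤ C) :
    ∫ r, f r ∂(gaussianEnv m) =
      ∫ y, ∫ x, f (i.insertNth x y) ∂(gaussianReal (m i) (1 / NNReal.sqrt 2))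
        ∂(gaussianEnv fun j => m (i.succAbove j)) := by
  have h := (measurePreserving_piFinSuccAbove
    (fun j => gaussianReal (m j) (1 / NNReal.sqrt 2)) i).symm
  rw [gaussianEnv, ← h.integral_comp', integral_prod_symm]
  · rfl
  · exact integrable_of_bound (hf.comp (MeasurableEquiv.measurable _)) (C := C) fun x => hb _

theorem sqrt_ne : (1 / NNReal.sqrt 2 : NNReal) ≠ 0 := by simp

/-- Raising the mean of one Gaussian arm by `θ` has relative entropy `θ² / (2 v)`. -/
theorem exp_integral_sub_le_gaussianEnv {K : ℕ} (m : Fin K → ℝ) (i : Fin K) (θ : ℝ)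
    {f : (Fin K → ℝ) → ℝ} (hf : Measurable f) {C : ℝ} (hb : ∀ x, |f x| ≤ C) :
    Real.exp ((∫ r, f r ∂(gaussianEnv m)) - θ ^ 2 / (2 * (1 / NNReal.sqrt 2 : NNReal))) ≤
      ∫ r, Real.exp (f r) ∂(gaussianEnv (Function.update m i (m i + θ))) := by
  obtain ⟨n, rfl⟩ : ∃ n, K = n + 1 := ⟨K - 1, by have := i.2; omega⟩
  have hfe : Measurable fun x => Real.exp (f x) := Real.measurable_exp.comp hf
  have hfeb : ∀ h, |Real.exp (f h)| ≤ Real.exp C := fun h => by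
    rw [Real.abs_exp]; exact Real.exp_le_exp.2 ((le_abs_self _).trans (hb h))
  rw [integral_gaussianEnv m i hf hb, integral_gaussianEnv _ i hfe hfeb]
  simp only [Function.update_self, ne_eq, Fin.succAbove_ne, not_false_eq_true,
    Function.update_of_ne]
  set ρ := gaussianEnv fun j => m (i.succAbove j) with hρ
  have : IsProbabilityMeasure ρ := by rw [hρ, gaussianEnv]; infer_instance
  have hins : Measurable fun p : (Fin n → ℝ) × ℝ => (i.insertNth p.2 p.1 : Fin (n + 1) → ℝ) :=
    (MeasurableEquiv.piFinSuccAbove (fun _ => ℝ) i).symm.measurable.comp measurable_swap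
  have hm1 : ∀ (μ : ℝ) (g : (Fin (n + 1) → ℝ) → ℝ), Measurable g → Measurable fun y : Fin n → ℝ =>
      ∫ x, g (i.insertNth x y) ∂(gaussianReal μ (1 / NNReal.sqrt 2)) := fun μ g hg =>
    (StronglyMeasurable.integral_prod_right' (f := fun p : (Fin n → ℝ) × ℝ =>
      g (i.insertNth p.2 p.1)) (hg.comp hins).stronglyMeasurable).measurable
  have hb1 : ∀ y : Fin n → ℝ, |∫ x, f (i.insertNth x y)
      ∂(gaussianReal (m i) (1 / NNReal.sqrt 2))| ≤ C := fun y =>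
    abs_integral_le_of_bound fun x => hb _
  have hint : Integrable (fun y : Fin n → ℝ => (∫ x, f (i.insertNth x y)
      ∂(gaussianReal (m i) (1 / NNReal.sqrt 2))) - θ ^ 2 / (2 * (1 / NNReal.sqrt 2 : NNReal))) ρ :=
    (integrable_of_bound (hm1 _ f hf) hb1).sub (integrable_const _)
  have hinte : Integrable (fun y : Fin n → ℝ => Real.exp ((∫ x, f (i.insertNth x y)
      ∂(gaussianReal (m i) (1 / NNReal.sqrt 2))) -
        θ ^ 2 / (2 * (1 / NNReal.sqrt 2 : NNReal)))) ρ := by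
    refine integrable_of_bound (Real.measurable_exp.comp ((hm1 _ f hf).sub measurable_const))
      (C := Real.exp C) fun y => ?_
    rw [Real.abs_exp]
    refine Real.exp_le_exp.2 ?_
    have h1 := (le_abs_self _).trans (hb1 y)
    have h2 : 0 ≤ θ ^ 2 / (2 * ((1 / NNReal.sqrt 2 : NNReal) : ℝ)) := by positivity
    linarith
  calc _ = Real.exp (∫ y, ((∫ x, f (i.insertNth x y)
      ∂(gaussianReal (m i) (1 / NNReal.sqrt 2))) -
        θ ^ 2 / (2 * (1 / NNReal.sqrt 2 : NNReal))) ∂ρ) := by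
        rw [integral_sub (integrable_of_bound (hm1 _ f hf) hb1) (integrable_const _)]
        simp
    _ ≤ ∫ y, Real.exp ((∫ x, f (i.insertNth x y)
      ∂(gaussianReal (m i) (1 / NNReal.sqrt 2))) -
        θ ^ 2 / (2 * (1 / NNReal.sqrt 2 : NNReal))) ∂ρ :=
        convexOn_exp.map_integral_le Real.continuous_exp.continuousOn isClosed_univ
          (Filter.Eventually.of_forall fun x => Set.mem_univ _) hint hinte
    _ ≤ _ := by
        refine integral_mono hinte (integrable_of_bound (hm1 _ _ hfe) (C := Real.exp C) fun y =>
          abs_integral_le_of_bound fun x => hfeb _) fun y => ?_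
        exact exp_integral_sub_le_gaussianReal (m i) θ sqrt_ne
          (hf.comp (hins.comp (measurable_const.prodMk measurable_id))) fun x => hb _

/-- The mean of an arm is irrelevant for functions that do not depend on its reward. -/
theorem integral_gaussianEnv_update {K : ℕ} (m : Fin K → ℝ) (i : Fin K) (a : ℝ)
    {f : (Fin K → ℝ) → ℝ} (hf : Measurable f) {C : ℝ} (hb : ∀ x, |f x| ≤ C)
    (hi : ∀ r x, f (Function.update r i x) = f r) :
    ∫ r, f r ∂(gaussianEnv (Function.update m i a)) = ∫ r, f r ∂(gaussianEnv m) := by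
  obtain ⟨n, rfl⟩ : ∃ n, K = n + 1 := ⟨K - 1, by have := i.2; omega⟩
  rw [integral_gaussianEnv m i hf hb, integral_gaussianEnv _ i hf hb]
  simp only [Function.update_self, ne_eq, Fin.succAbove_ne, not_false_eq_true,
    Function.update_of_ne]
  have : ∀ (x : ℝ) (y : Fin n → ℝ), f (i.insertNth x y) = f (i.insertNth 0 y) := fun x y => by
    rw [← hi (i.insertNth 0 y) x, Fin.update_insertNth]
  simp [this]

end Gauss

/-! ### Charges for the plays up to a stopping time -/

section StopSum

variable {K : ℕ}

theorem measurable_init {t : ℕ} :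
    Measurable (fun h : Fin (t + 1) → Round K => (Fin.init h : Fin t → Round K)) :=
  measurable_pi_lambda _ fun _ => measurable_pi_apply _

theorem init_appendRound {t : ℕ} (h : Fin t → Round K) (r : Round K) :
    (Fin.init (appendRound (h, r)) : Fin t → Round K) = h := by
  simp [appendRound]

theorem appendRound_last {t : ℕ} (h : Fin t → Round K) (r : Round K) :
    appendRound (h, r) (Fin.last t) = r := by
  simp [appendRound]

open scoped Classical in
/-- The total charge of the arms played, where round `t` is charged only if the history before it
belongs to `E t`. -/
noncomputable def chargeSum (E : (t : ℕ) → Set (Fin t → Round K)) (c : Fin K → ℝ) :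
    (T : ℕ) → (Fin T → Round K) → ℝ
  | 0, _ => 0
  | T + 1, h => chargeSum E c T (Fin.init h) +
      if (Fin.init h : Fin T → Round K) ∈ E T then c (h (Fin.last T)).1 else 0

variable {E : (t : ℕ) → Set (Fin t → Round K)} {c : Fin K → ℝ}

theorem chargeSum_append {T : ℕ} (h : Fin T → Round K) (r : Round K) [Decidable (h ∈ E T)] :
    chargeSum E c (T + 1) (appendRound (h, r)) =
      chargeSum E c T h + if h ∈ E T then c r.1 else 0 := by
  simp only [chargeSum, init_appendRound, appendRound_last]

theorem measurable_chargeSum (hE : ∀ t, MeasurableSet (E t)) (T : ℕ) :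
    Measurable (chargeSum E c T) := by
  classical
  induction T with
  | zero => exact measurable_const
  | succ T ih =>
    refine (ih.comp measurable_init).add (Measurable.ite (measurable_init (hE T)) ?_
      measurable_const)
    exact (measurable_of_finite c).comp (measurable_fst.comp (measurable_pi_apply _))

theorem abs_chargeSum_le (T : ℕ) (h : Fin T → Round K) :
    |chargeSum E c T h| ≤ T * ∑ a, |c a| := by
  classical
  induction T with
  | zero => simp [chargeSum]
  | succ T ih =>
    rw [chargeSum]
    refine (abs_add_le _ _).trans ?_
    push_cast
    rw [add_mul, one_mul]
    refine add_le_add (ih _) ?_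
    split_ifs
    · exact Finset.single_le_sum (f := fun a => |c a|) (fun a _ => abs_nonneg _)
        (Finset.mem_univ _)
    · simpa using Finset.sum_nonneg fun a _ => abs_nonneg (c a)

theorem chargeSum_sum {ι : Type*} (s : Finset ι) (w : ι → ℝ) (c : ι → Fin K → ℝ) (T : ℕ)
    (h : Fin T → Round K) :
    chargeSum E (fun a => ∑ j ∈ s, w j * c j a) T h = ∑ j ∈ s, w j * chargeSum E (c j) T h := by
  induction T with
  | zero => simp [chargeSum]
  | succ T ih =>
    simp only [chargeSum, ih, mul_add, Finset.sum_add_distrib]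
    split_ifs <;> simp

theorem integrable_chargeSum {μ : (T : ℕ) → Measure (Fin T → Round K)}
    [∀ T, IsProbabilityMeasure (μ T)] (hE : ∀ t, MeasurableSet (E t)) (T : ℕ) :
    Integrable (chargeSum E c T) (μ T) :=
  integrable_of_bound (measurable_chargeSum hE T) (abs_chargeSum_le T)

variable {κ : (t : ℕ) → Kernel (Fin t → Round K) (Round K)} [∀ t, IsMarkovKernel (κ t)]

open scoped Classical in
/-- The expected charge in terms of the conditional law of the arm, for every law of histories in
which the arms are drawn by the algorithm `π`. -/
theorem integral_chargeSum (hE : ∀ t, MeasurableSet (E t)) (π : Policy K)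
    (hκ : ∀ t h (f : Fin K → ℝ), ∫ r, f r.1 ∂(κ t h) = ∑ a, playProb π h a * f a) (T : ℕ) :
    ∫ h, chargeSum E c T h ∂(pathLaw κ T) = ∑ t ∈ Finset.range T,
      ∫ h, (if h ∈ E t then ∑ a, playProb π h a * c a else 0) ∂(pathLaw κ t) := by
  induction T with
  | zero => simp [chargeSum]
  | succ T ih =>
    rw [integral_pathLaw_succ (measurable_chargeSum hE _) (integrable_chargeSum hE _),
      Finset.sum_range_succ, ← ih, ← integral_add (integrable_chargeSum hE T)]
    · refine integral_congr_ae (Filter.Eventually.of_forall fun h => ?_)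
      simp only [chargeSum_append]
      rw [integral_add (integrable_const _)]
      · simp only [integral_const, probReal_univ, one_smul]
        congr 1
        split_ifs with hh
        · exact hκ T h c
        · simp
      · split_ifs
        · exact integrable_of_bound ((measurable_of_finite c).comp measurable_fst)
            (C := ∑ a, |c a|) fun x => Finset.single_le_sum (f := fun a => |c a|)
              (fun a _ => abs_nonneg _) (Finset.mem_univ _)
        · exact integrable_const _
    · refine integrable_of_bound (Measurable.ite (hE T)
        (Finset.measurable_sum _ fun a _ => (measurable_playProb π a).mul_const _)
        measurable_const) (C := ∑ a, |c a|) fun h => ?_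
      split_ifs
      · refine (Finset.abs_sum_le_sum_abs _ _).trans (Finset.sum_le_sum fun a _ => ?_)
        rw [abs_mul, abs_of_nonneg (playProb_nonneg π h a)]
        exact mul_le_of_le_one_left (abs_nonneg _) measureReal_le_one
      · simpa using Finset.sum_nonneg fun a _ => abs_nonneg (c a)

end StopSum

/-! ### Change of measure between environments -/

section Environments

variable {K : ℕ} (G : SimpleGraph (Fin K)) (π : Policy K)

instance (m : Fin K → ℝ) : IsProbabilityMeasure (gaussianEnv m) := by
  rw [gaussianEnv]; infer_instance

theorem measurePreserving_eval_gaussianEnv (m : Fin K → ℝ) (i : Fin K) :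
    MeasurePreserving (fun r : Fin K → ℝ => r i) (gaussianEnv m)
      (gaussianReal (m i) (1 / NNReal.sqrt 2)) :=
  measurePreserving_eval (fun i => gaussianReal (m i) (1 / NNReal.sqrt 2)) i

theorem integrable_gaussianEnv (m : Fin K → ℝ) (i : Fin K) :
    Integrable (fun r : Fin K → ℝ => r i) (gaussianEnv m) :=
  (measurePreserving_eval_gaussianEnv m i).integrable_comp_of_integrable
    ((memLp_id_gaussianReal (μ := m i) (v := 1 / NNReal.sqrt 2) 1).integrable le_rfl)

theorem means_gaussianEnv (m : Fin K → ℝ) : means (gaussianEnv m) = m := by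
  funext i
  have h := (measurePreserving_eval_gaussianEnv m i)
  rw [means, ← integral_map (φ := fun r : Fin K → ℝ => r i) (f := fun x : ℝ => x)
    h.measurable.aemeasurable measurable_id.aestronglyMeasurable, h.map_eq,
    integral_id_gaussianReal]

theorem integral_stepKernel_arm (ν : Measure (Fin K → ℝ)) [IsProbabilityMeasure ν] (t : ℕ)
    (h : Fin t → Round K) (f : Fin K → ℝ) :
    ∫ r, f r.1 ∂(stepKernel G ν π t h) = ∑ a, playProb π h a * f a := by
  rw [integral_stepKernel G ν π h (f := fun r => f r.1)
    ((measurable_of_finite f).comp measurable_fst)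
    fun a => by simp [feedback]]
  simp [feedback]

theorem regret_zero (ν : Measure (Fin K → ℝ)) : regret G ν π 0 = 0 := by
  simp [regret]

theorem regret_eq_sum (ν : Measure (Fin K → ℝ)) [IsProbabilityMeasure ν]
    (hν : ∀ i, Integrable (fun r : Fin K → ℝ => r i) ν) (T : ℕ) :
    regret G ν π T = ∑ t ∈ Finset.range T,
      ∫ h, ∑ a, playProb π h a * gap (means ν) a ∂(historyLaw G ν π t) := by
  induction T with
  | zero => simp [regret_zero]
  | succ T ih => rw [regret_succ G ν π hν, ih, Finset.sum_range_succ]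

theorem le_best (m : Fin K → ℝ) (i : Fin K) : m i ≤ best m :=
  le_ciSup (Set.finite_range m).bddAbove i

theorem gap_nonneg (m : Fin K → ℝ) (i : Fin K) : 0 ≤ gap m i := sub_nonneg.2 (le_best m i)

theorem sum_playProb_mul_nonneg {t : ℕ} (h : Fin t → Round K) {c : Fin K → ℝ}
    (hc : ∀ a, 0 ≤ c a) : 0 ≤ ∑ a, playProb π h a * c a :=
  Finset.sum_nonneg fun a _ => mul_nonneg (playProb_nonneg π h a) (hc a)

theorem integrable_sum_playProb {t : ℕ} (μ : Measure (Fin t → Round K)) [IsProbabilityMeasure μ]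
    (c : Fin K → ℝ) : Integrable (fun h : Fin t → Round K => ∑ a, playProb π h a * c a) μ := by
  refine integrable_finsetSum _ fun a _ => Integrable.mul_const ?_ _
  refine integrable_of_bound (measurable_playProb π a) (C := 1) fun h => ?_
  rw [abs_of_nonneg (playProb_nonneg π h a)]
  exact measureReal_le_one

open scoped Classical in
/-- Observing `i` when playing `a`. -/
noncomputable def obs (i a : Fin K) : ℝ := if i ∈ nbhd G a then 1 else 0

theorem obs_nonneg (i a : Fin K) : 0 ≤ obs G i a := by
  unfold obs; split_ifs <;> simp

theorem obs_le_one (i a : Fin K) : obs G i a ≤ 1 := by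
  unfold obs; split_ifs <;> simp

open scoped Classical in
/-- The kernel that draws the rewards from `ν₁` after the histories in `J`, and from `ν₀` after the
others. -/
noncomputable def switchKernel (ν₀ ν₁ : Measure (Fin K → ℝ))
    {J : (t : ℕ) → Set (Fin t → Round K)} (hJ : ∀ t, MeasurableSet (J t)) (t : ℕ) :
    Kernel (Fin t → Round K) (Round K) :=
  Kernel.piecewise (hJ t) (stepKernel G ν₁ π t) (stepKernel G ν₀ π t)

instance (ν₀ ν₁ : Measure (Fin K → ℝ)) [IsProbabilityMeasure ν₀] [IsProbabilityMeasure ν₁]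
    {J : (t : ℕ) → Set (Fin t → Round K)} (hJ : ∀ t, MeasurableSet (J t)) (t : ℕ) :
    IsMarkovKernel (switchKernel G π ν₀ ν₁ hJ t) := by
  unfold switchKernel; infer_instance

/-- The histories that end in `E` never left `J` before, so that their law under the switching
kernel is the law under `ν₁`. -/
theorem integral_switchKernel_eq (ν₀ ν₁ : Measure (Fin K → ℝ)) [IsProbabilityMeasure ν₀]
    [IsProbabilityMeasure ν₁] {J E : (t : ℕ) → Set (Fin t → Round K)}
    (hJ : ∀ t, MeasurableSet (J t))
    (hEJ : ∀ t (h : Fin (t + 1) → Round K), h ∈ E (t + 1) → Fin.init h ∈ J t ∧ Fin.init h ∈ E t)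
    (T : ℕ) : ∀ (f : (Fin T → Round K) → ℝ) (C : ℝ), Measurable f → (∀ h, |f h| ≤ C) →
      (∀ h, h ∉ E T → f h = 0) →
      ∫ h, f h ∂(pathLaw (switchKernel G π ν₀ ν₁ hJ) T) =
        ∫ h, f h ∂(pathLaw (stepKernel G ν₁ π) T) := by
  classical
  induction T with
  | zero => intro f C _ _ _; rfl
  | succ T ih =>
    intro f C hf hb h0
    rw [integral_pathLaw_succ hf (integrable_of_bound hf hb),
      integral_pathLaw_succ hf (integrable_of_bound hf hb)]
    have hz : ∀ h : Fin T → Round K, ¬ (h ∈ J T ∧ h ∈ E T) → ∀ r, f (appendRound (h, r)) = 0 :=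
      fun h hh r => h0 _ fun hc => hh (by simpa [init_appendRound] using hEJ T _ hc)
    have heq : ∀ h : Fin T → Round K,
        ∫ r, f (appendRound (h, r)) ∂(switchKernel G π ν₀ ν₁ hJ T h) =
          ∫ r, f (appendRound (h, r)) ∂(stepKernel G ν₁ π T h) := fun h => by
      by_cases hh : h ∈ J T ∧ h ∈ E T
      · rw [switchKernel, Kernel.piecewise_apply, if_pos hh.1]
      · simp [hz h hh]
    simp only [heq]
    refine ih _ C (measurable_integral_append hf) (fun h => abs_integral_le_of_bound fun r => hb _)
      fun h hh => ?_
    simp [hz h fun hc => hh hc.2]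

open scoped Classical in
/-- The one-step inequality behind the lower bound: after the histories in `J`, the entropy of
raising the mean of `i` is paid for if `i` is observed. -/
theorem exp_integral_sub_le_switchKernel (m : Fin K → ℝ) (i : Fin K) (θ : ℝ)
    {J : (t : ℕ) → Set (Fin t → Round K)} (hJ : ∀ t, MeasurableSet (J t)) (t : ℕ)
    (h : Fin t → Round K) (f : Round K → ℝ) (C : ℝ) (hf : Measurable f) (hb : ∀ r, |f r| ≤ C) :
    Real.exp ((∫ r, f r ∂(stepKernel G (gaussianEnv m) π t h)) -
        if h ∈ J t then ∑ a, playProb π h a *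
          (θ ^ 2 / (2 * (1 / NNReal.sqrt 2 : NNReal)) * obs G i a) else 0) ≤
      ∫ r, Real.exp (f r) ∂(switchKernel G π (gaussianEnv m)
        (gaussianEnv (Function.update m i (m i + θ))) hJ t h) := by
  set k : ℝ := θ ^ 2 / (2 * (1 / NNReal.sqrt 2 : NNReal)) with hk
  have hfe : Measurable fun x => Real.exp (f x) := Real.measurable_exp.comp hf
  have hfeb : ∀ h, |Real.exp (f h)| ≤ Real.exp C := fun h => by
    rw [Real.abs_exp]; exact Real.exp_le_exp.2 ((le_abs_self _).trans (hb h))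
  have hfa : ∀ a, Measurable fun r : Fin K → ℝ => f (feedback G (a, r)) := fun a =>
    hf.comp (measurable_feedback_arm G a)
  have hfea : ∀ a, Measurable fun r : Fin K → ℝ => Real.exp (f (feedback G (a, r))) := fun a =>
    hfe.comp (measurable_feedback_arm G a)
  -- Jensen without a change of measure
  have hplain : ∀ a, Real.exp (∫ r, f (feedback G (a, r)) ∂(gaussianEnv m)) ≤
      ∫ r, Real.exp (f (feedback G (a, r))) ∂(gaussianEnv m) := fun a =>
    convexOn_exp.map_integral_le Real.continuous_exp.continuousOn isClosed_univ
      (Filter.Eventually.of_forall fun x => Set.mem_univ _)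
      (integrable_of_bound (hfa a) fun r => hb _) (integrable_of_bound (hfea a) fun r => hfeb _)
  rw [integral_stepKernel G _ π h hf fun a => integrable_of_bound (hfa a) fun r => hb _,
    switchKernel, Kernel.piecewise_apply]
  by_cases hh : h ∈ J t
  · rw [if_pos hh, if_pos hh, integral_stepKernel G _ π h hfe fun a =>
      integrable_of_bound (hfea a) fun r => hfeb _, ← Finset.sum_sub_distrib]
    simp only [← mul_sub]
    refine (convexOn_exp.map_sum_le (fun a _ => playProb_nonneg π h a) (sum_playProb π h)
      fun a _ => Set.mem_univ _).trans (Finset.sum_le_sum fun a _ => ?_)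
    refine mul_le_mul_of_nonneg_left ?_ (playProb_nonneg π h a)
    by_cases hi : i ∈ nbhd G a
    · rw [obs, if_pos hi, mul_one]
      exact exp_integral_sub_le_gaussianEnv m i θ (hfa a) fun r => hb _
    · rw [obs, if_neg hi, mul_zero, sub_zero]
      refine (hplain a).trans (le_of_eq ?_)
      refine (integral_gaussianEnv_update m i _ (hfea a) (fun r => hfeb _) fun r x => ?_).symm
      congr 2
      simp only [feedback, Prod.mk.injEq, true_and]
      funext j
      by_cases hj : j ∈ nbhd G a
      · have : j ≠ i := fun hc => hi (hc ▸ hj)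
        simp [hj, this]
      · simp [hj]
  · rw [if_neg hh, if_neg hh, sub_zero, integral_stepKernel G _ π h hfe fun a =>
      integrable_of_bound (hfea a) fun r => hfeb _]
    refine (convexOn_exp.map_sum_le (fun a _ => playProb_nonneg π h a) (sum_playProb π h)
      fun a _ => Set.mem_univ _).trans (Finset.sum_le_sum fun a _ => ?_)
    exact mul_le_mul_of_nonneg_left (hplain a) (playProb_nonneg π h a)

/-- The change of measure: a charge bounded by `1` that arises in the environment `m` also arises
after the mean of arm `i` is raised by `θ`, up to the entropy of the observations of `i`; the
regret in the latter environment pays for it. -/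
theorem le_regret_raise (m : Fin K → ℝ) (i : Fin K) (θ : ℝ)
    {J E : (t : ℕ) → Set (Fin t → Round K)} (hJ : ∀ t, MeasurableSet (J t))
    (hE : ∀ t, MeasurableSet (E t))
    (hEJ : ∀ t (h : Fin (t + 1) → Round K), h ∈ E (t + 1) → Fin.init h ∈ J t ∧ Fin.init h ∈ E t)
    {c : Fin K → ℝ} {S : ℝ} (hS : 0 ≤ S) {T T' : ℕ} (hT : T ≤ T')
    (hX : ∀ h : Fin T → Round K, chargeSum E c T h ∈ Set.Icc (0 : ℝ) 1)
    (hgap : ∀ a, S * c a ≤ gap (Function.update m i (m i + θ)) a) :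
    S / 2 * ((∫ h, chargeSum E c T h ∂(historyLaw G (gaussianEnv m) π T)) -
      θ ^ 2 / (2 * (1 / NNReal.sqrt 2 : NNReal)) *
        ∫ h, chargeSum J (obs G i) T h ∂(historyLaw G (gaussianEnv m) π T)) ≤
      regret G (gaussianEnv (Function.update m i (m i + θ))) π T' := by
  classical
  set k : ℝ := θ ^ 2 / (2 * (1 / NNReal.sqrt 2 : NNReal)) with hk
  set m' := Function.update m i (m i + θ) with hm'
  have hk0 : 0 ≤ k := by positivity
  have hmeasE : ∀ (t : ℕ) (F : (t : ℕ) → Set (Fin t → Round K)) (_ : ∀ t, MeasurableSet (F t))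
      (c : Fin K → ℝ), Measurable fun h : Fin t → Round K =>
        if h ∈ F t then ∑ a, playProb π h a * c a else 0 := fun t F hF c =>
    Measurable.ite (hF t) (Finset.measurable_sum _ fun a _ =>
      (measurable_playProb π a).mul_const _) measurable_const
  have hbE : ∀ (t : ℕ) (F : (t : ℕ) → Set (Fin t → Round K)) (c : Fin K → ℝ)
      (h : Fin t → Round K), |if h ∈ F t then ∑ a, playProb π h a * c a else 0| ≤ ∑ a, |c a| := by
    intro t F c h
    split_ifs
    · refine (Finset.abs_sum_le_sum_abs _ _).trans (Finset.sum_le_sum fun a _ => ?_)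
      rw [abs_mul, abs_of_nonneg (playProb_nonneg π h a)]
      exact mul_le_of_le_one_left (abs_nonneg _) measureReal_le_one
    · simpa using Finset.sum_nonneg fun a _ => abs_nonneg (c a)
  have harm : ∀ t h (f : Fin K → ℝ), ∫ r, f r.1 ∂(switchKernel G π (gaussianEnv m)
      (gaussianEnv m') hJ t h) = ∑ a, playProb π h a * f a := fun t h f => by
    rw [switchKernel, Kernel.piecewise_apply]
    split_ifs <;> exact integral_stepKernel_arm G π _ t h f
  -- the regret dominates the charge under the switching kernel
  have h1 : S * ∫ h, chargeSum E c T h ∂(pathLaw (switchKernel G π (gaussianEnv m)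
      (gaussianEnv m') hJ) T) ≤ regret G (gaussianEnv m') π T' := by
    rw [integral_chargeSum hE π harm, regret_eq_sum G π _ (integrable_gaussianEnv m'),
      Finset.mul_sum, means_gaussianEnv]
    refine (Finset.sum_le_sum fun t _ => ?_).trans (Finset.sum_le_sum_of_subset_of_nonneg
      (Finset.range_mono hT) fun t _ _ => integral_nonneg fun h =>
        sum_playProb_mul_nonneg π h (gap_nonneg m'))
    rw [integral_switchKernel_eq G π _ _ hJ hEJ t _ _ (hmeasE t E hE c) (hbE t E c)
      fun h hh => if_neg hh, ← integral_const_mul, historyLaw_eq_pathLaw]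
    refine integral_mono ((integrable_of_bound (hmeasE t E hE c) (hbE t E c)).const_mul _)
      (integrable_sum_playProb π _ _) fun h => ?_
    simp only
    split_ifs
    · rw [Finset.mul_sum]
      refine Finset.sum_le_sum fun a _ => ?_
      have := mul_le_mul_of_nonneg_left (hgap a) (playProb_nonneg π h a)
      linarith
    · simpa using sum_playProb_mul_nonneg π h (gap_nonneg m')
  -- Gibbs' inequality, and `exp x ≤ 1 + 2 x` on `[0, 1]`
  have h2 := exp_integral_sub_le_pathLaw (P := stepKernel G (gaussianEnv m) π)
    (Q := switchKernel G π (gaussianEnv m) (gaussianEnv m') hJ)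
    (fun t h => if h ∈ J t then ∑ a, playProb π h a * (k * obs G i a) else 0)
    (fun t => hmeasE t J hJ _) (fun t => hbE t J _)
    (exp_integral_sub_le_switchKernel G π m i θ hJ) T (chargeSum E c T) 1
    (measurable_chargeSum hE T) fun h => abs_le.2 ⟨by linarith [(hX h).1], (hX h).2⟩
  rw [← integral_chargeSum (κ := stepKernel G (gaussianEnv m) π) hJ π
    (integral_stepKernel_arm G π _)] at h2
  have hmul : ∀ h : Fin T → Round K, chargeSum J (fun a => k * obs G i a) T h =
      k * chargeSum J (obs G i) T h := fun h => by
    have := chargeSum_sum (E := J) (Finset.univ : Finset Unit) (fun _ => k)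
      (fun _ => obs G i) T h
    simpa using this
  simp only [hmul, integral_const_mul, ← historyLaw_eq_pathLaw] at h2
  have h3 : ∫ h, Real.exp (chargeSum E c T h) ∂(pathLaw (switchKernel G π (gaussianEnv m)
      (gaussianEnv m') hJ) T) ≤ ∫ h, (1 + 2 * chargeSum E c T h)
        ∂(pathLaw (switchKernel G π (gaussianEnv m) (gaussianEnv m') hJ) T) := by
    refine integral_mono (integrable_of_bound (Real.measurable_exp.comp
      (measurable_chargeSum hE T)) (C := Real.exp 1) fun h => ?_)
      ((integrable_const _).add ((integrable_chargeSum hE T).const_mul 2)) fun h => ?_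
    · rw [Real.abs_exp]
      exact Real.exp_le_exp.2 (hX h).2
    · have hx := hX h
      have hb := Real.abs_exp_sub_one_sub_id_le (x := chargeSum E c T h)
        (abs_le.2 ⟨by linarith [hx.1], hx.2⟩)
      have hb2 := (abs_le.1 hb).2
      have : chargeSum E c T h ^ 2 ≤ chargeSum E c T h := by
        nlinarith [hx.1, hx.2]
      simp only
      linarith
  rw [integral_add (integrable_const _) ((integrable_chargeSum hE T).const_mul 2),
    integral_const_mul] at h3
  simp only [integral_const, probReal_univ, one_smul] at h3
  have h4 := Real.add_one_le_exp ((∫ h, chargeSum E c T h ∂(historyLaw G (gaussianEnv m) π T)) -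
    k * ∫ h, chargeSum J (obs G i) T h ∂(historyLaw G (gaussianEnv m) π T))
  nlinarith [h1, h2, h3, h4, hS]

end Environments

/-! ### The linear program of a phase -/

section LP

variable {K : ℕ} (G : SimpleGraph (Fin K)) (m : Fin K → ℝ) (s : ℕ)

theorem scale_pos : 0 < scale s := by unfold scale; positivity

theorem scale_le_one : scale s ≤ 1 := by
  unfold scale
  exact inv_le_one_of_one_le₀ (one_le_pow₀ (by norm_num))

theorem scale_succ : scale (s + 1) = scale s / 2 := by
  unfold scale; rw [pow_succ, mul_inv]; ring

theorem four_pow_mul_scale_sq (s : ℕ) : (4 : ℝ) ^ s * scale s ^ 2 = 1 := by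
  have h4 : (4 : ℝ) ^ s = (2 ^ s) ^ 2 := by rw [← pow_mul, mul_comm, pow_mul]; norm_num
  rw [h4, scale, ← mul_pow, mul_inv_cancel₀ (by positivity), one_pow]

theorem scale_le_clippedGap (i : Fin K) : scale s ≤ clippedGap m s i := le_max_left _ _

theorem gap_le_clippedGap (i : Fin K) : gap m i ≤ clippedGap m s i := le_max_right _ _

theorem clippedGap_pos (i : Fin K) : 0 < clippedGap m s i :=
  (scale_pos s).trans_le (scale_le_clippedGap m s i)

theorem self_mem_nbhd (i : Fin K) : i ∈ nbhd G i := by simp [nbhd]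

theorem mem_nbhd_comm (i j : Fin K) : i ∈ nbhd G j ↔ j ∈ nbhd G i := by
  simp only [nbhd, Finset.mem_filter, Finset.mem_univ, true_and]
  rw [G.adj_comm, eq_comm]

theorem exists_eq_best (hK : 1 ≤ K) : ∃ i, m i = best m := by
  have : Nonempty (Fin K) := ⟨⟨0, hK⟩⟩
  exact exists_eq_ciSup_of_finite

theorem phaseValue_le {x : Fin K → ℝ} (hx : ∀ i, 0 ≤ x i)
    (hc : ∀ i, gap m i ≤ 2 * scale s → 1 / scale s ^ 2 ≤ ∑ j ∈ nbhd G i, x j) :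
    phaseValue G m s ≤ ∑ i, clippedGap m s i * x i := by
  refine csInf_le ⟨0, ?_⟩ ⟨x, hx, hc, rfl⟩
  rintro _ ⟨y, hy, -, rfl⟩
  exact Finset.sum_nonneg fun i _ => mul_nonneg (clippedGap_pos m s i).le (hy i)

theorem le_phaseValue {v : ℝ} (h : ∀ x : Fin K → ℝ, (∀ i, 0 ≤ x i) →
    (∀ i, gap m i ≤ 2 * scale s → 1 / scale s ^ 2 ≤ ∑ j ∈ nbhd G i, x j) →
      v ≤ ∑ i, clippedGap m s i * x i) : v ≤ phaseValue G m s := by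
  refine le_csInf ⟨_, fun _ => 1 / scale s ^ 2, fun _ => by positivity, fun i _ => ?_, rfl⟩ ?_
  · exact Finset.single_le_sum (f := fun _ => 1 / scale s ^ 2) (fun _ _ => by positivity)
      (self_mem_nbhd G i)
  · rintro _ ⟨y, hy, hc, rfl⟩
    exact h y hy hc

theorem one_div_scale_le_phaseValue (hK : 1 ≤ K) : 1 / scale s ≤ phaseValue G m s := by
  have hs := scale_pos s
  refine le_phaseValue G m s fun x hx hc => ?_
  obtain ⟨i, hi⟩ := exists_eq_best m hK
  have h1 := hc i (by simp only [gap, hi, sub_self]; positivity)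
  calc 1 / scale s = scale s * (1 / scale s ^ 2) := by field_simp
    _ ≤ scale s * ∑ j ∈ nbhd G i, x j := by gcongr
    _ ≤ scale s * ∑ j, x j := by
        exact mul_le_mul_of_nonneg_left
          (Finset.sum_le_sum_of_subset_of_nonneg (Finset.subset_univ _) fun j _ _ => hx j) hs.le
    _ ≤ ∑ j, clippedGap m s j * x j := by
        rw [Finset.mul_sum]
        exact Finset.sum_le_sum fun j _ =>
          mul_le_mul_of_nonneg_right (scale_le_clippedGap m s j) (hx j)

end LP

/-! ### Lower bound for one phase -/

section Lower

variable {K : ℕ} (G : SimpleGraph (Fin K)) (π : Policy K)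

theorem chargeSum_mem_Icc {E : (t : ℕ) → Set (Fin t → Round K)} {c : Fin K → ℝ} {b : ℝ}
    (hc : ∀ a, c a ∈ Set.Icc 0 b) (T : ℕ) (h : Fin T → Round K) :
    chargeSum E c T h ∈ Set.Icc 0 (T * b) := by
  classical
  induction T with
  | zero => simp [chargeSum]
  | succ T ih =>
    have h1 := ih (Fin.init h)
    have h2 := hc (h (Fin.last T)).1
    rw [chargeSum]
    push_cast
    constructor <;> split_ifs <;> nlinarith [h1.1, h1.2, h2.1, h2.2, h2.1.trans h2.2]

/-- The histories whose total charge is still below the budget `B`. -/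
def belowBudget (c : Fin K → ℝ) (B : ℝ) (t : ℕ) : Set (Fin t → Round K) :=
  {h | chargeSum (fun _ => Set.univ) c t h < B}

theorem measurableSet_belowBudget (c : Fin K → ℝ) (B : ℝ) (t : ℕ) :
    MeasurableSet (belowBudget (K := K) c B t) :=
  measurable_chargeSum (fun _ => MeasurableSet.univ) t measurableSet_Iio

theorem init_mem_belowBudget {c : Fin K → ℝ} (hc : ∀ a, 0 ≤ c a) {B : ℝ} {t : ℕ}
    {h : Fin (t + 1) → Round K} (hh : h ∈ belowBudget c B (t + 1)) :
    Fin.init h ∈ belowBudget c B t := by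
  simp only [belowBudget, Set.mem_ofPred_eq, chargeSum, Set.mem_univ, if_true] at hh ⊢
  linarith [hc (h (Fin.last t)).1]

/-- A charge that stops when it exceeds the budget `B` overshoots it by at most one round. -/
theorem chargeSum_belowBudget_mem {c : Fin K → ℝ} {δ b : ℝ} (hδ : ∀ a, δ ≤ c a)
    (hb : ∀ a, c a ≤ b) (hδ0 : 0 ≤ δ) {B : ℝ} (hB : 0 < B) (T : ℕ)
    (h : Fin T → Round K) (hT : B ≤ T * δ) :
    chargeSum (belowBudget c B) c T h ∈ Set.Icc B (B + b) := by
  classical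
  have hc : ∀ a, 0 ≤ c a := fun a => hδ0.trans (hδ a)
  have key : ∀ (T : ℕ) (h : Fin T → Round K),
      (h ∈ belowBudget c B T → chargeSum (belowBudget c B) c T h =
        chargeSum (fun _ => Set.univ) c T h ∧ T * δ ≤ chargeSum (fun _ => Set.univ) c T h) ∧
      (h ∉ belowBudget c B T → chargeSum (belowBudget c B) c T h ∈ Set.Icc B (B + b)) := by
    intro T
    induction T with
    | zero =>
      intro h
      have : h ∈ belowBudget c B 0 := by
        rw [belowBudget, Set.mem_ofPred_eq]; simpa [chargeSum] using hB
      exact ⟨fun _ => by simp [chargeSum], fun hn => absurd this hn⟩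
    | succ T ih =>
      intro h
      obtain ⟨h1, h2⟩ := ih (Fin.init h)
      by_cases hi : Fin.init h ∈ belowBudget c B T
      · obtain ⟨h3, h4⟩ := h1 hi
        have e1 : chargeSum (belowBudget c B) c (T + 1) h =
            chargeSum (fun _ => Set.univ) c (T + 1) h := by
          simp only [chargeSum, hi, if_true, h3, Set.mem_univ]
        have e2 : chargeSum (fun _ => Set.univ) c (T + 1) h =
            chargeSum (fun _ => Set.univ) c T (Fin.init h) + c (h (Fin.last T)).1 := by
          simp [chargeSum]
        refine ⟨fun _ => ⟨e1, ?_⟩, fun hn => ?_⟩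
        · rw [e2]; push_cast; linarith [hδ (h (Fin.last T)).1]
        · rw [e1]
          simp only [belowBudget, Set.mem_ofPred_eq, not_lt] at hn hi
          refine ⟨hn, ?_⟩
          rw [e2]; linarith [hb (h (Fin.last T)).1]
      · have hn : h ∉ belowBudget c B (T + 1) := fun hc' => hi (init_mem_belowBudget hc hc')
        refine ⟨fun hc' => absurd hc' hn, fun _ => ?_⟩
        have e1 : chargeSum (belowBudget c B) c (T + 1) h =
            chargeSum (belowBudget c B) c T (Fin.init h) := by
          simp [chargeSum, hi]
        rw [e1]
        exact h2 hi
  by_cases hh : h ∈ belowBudget c B T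
  · obtain ⟨-, h2⟩ := (key T h).1 hh
    rw [belowBudget, Set.mem_ofPred_eq] at hh
    linarith
  · exact (key T h).2 hh

theorem best_le {m : Fin K → ℝ} {v : ℝ} (hK : 1 ≤ K) (h : ∀ i, m i ≤ v) : best m ≤ v := by
  have : Nonempty (Fin K) := ⟨⟨0, hK⟩⟩
  exact ciSup_le h

/-- The means in which arm `i` is raised above the best arm by the scale of the phase; the base
means are `l * m`. -/
noncomputable def raised (m : Fin K → ℝ) (l : ℝ) (s : ℕ) (i : Fin K) : Fin K → ℝ :=
  Function.update (fun a => l * m a) i (l * m i + l * (gap m i + scale s))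

variable {m : Fin K → ℝ} {l : ℝ} {s : ℕ}

theorem raised_self (i : Fin K) : raised m l s i i = l * (best m + scale s) := by
  simp only [raised, Function.update_self, gap]; ring

theorem le_gap_raised (hl : 1 / 2 ≤ l) {i a : Fin K} (ha : a ≠ i) :
    clippedGap m s a / 2 ≤ gap (raised m l s i) a := by
  have h1 := le_best (raised m l s i) i
  rw [raised_self] at h1
  have h2 : raised m l s i a = l * m a := by simp [raised, ha]
  have h3 : l * (scale s + gap m a) ≤ gap (raised m l s i) a := by
    have e : gap (raised m l s i) a = best (raised m l s i) - l * m a := by rw [← h2, gap]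
    rw [e, gap]; linarith
  have h4 := gap_nonneg m a
  have h5 := scale_pos s
  refine le_trans ?_ h3
  have : clippedGap m s a ≤ scale s + gap m a := max_le (by linarith) (by linarith)
  nlinarith

theorem entropy_raised_le (hl0 : 0 ≤ l) (hl1 : l ≤ 1) {i : Fin K}
    (hi : gap m i ≤ 2 * scale s) :
    (l * (gap m i + scale s)) ^ 2 / (2 * (1 / NNReal.sqrt 2 : NNReal)) ≤ 9 * scale s ^ 2 := by
  have h1 := gap_nonneg m i
  have h2 := scale_pos s
  have h3 : l * (gap m i + scale s) ≤ 3 * scale s := by nlinarith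
  have h4 : 0 ≤ l * (gap m i + scale s) := by positivity
  have h5 : (1 : ℝ) ≤ 2 * (1 / NNReal.sqrt 2 : NNReal) := by
    push_cast
    rw [mul_one_div, le_div_iff₀ (by positivity), one_mul]
    rw [Real.sqrt_le_left (by norm_num)]
    norm_num
  calc _ ≤ (l * (gap m i + scale s)) ^ 2 := div_le_self (sq_nonneg _) h5
    _ ≤ (3 * scale s) ^ 2 := by gcongr
    _ = _ := by ring

theorem integral_chargeSum_sum (ν : Measure (Fin K → ℝ)) [IsProbabilityMeasure ν]
    {E : (t : ℕ) → Set (Fin t → Round K)} (hE : ∀ t, MeasurableSet (E t)) (c : Fin K → ℝ) (T : ℕ) :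
    ∫ h, chargeSum E c T h ∂(historyLaw G ν π T) =
      ∑ j, c j * ∫ h, chargeSum E (fun a => if a = j then 1 else 0) T h
        ∂(historyLaw G ν π T) := by
  have h1 : c = fun a => ∑ j, c j * (if a = j then 1 else 0) := by funext a; simp
  conv_lhs => rw [h1]
  simp only [chargeSum_sum]
  rw [integral_finsetSum _ fun j _ => (integrable_chargeSum hE T).const_mul _]
  simp only [integral_const_mul]

/-- If the phase LP is expensive, the plays that fit into a small budget leave some arm of the
phase unobserved, and this arm can be raised. -/
theorem exists_raised_of_large (hK : 1 ≤ K) (hm : ∀ i, m i ∈ Set.Icc (0 : ℝ) 1)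
    (hl : 1 / 2 ≤ l) (hl1 : l ≤ 1) (hD : 288 / scale s ≤ phaseValue G m s) :
    ∃ i, gap m i ≤ 2 * scale s ∧ ∀ T : ℕ, 2 * (phaseValue G m s / scale s) ≤ T →
      phaseValue G m s / 4608 ≤ regret G (gaussianEnv (raised m l s i)) π T := by
  classical
  set D := phaseValue G m s with hDdef
  have hs := scale_pos s
  have hs1 := scale_le_one s
  have hD1 : 288 ≤ D * scale s := by rwa [div_le_iff₀ hs] at hD
  have hD2 : 288 ≤ D := by nlinarith
  -- the budget for the clipped cost of the plays
  set B : ℝ := D / 288 with hB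
  have hB1 : 1 ≤ B := by rw [hB]; linarith
  set c : Fin K → ℝ := clippedGap m s with hc
  have hc1 : ∀ a, c a ≤ 1 := fun a => max_le hs1 (by
    rw [gap]; linarith [best_le hK fun i => (hm i).2, (hm a).1])
  have hc0 : ∀ a, 0 ≤ c a := fun a => (clippedGap_pos m s a).le
  set T₀ := ⌈B / scale s⌉₊ with hT₀
  have hT₀B : B ≤ T₀ * scale s := by
    have := Nat.le_ceil (B / scale s)
    rwa [div_le_iff₀ hs] at this
  set E : (t : ℕ) → Set (Fin t → Round K) := belowBudget c B with hE
  have hEm : ∀ t, MeasurableSet (E t) := measurableSet_belowBudget c B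
  have hF : ∀ h : Fin T₀ → Round K, chargeSum E c T₀ h ∈ Set.Icc B (B + 1) := fun h =>
    chargeSum_belowBudget_mem (scale_le_clippedGap m s) hc1 hs.le (by linarith) T₀ h hT₀B
  set μ := historyLaw G (gaussianEnv fun a => l * m a) π T₀ with hμ
  set n : Fin K → ℝ := fun j => ∫ h, chargeSum E (fun a => if a = j then 1 else 0) T₀ h ∂μ with hn
  have hn0 : ∀ j, 0 ≤ n j := fun j => integral_nonneg fun h =>
    (chargeSum_mem_Icc (b := 1) (fun a => by split_ifs <;> simp) T₀ h).1
  have hint : ∀ c : Fin K → ℝ, ∫ h, chargeSum E c T₀ h ∂μ = ∑ j, c j * n j :=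
    fun c => integral_chargeSum_sum G π _ hEm c T₀
  have hFi : Integrable (chargeSum E c T₀) μ := integrable_chargeSum
    (μ := fun T => historyLaw G (gaussianEnv fun a => l * m a) π T) hEm T₀
  have hF1 : B ≤ ∑ j, c j * n j := by
    rw [← hint]
    have := integral_mono (integrable_const B) hFi fun h => (hF h).1
    simpa using this
  have hF2 : ∑ j, c j * n j ≤ B + 1 := by
    rw [← hint]
    have := integral_mono hFi (integrable_const (B + 1)) fun h => (hF h).2
    simpa using this
  -- the plays scaled by `72` cost less than the LP, hence violate one of its constraints
  obtain ⟨i, hi, hni⟩ : ∃ i, gap m i ≤ 2 * scale s ∧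
      ∑ j ∈ nbhd G i, 72 * n j < 1 / scale s ^ 2 := by
    by_contra! hcon
    have h1 := phaseValue_le G m s (x := fun j => 72 * n j)
      (fun j => mul_nonneg (by norm_num) (hn0 j)) hcon
    have h2 : ∑ j, clippedGap m s j * (72 * n j) = 72 * ∑ j, c j * n j := by
      rw [Finset.mul_sum]; exact Finset.sum_congr rfl fun j _ => by ring
    rw [h2, ← hDdef] at h1
    have : D = 288 * B := by rw [hB]; ring
    linarith
  rw [← Finset.mul_sum] at hni
  refine ⟨i, hi, fun T hT => ?_⟩
  have hTT : T₀ ≤ T := by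
    rw [hT₀]
    refine Nat.ceil_le.2 (le_trans ?_ hT)
    rw [hB]
    have : 0 < D / scale s := by positivity
    have h3 : D / 288 / scale s = D / scale s / 288 := by ring
    rw [h3]; linarith
  -- the charge that stays regret when arm `i` is raised, normalized to be at most `1`
  set c' : Fin K → ℝ := fun a => if a = i then 0 else c a / (B + 1) with hc'
  have hc'0 : ∀ a, 0 ≤ c' a := fun a => by
    simp only [hc']; split_ifs
    · exact le_rfl
    · exact div_nonneg (hc0 a) (by linarith)
  have hle : ∀ h : Fin T₀ → Round K, chargeSum E c' T₀ h ≤ chargeSum E c T₀ h / (B + 1) := by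
    have : ∀ (t : ℕ) (h : Fin t → Round K),
        chargeSum E c' t h ≤ chargeSum E c t h / (B + 1) := by
      intro t
      induction t with
      | zero => simp [chargeSum]
      | succ t ih =>
        intro h
        simp only [chargeSum, add_div]
        refine add_le_add (ih _) ?_
        split_ifs
        · simp only [hc']; split_ifs
          · exact div_nonneg (hc0 _) (by linarith)
          · exact le_rfl
        · simp
    exact this T₀
  have hmain := le_regret_raise G π (fun a => l * m a) i (l * (gap m i + scale s))
    (J := E) (E := E) hEm hEm (fun t h hh => ⟨init_mem_belowBudget hc0 hh,
      init_mem_belowBudget hc0 hh⟩) (c := c') (S := (B + 1) / 2) (by linarith) hTT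
    (fun h => ⟨(chargeSum_mem_Icc (b := 1) (fun a => ⟨hc'0 a, by
        simp only [hc']; split_ifs
        · norm_num
        · rw [div_le_one (by linarith)]; linarith [hc1 a]⟩) T₀ h).1, (hle h).trans (by
      rw [div_le_one (by linarith)]; exact (hF h).2)⟩)
    (fun a => by
      change _ ≤ gap (raised m l s i) a
      simp only [hc']
      split_ifs with ha
      · rw [mul_zero]; exact gap_nonneg _ _
      · refine le_trans (le_of_eq ?_) (le_gap_raised (s := s) (m := m) hl ha)
        have : B + 1 ≠ 0 := by linarith
        field_simp
        rfl)
  refine le_trans ?_ hmain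
  rw [← hμ, hint c']
  have hobs : ∫ h, chargeSum E (obs G i) T₀ h ∂μ = ∑ j ∈ nbhd G i, n j := by
    rw [hint, ← Finset.sum_filter_add_sum_filter_not Finset.univ (fun j => j ∈ nbhd G i)]
    have e1 : ∑ j with j ∉ nbhd G i, obs G i j * n j = 0 :=
      Finset.sum_eq_zero fun j hj => by
        have := (Finset.mem_filter.1 hj).2
        rw [← mem_nbhd_comm] at this
        simp [obs, this]
    rw [e1, add_zero]
    refine Finset.sum_congr (by ext; simp) fun j hj => ?_
    rw [← mem_nbhd_comm] at hj
    simp [obs, hj]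
  rw [hobs]
  have hsum : ∑ j, c' j * n j = ((∑ j, c j * n j) - c i * n i) / (B + 1) := by
    rw [Finset.sum_eq_sum_sdiff_singleton_add (Finset.mem_univ i) (fun j => c j * n j),
      Finset.sum_eq_sum_sdiff_singleton_add (Finset.mem_univ i) (fun j => c' j * n j)]
    simp only [hc', if_true, zero_mul, add_zero, add_sub_cancel_right, Finset.sum_div]
    refine Finset.sum_congr rfl fun j hj => ?_
    have : j ≠ i := by simpa using hj
    simp only [this, if_false]
    ring
  have hci : c i ≤ 2 * scale s := max_le (by linarith) hi
  have hO0 : 0 ≤ ∑ j ∈ nbhd G i, n j := Finset.sum_nonneg fun j _ => hn0 j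
  have hnO : n i ≤ ∑ j ∈ nbhd G i, n j :=
    Finset.single_le_sum (f := n) (fun j _ => hn0 j) (self_mem_nbhd G i)
  have hO : scale s ^ 2 * ∑ j ∈ nbhd G i, n j ≤ 1 / 72 := by
    rw [lt_div_iff₀ (by positivity)] at hni
    linarith
  have hent := entropy_raised_le (m := m) (s := s) (by linarith) hl1 hi
  -- the entropy of the observations of arm `i`
  have hkl : (l * (gap m i + scale s)) ^ 2 / (2 * (1 / NNReal.sqrt 2 : NNReal)) *
      ∑ j ∈ nbhd G i, n j ≤ 1 / 8 := by
    calc _ ≤ 9 * scale s ^ 2 * ∑ j ∈ nbhd G i, n j := mul_le_mul_of_nonneg_right hent hO0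
      _ ≤ 1 / 8 := by linarith
  have hcn : c i * n i ≤ B / 36 := by
    have h1 : c i * n i ≤ 2 * scale s * ∑ j ∈ nbhd G i, n j :=
      mul_le_mul hci hnO (hn0 i) (by positivity)
    have h2 : 1 ≤ B * scale s := by rw [hB]; linarith
    have h3 : scale s * (c i * n i) ≤ scale s * (B / 36) := by nlinarith
    exact le_of_mul_le_mul_left h3 hs
  have hX : 35 / 72 ≤ ∑ j, c' j * n j := by
    rw [hsum, le_div_iff₀ (by linarith)]
    linarith
  have hfin : 1 / 4 ≤ ∑ j, c' j * n j - (l * (gap m i + scale s)) ^ 2 /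
      (2 * (1 / NNReal.sqrt 2 : NNReal)) * ∑ j ∈ nbhd G i, n j := by linarith
  have : D / 4608 ≤ (B + 1) / 2 / 2 * (1 / 4) := by rw [hB]; linarith
  exact this.trans (mul_le_mul_of_nonneg_left hfin (by linarith))

/-- With two arms in the phase, one of them is played at most half of the time during the first
`1 / scale²` rounds. -/
theorem exists_raised_of_two (hl : 1 / 2 ≤ l) (hl1 : l ≤ 1) (i₁ i₂ : Fin K) (hne : i₁ ≠ i₂)
    (h₁ : gap m i₁ ≤ 2 * scale s) (h₂ : gap m i₂ ≤ 2 * scale s) :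
    ∃ i, gap m i ≤ 2 * scale s ∧ ∀ T : ℕ, 2 * (1 / scale s ^ 2) ≤ T →
      1 / scale s / 768 ≤ regret G (gaussianEnv (raised m l s i)) π T := by
  classical
  have hs := scale_pos s
  have hs1 := scale_le_one s
  have hs2 : 1 ≤ 1 / scale s ^ 2 := by
    rw [le_div_iff₀ (by positivity), one_mul]; exact pow_le_one₀ hs.le hs1
  set N := ⌊1 / scale s ^ 2 / 72⌋₊ with hN
  have hN1 : (N : ℝ) ≤ 1 / scale s ^ 2 / 72 := Nat.floor_le (by positivity)
  have hN2 : 1 / scale s ^ 2 / 72 ≤ (N + 1 : ℕ) := by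
    push_cast; exact (Nat.lt_floor_add_one _).le
  set T₀ := N + 1 with hT₀
  have hT₀0 : (0 : ℝ) < T₀ := by positivity
  -- the entropy of the last of the `T₀` rounds need not be paid, as the arm of round `T₀` is chosen
  -- before its reward is observed; this matters if `T₀ = 1`
  set E : (t : ℕ) → Set (Fin t → Round K) := fun t => {_h | t < T₀} with hE
  set J : (t : ℕ) → Set (Fin t → Round K) := fun t => {_h | t + 1 < T₀} with hJ
  have hEm : ∀ t, MeasurableSet (E t) := fun t => MeasurableSet.const _
  have hJm : ∀ t, MeasurableSet (J t) := fun t => MeasurableSet.const _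
  have hEJ : ∀ t (h : Fin (t + 1) → Round K), h ∈ E (t + 1) →
      Fin.init h ∈ J t ∧ Fin.init h ∈ E t := fun t h hh => ⟨hh, Nat.lt_of_succ_lt hh⟩
  set μ := historyLaw G (gaussianEnv fun a => l * m a) π T₀ with hμ
  set c : Fin K → Fin K → ℝ := fun i a => if a = i then 0 else 1 / T₀ with hc
  have hci : ∀ i a, c i a ∈ Set.Icc (0 : ℝ) (1 / T₀) := fun i a => by
    simp only [hc]; split_ifs
    · exact ⟨le_rfl, by positivity⟩
    · exact ⟨by positivity, le_rfl⟩
  have hX : ∀ i (h : Fin T₀ → Round K), chargeSum E (c i) T₀ h ∈ Set.Icc (0 : ℝ) 1 := fun i h => by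
    have := chargeSum_mem_Icc (E := E) (hci i) T₀ h
    rwa [mul_one_div_cancel hT₀0.ne'] at this
  have hXi : ∀ i, Integrable (chargeSum E (c i) T₀) μ := fun i => integrable_chargeSum
    (μ := fun T => historyLaw G (gaussianEnv fun a => l * m a) π T) hEm T₀
  have hsum : ∀ h : Fin T₀ → Round K, 1 ≤ chargeSum E (c i₁) T₀ h + chargeSum E (c i₂) T₀ h := by
    have : ∀ (t : ℕ) (h : Fin t → Round K), t ≤ T₀ →
        t * (1 / T₀ : ℝ) ≤ chargeSum E (c i₁) t h + chargeSum E (c i₂) t h := by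
      intro t
      induction t with
      | zero => intro h _; simp [chargeSum]
      | succ t ih =>
        intro h ht
        have h1 := ih (Fin.init h) (by omega)
        have hin : (Fin.init h : Fin t → Round K) ∈ E t := by
          change t < T₀; omega
        have h2 : 1 / (T₀ : ℝ) ≤ c i₁ (h (Fin.last t)).1 + c i₂ (h (Fin.last t)).1 := by
          by_cases ha : (h (Fin.last t)).1 = i₁
          · have : (h (Fin.last t)).1 ≠ i₂ := fun hc' => hne (ha.symm.trans hc')
            have e : c i₂ (h (Fin.last t)).1 = 1 / T₀ := by simp only [hc, this, if_false]
            linarith [(hci i₁ (h (Fin.last t)).1).1]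
          · have e : c i₁ (h (Fin.last t)).1 = 1 / T₀ := by simp only [hc, ha, if_false]
            linarith [(hci i₂ (h (Fin.last t)).1).1]
        simp only [chargeSum, hin, if_true]
        push_cast
        linarith
    intro h
    have := this T₀ h le_rfl
    rwa [mul_one_div_cancel hT₀0.ne'] at this
  have hexp : 1 ≤ ∫ h, chargeSum E (c i₁) T₀ h ∂μ + ∫ h, chargeSum E (c i₂) T₀ h ∂μ := by
    rw [← integral_add (hXi i₁) (hXi i₂)]
    have := integral_mono (integrable_const (1 : ℝ)) ((hXi i₁).add (hXi i₂)) hsum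
    simpa using this
  obtain ⟨i, hi, hhalf⟩ : ∃ i, gap m i ≤ 2 * scale s ∧
      1 / 2 ≤ ∫ h, chargeSum E (c i) T₀ h ∂μ := by
    by_cases h : 1 / 2 ≤ ∫ h, chargeSum E (c i₁) T₀ h ∂μ
    · exact ⟨i₁, h₁, h⟩
    · exact ⟨i₂, h₂, by linarith⟩
  refine ⟨i, hi, fun T hT => ?_⟩
  have hTT : T₀ ≤ T := by
    have : (T₀ : ℝ) ≤ T := by rw [hT₀]; push_cast; linarith
    exact_mod_cast this
  have hmain := le_regret_raise G π (fun a => l * m a) i (l * (gap m i + scale s))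
    (J := J) (E := E) hJm hEm hEJ (c := c i) (S := T₀ * (scale s / 2)) (by positivity) hTT (hX i)
    (fun a => by
      change _ ≤ gap (raised m l s i) a
      simp only [hc]
      split_ifs with ha
      · rw [mul_zero]; exact gap_nonneg _ _
      · refine le_trans (le_of_eq_of_le ?_ (div_le_div_of_nonneg_right
          (scale_le_clippedGap m s a) zero_le_two)) (le_gap_raised (s := s) (m := m) hl ha)
        field_simp)
  refine le_trans ?_ hmain
  have hobs : ∫ h, chargeSum J (obs G i) T₀ h ∂μ ≤ N := by
    have hb : ∀ (t : ℕ) (h : Fin t → Round K), chargeSum J (obs G i) t h ≤ min (t : ℝ) N := by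
      intro t
      induction t with
      | zero => intro h; simp [chargeSum]
      | succ t ih =>
        intro h
        have h1 := le_min_iff.1 (ih (Fin.init h))
        have h2 := obs_le_one G i (h (Fin.last t)).1
        simp only [chargeSum]
        by_cases hj : (Fin.init h : Fin t → Round K) ∈ J t
        · have : t + 1 < T₀ := hj
          have : ((t : ℝ) + 1) ≤ N := by
            have : t + 1 ≤ N := by omega
            exact_mod_cast this
          simp only [hj, if_true]
          push_cast
          exact le_min (by linarith) (by linarith)
        · simp only [hj, if_false, add_zero]
          push_cast
          exact le_min (by linarith) h1.2
    have := integral_mono (integrable_chargeSum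
      (μ := fun T => historyLaw G (gaussianEnv fun a => l * m a) π T) (c := obs G i) hJm T₀)
      (integrable_const (N : ℝ)) fun h => (le_min_iff.1 (hb T₀ h)).2
    simpa using this
  have hO0 : 0 ≤ ∫ h, chargeSum J (obs G i) T₀ h ∂μ := integral_nonneg fun h =>
    (chargeSum_mem_Icc (b := 1) (fun a => ⟨obs_nonneg G i a, obs_le_one G i a⟩) T₀ h).1
  have hent := entropy_raised_le (m := m) (s := s) (by linarith) hl1 hi
  have hkl : (l * (gap m i + scale s)) ^ 2 / (2 * (1 / NNReal.sqrt 2 : NNReal)) *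
      ∫ h, chargeSum J (obs G i) T₀ h ∂μ ≤ 1 / 8 := by
    calc _ ≤ 9 * scale s ^ 2 * (1 / scale s ^ 2 / 72) :=
          mul_le_mul hent (hobs.trans hN1) hO0 (by positivity)
      _ = 1 / 8 := by field_simp; norm_num
  have hfin : 3 / 8 ≤ ∫ h, chargeSum E (c i) T₀ h ∂μ - (l * (gap m i + scale s)) ^ 2 /
      (2 * (1 / NNReal.sqrt 2 : NNReal)) * ∫ h, chargeSum J (obs G i) T₀ h ∂μ := by linarith
  have h5 : 1 / scale s / 768 ≤ T₀ * (scale s / 2) / 2 * (3 / 8) := by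
    have : 1 / scale s / 72 ≤ T₀ * scale s := by
      have := mul_le_mul_of_nonneg_right hN2 hs.le
      refine le_trans (le_of_eq ?_) this
      field_simp
    linarith
  exact h5.trans (mul_le_mul_of_nonneg_left hfin (by positivity))

/-- The lower bound of one phase. -/
theorem exists_raised (hK : 1 ≤ K) (hm : ∀ i, m i ∈ Set.Icc (0 : ℝ) 1)
    (hl : 1 / 2 ≤ l) (hl1 : l ≤ 1) (i₁ i₂ : Fin K) (hne : i₁ ≠ i₂)
    (h₁ : gap m i₁ ≤ 2 * scale s) (h₂ : gap m i₂ ≤ 2 * scale s) :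
    ∃ i, gap m i ≤ 2 * scale s ∧ ∀ T : ℕ, 2 * (phaseValue G m s / scale s) ≤ T →
      phaseValue G m s / 300000 ≤ regret G (gaussianEnv (raised m l s i)) π T := by
  have hs := scale_pos s
  have hD0 := one_div_scale_le_phaseValue G m s hK
  have hs' : 0 < 1 / scale s := by positivity
  by_cases hD : 288 / scale s ≤ phaseValue G m s
  · obtain ⟨i, hi, h⟩ := exists_raised_of_large G π hK hm hl hl1 hD
    exact ⟨i, hi, fun T hT => le_trans (by linarith) (h T hT)⟩
  · obtain ⟨i, hi, h⟩ := exists_raised_of_two G π hl hl1 i₁ i₂ hne h₁ h₂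
    refine ⟨i, hi, fun T hT => le_trans ?_ (h T (le_trans ?_ hT))⟩
    · have : 288 / scale s = 288 * (1 / scale s) := by ring
      linarith
    · have : 1 / scale s ^ 2 = 1 / scale s / scale s := by field_simp
      rw [this]
      gcongr

end Lower

/-! ### Lower bound -/

section Phases

variable {K : ℕ} {G : SimpleGraph (Fin K)} {m : Fin K → ℝ}

theorem exists_gap_eq_gapMin (h : ∃ i, 0 < gap m i) : ∃ i, 0 < gap m i ∧ gap m i = gapMin m := by
  have hne : {d | ∃ i, 0 < gap m i ∧ d = gap m i}.Nonempty := by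
    obtain ⟨i, hi⟩ := h; exact ⟨_, i, hi, rfl⟩
  have hfin : {d | ∃ i, 0 < gap m i ∧ d = gap m i}.Finite :=
    (Set.finite_range (gap m)).subset (by rintro _ ⟨i, -, rfl⟩; exact ⟨i, rfl⟩)
  obtain ⟨i, hi, he⟩ := hne.csInf_mem hfin
  exact ⟨i, hi, he.symm⟩

theorem gapMin_pos (h : ∃ i, 0 < gap m i) : 0 < gapMin m := by
  obtain ⟨i, hi, he⟩ := exists_gap_eq_gapMin h
  rwa [← he]

theorem gapMin_le {i : Fin K} (hi : 0 < gap m i) : gapMin m ≤ gap m i :=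
  csInf_le ⟨0, by rintro _ ⟨j, hj, rfl⟩; exact hj.le⟩ ⟨i, hi, rfl⟩

theorem gap_le_one (hm : ∀ i, m i ∈ Set.Icc (0 : ℝ) 1) (i : Fin K) : gap m i ≤ 1 := by
  have hK : 1 ≤ K := by have := i.2; omega
  rw [gap]; linarith [best_le hK fun i => (hm i).2, (hm i).1]

theorem gapMin_le_one (hm : ∀ i, m i ∈ Set.Icc (0 : ℝ) 1) (h : ∃ i, 0 < gap m i) :
    gapMin m ≤ 1 := by
  obtain ⟨i, -, he⟩ := exists_gap_eq_gapMin h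
  rw [← he]; exact gap_le_one hm i

theorem mem_optArms {i : Fin K} : i ∈ optArms m ↔ gap m i = 0 := by
  simp only [optArms, Finset.mem_filter, Finset.mem_univ, true_and, gap, sub_eq_zero]
  exact eq_comm

theorem gap_pos_iff {i : Fin K} : 0 < gap m i ↔ i ∉ optArms m := by
  rw [mem_optArms]
  exact ⟨fun h => h.ne', fun h => lt_of_le_of_ne (gap_nonneg m i) (Ne.symm h)⟩

theorem card_optArms_pos (hK : 1 ≤ K) : 0 < (optArms m).card := by
  obtain ⟨i, hi⟩ := exists_eq_best m hK
  exact Finset.card_pos.2 ⟨i, mem_optArms.2 (by simp [gap, hi])⟩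

theorem mem_phases (hK : 1 ≤ K) (h : ∃ i, 0 < gap m i) {s : ℕ} :
    s ∈ phases m ↔ gapMin m * 2 ^ s ≤ (optArms m).card := by
  have hg := gapMin_pos h
  have hc : (0 : ℝ) < (optArms m).card := by exact_mod_cast card_optArms_pos hK
  rw [phases, Set.mem_ofPred_eq, Real.le_logb_iff_rpow_le (by norm_num) (by positivity),
    Real.rpow_natCast, le_div_iff₀ hg, mul_comm]

theorem zero_mem_phases (hK : 1 ≤ K) (hm : ∀ i, m i ∈ Set.Icc (0 : ℝ) 1)
    (h : ∃ i, 0 < gap m i) : 0 ∈ phases m := by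
  rw [mem_phases hK h, pow_zero, mul_one]
  have : (1 : ℝ) ≤ (optArms m).card := by exact_mod_cast card_optArms_pos hK
  exact (gapMin_le_one hm h).trans this

theorem finite_phases : (phases m).Finite :=
  (Set.finite_Iic ⌊Real.logb 2 ((optArms m).card / gapMin m)⌋₊).subset fun _ hs =>
    Nat.le_floor hs

theorem phaseValue_le_dStar {s : ℕ} (hs : s ∈ phases m) : phaseValue G m s ≤ dStar G m :=
  le_csSup (finite_phases.image _).bddAbove ⟨s, hs, rfl⟩

theorem exists_phaseValue_eq_dStar (h : (phases m).Nonempty) :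
    ∃ s ∈ phases m, phaseValue G m s = dStar G m :=
  (h.image _).csSup_mem (finite_phases.image _)

theorem exists_two_of_mem_phases (hK : 1 ≤ K) (h : ∃ i, 0 < gap m i) {s : ℕ}
    (hs : s ∈ phases m) :
    ∃ i₁ i₂ : Fin K, i₁ ≠ i₂ ∧ gap m i₁ ≤ 2 * scale s ∧ gap m i₂ ≤ 2 * scale s := by
  have hsc := scale_pos s
  rcases Nat.lt_or_ge 1 (optArms m).card with hc | hc
  · obtain ⟨i, hi, j, hj, hij⟩ := Finset.one_lt_card.1 hc
    rw [mem_optArms] at hi hj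
    exact ⟨i, j, hij, by rw [hi]; positivity, by rw [hj]; positivity⟩
  · rw [mem_phases hK h] at hs
    obtain ⟨i, hi⟩ := exists_eq_best m hK
    obtain ⟨j, hj, he⟩ := exists_gap_eq_gapMin h
    have hi0 : gap m i = 0 := by simp [gap, hi]
    refine ⟨i, j, ?_, by rw [hi0]; positivity, ?_⟩
    · rintro rfl; linarith
    · have hc1 : ((optArms m).card : ℝ) ≤ 1 := by exact_mod_cast hc
      rw [he]
      have : gapMin m ≤ scale s := by
        rw [scale, ← one_div, le_div_iff₀ (by positivity)]; linarith
      linarith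

end Phases

/-- The finite-time lower bound: both parts come from raising one arm of a phase, above the given
means or above their halves. -/
theorem lower_bound : ∃ c C : ℝ, 0 < c ∧ 0 < C ∧ ∀ (K : ℕ), 1 ≤ K → ∀ (G : SimpleGraph (Fin K))
      (m : Fin K → ℝ), (∀ i, m i ∈ Set.Icc (0 : ℝ) 1) → (∃ i, 0 < gap m i) → ∀ π : Policy K,
        (∃ m' : Fin K → ℝ, (∀ i, m' i ∈ Set.Icc (0 : ℝ) 1) ∧
          ∀ T : ℕ, C * (dStar G m * ((optArms m).card / gapMin m)) ≤ T →
            c * dStar G m ≤ regret G (gaussianEnv m') π T) ∧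
        (∀ s ∈ phases m, best m ≤ 1 - 2 * scale s →
          ∃ m' : Fin K → ℝ, (∀ i, m' i ∈ Set.Icc (0 : ℝ) 1) ∧
            (∀ i, m' i ∈ Set.Icc (m i) (m i + 2 * clippedGap m s i)) ∧
            ∀ T : ℕ, C * (phaseValue G m s / scale s) ≤ T →
              c * phaseValue G m s ≤ regret G (gaussianEnv m') π T) := by
  refine ⟨1 / 300000, 2, by norm_num, by norm_num, fun K hK G m hm hgap π => ⟨?_, ?_⟩⟩
  · obtain ⟨s, hs, hsd⟩ := exists_phaseValue_eq_dStar (G := G) ⟨0, zero_mem_phases hK hm hgap⟩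
    obtain ⟨i₁, i₂, hne, h₁, h₂⟩ := exists_two_of_mem_phases hK hgap hs
    obtain ⟨i, hi, h⟩ := exists_raised G π hK hm (l := 1 / 2) le_rfl (by norm_num) i₁ i₂ hne h₁ h₂
    have hsc := scale_pos s
    have hsc1 := scale_le_one s
    refine ⟨raised m (1 / 2) s i, fun a => ?_, fun T hT => ?_⟩
    · by_cases ha : a = i
      · subst ha
        rw [raised_self]
        have h1 := le_best m a
        have h2 := best_le hK fun i => (hm i).2
        have h3 := (hm a).1
        constructor <;> linarith
      · have : raised m (1 / 2) s i a = 1 / 2 * m a := by simp [raised, ha]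
        rw [this]
        have := hm a
        constructor <;> linarith [this.1, this.2]
    · rw [← hsd] at hT ⊢
      refine le_trans (le_of_eq (by ring)) (h T (le_trans ?_ hT))
      have hD : 0 < phaseValue G m s :=
        (by positivity : 0 < 1 / scale s).trans_le (one_div_scale_le_phaseValue G m s hK)
      rw [mem_phases hK hgap] at hs
      have hg := gapMin_pos hgap
      have : 1 / scale s ≤ (optArms m).card / gapMin m := by
        rw [scale, one_div, inv_inv, le_div_iff₀ hg]; linarith
      rw [div_eq_mul_one_div]
      gcongr
  · intro s hs hb
    obtain ⟨i₁, i₂, hne, h₁, h₂⟩ := exists_two_of_mem_phases hK hgap hs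
    obtain ⟨i, hi, h⟩ := exists_raised G π hK hm (l := 1) (by norm_num) le_rfl i₁ i₂ hne h₁ h₂
    have hsc := scale_pos s
    have hother : ∀ a, a ≠ i → raised m 1 s i a = m a := fun a ha => by simp [raised, ha]
    refine ⟨raised m 1 s i, fun a => ?_, fun a => ?_, fun T hT =>
      le_trans (le_of_eq (by ring)) (h T hT)⟩
    · by_cases ha : a = i
      · subst ha
        rw [raised_self]
        have h1 := le_best m a
        have h3 := (hm a).1
        constructor <;> linarith
      · rw [hother a ha]; exact hm a
    · have hcl := clippedGap_pos m s a
      by_cases ha : a = i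
      · subst ha
        rw [raised_self]
        have h1 := le_best m a
        have h2 := scale_le_clippedGap m s a
        have h3 := gap_le_clippedGap m s a
        rw [gap] at h3
        constructor <;> linarith
      · rw [hother a ha]; constructor <;> linarith

/-! ### Batch algorithms and their value -/

section Batch

/-- The discrete part of the memory of a batch algorithm: the stage, the levels that the algorithm
attributes to the arms, and the arms that remain to be played in the current batch. -/
def Control (K : ℕ) : Type := ℕ × (Fin K → ℕ) × List (Fin K)

instance (K : ℕ) : MeasurableSpace (Control K) := ⊤

instance (K : ℕ) : DiscreteMeasurableSpace (Control K) := ⟨fun _ => trivial⟩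

instance (K : ℕ) : Countable (Control K) := by unfold Control; infer_instance

/-- A deterministic algorithm that works in batches. The batch of stage `s` is a list of arms that
is fixed in advance given the levels; at its end, new levels are computed from the sums of the
rewards observed in this batch. -/
structure BatchAlg (K : ℕ) where
  /-- The arms played in the batch of a stage, given the levels. -/
  plan : ℕ → (Fin K → ℕ) → List (Fin K)
  /-- The new levels, given the stage, the old levels and the sums of the observed rewards. -/
  next : ℕ → (Fin K → ℕ) → (Fin K → ℝ) → Fin K → ℕ
  measurable_next : ∀ s lev, Measurable (next s lev)
  /-- The stage of the first batch. -/
  start : ℕ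
  /-- An arm that is played when no arm is planned, which never happens if plans are nonempty. -/
  dflt : Fin K

variable {K : ℕ} (A : BatchAlg K)

namespace BatchAlg

/-- The memory at the start of a batch. -/
def fresh (s : ℕ) (lev : Fin K → ℕ) : Control K × (Fin K → ℝ) := ((s, lev, A.plan s lev), 0)

/-- The arm that is played next. -/
def act (σ : Control K × (Fin K → ℝ)) : Fin K := σ.1.2.2.headD A.dflt

/-- The memory after one more round. -/
def update (p : (Control K × (Fin K → ℝ)) × Round K) : Control K × (Fin K → ℝ) :=
  match p.1.1.2.2 with
  | _ :: b :: l => ((p.1.1.1, p.1.1.2.1, b :: l), p.1.2 + p.2.2)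
  | _ => A.fresh (p.1.1.1 + 1) (A.next p.1.1.1 p.1.1.2.1 (p.1.2 + p.2.2))

/-- The memory after a history. -/
def state : (t : ℕ) → (Fin t → Round K) → Control K × (Fin K → ℝ)
  | 0, _ => A.fresh A.start fun _ => A.start
  | t + 1, h => A.update (state t (Fin.init h), h (Fin.last t))

theorem measurable_act : Measurable A.act :=
  (measurable_of_countable fun c : Control K => c.2.2.headD A.dflt).comp measurable_fst

theorem measurable_fresh (s : ℕ) : Measurable (A.fresh s) :=
  measurable_of_countable _

theorem measurable_update : Measurable A.update := by
  have h : Measurable fun q : Control K × ((Fin K → ℝ) × Round K) =>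
      A.update ((q.1, q.2.1), q.2.2) := by
    refine measurable_from_prod_countable_right fun c => ?_
    obtain ⟨s, lev, l⟩ := c
    have hs : Measurable fun x : (Fin K → ℝ) × Round K => x.1 + x.2.2 :=
      measurable_fst.add (measurable_snd.comp measurable_snd)
    rcases l with _ | ⟨a, _ | ⟨b, l⟩⟩
    · exact (A.measurable_fresh (s + 1)).comp ((A.measurable_next s lev).comp hs)
    · exact (A.measurable_fresh (s + 1)).comp ((A.measurable_next s lev).comp hs)
    · exact (measurable_const (a := ((s, lev, b :: l) : Control K))).prodMk hs
  exact h.comp ((measurable_fst.comp measurable_fst).prodMk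
    ((measurable_snd.comp measurable_fst).prodMk measurable_snd))

theorem measurable_state (t : ℕ) : Measurable (A.state t) := by
  induction t with
  | zero => exact measurable_const
  | succ t ih =>
    exact A.measurable_update.comp ((ih.comp measurable_init).prodMk (measurable_pi_apply _))

/-- The batch algorithm as a policy. -/
noncomputable def policy : Policy K where
  law _ := Kernel.deterministic (fun h => A.act (A.state _ h))
    (A.measurable_act.comp (A.measurable_state _))
  isMarkov _ := inferInstance

variable (G : SimpleGraph (Fin K)) (ν : Measure (Fin K → ℝ))

/-- The expected regret of the next `n` rounds, given the memory. -/
noncomputable def value : ℕ → Control K × (Fin K → ℝ) → ENNReal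
  | 0, _ => 0
  | n + 1, σ => ENNReal.ofReal (gap (means ν) (A.act σ)) +
      ∫⁻ r, value n (A.update (σ, feedback G (A.act σ, r))) ∂ν

theorem measurable_value [IsProbabilityMeasure ν] (n : ℕ) : Measurable (A.value G ν n) := by
  induction n with
  | zero => exact measurable_const
  | succ n ih =>
    refine ((measurable_of_finite fun a => ENNReal.ofReal (gap (means ν) a)).comp
      A.measurable_act).add ?_
    refine Measurable.lintegral_prod_right' (f := fun p : (Control K × (Fin K → ℝ)) × (Fin K → ℝ) =>
      A.value G ν n (A.update (p.1, feedback G (A.act p.1, p.2)))) ?_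
    exact ih.comp (A.measurable_update.comp (measurable_fst.prodMk
      ((measurable_feedback G).comp ((A.measurable_act.comp measurable_fst).prodMk
        measurable_snd))))

/-- The expected gap of the arm played after `t` rounds. -/
noncomputable def expectedGap (t : ℕ) : ENNReal :=
  ∫⁻ h, ENNReal.ofReal (gap (means ν) (A.act (A.state t h))) ∂(historyLaw G ν A.policy t)

/-- The value computes the expected gaps of the coming rounds. -/
theorem lintegral_value [IsProbabilityMeasure ν] (n : ℕ) : ∀ t : ℕ,
    ∫⁻ h, A.value G ν n (A.state t h) ∂(historyLaw G ν A.policy t) =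
      ∑ u ∈ Finset.range n, A.expectedGap G ν (t + u) := by
  classical
  induction n with
  | zero => intro t; simp [value]
  | succ n ih =>
    intro t
    have hg : Measurable fun h : Fin t → Round K =>
        ENNReal.ofReal (gap (means ν) (A.act (A.state t h))) :=
      (measurable_of_finite fun a => ENNReal.ofReal (gap (means ν) a)).comp
        (A.measurable_act.comp (A.measurable_state t))
    simp only [value]
    rw [lintegral_add_left hg, Finset.sum_range_succ', add_comm]
    refine congrArg₂ _ ?_ rfl
    have h1 := ih (t + 1)
    have h2 : ∀ u, t + 1 + u = t + (u + 1) := fun u => by omega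
    simp only [h2] at h1
    rw [← h1, historyLaw_eq_pathLaw, historyLaw_eq_pathLaw, lintegral_pathLaw_succ
      (f := fun h => A.value G ν n (A.state (t + 1) h))
      ((A.measurable_value G ν n).comp (A.measurable_state _))]
    refine lintegral_congr fun h => ?_
    rw [lintegral_stepKernel G ν _ h (f := fun r => A.value G ν n (A.state (t + 1)
      (appendRound (h, r))))]
    · have h2 : ∀ a, (A.policy.law t h) {a} =
          if A.act (A.state t h) = a then 1 else 0 := fun a => by
        simp only [policy]
        rw [Kernel.deterministic_apply, Measure.dirac_apply' _ (measurableSet_singleton a)]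
        simp [Set.indicator]
      simp only [h2, ite_mul, one_mul, zero_mul, Finset.sum_ite_eq, Finset.mem_univ, if_true]
      refine lintegral_congr fun r => ?_
      rw [state, init_appendRound, appendRound_last]
    · exact ((A.measurable_value G ν n).comp (A.measurable_state _)).comp
        (measurable_appendRound.comp (measurable_const.prodMk measurable_id))

theorem regret_le_of_value_le [IsProbabilityMeasure ν]
    (hν : ∀ i, Integrable (fun r : Fin K → ℝ => r i) ν) {T : ℕ} {b : ℝ} (hb : 0 ≤ b)
    (h : A.value G ν T (A.fresh A.start fun _ => A.start) ≤ ENNReal.ofReal b) :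
    regret G ν A.policy T ≤ b := by
  classical
  have h1 := A.lintegral_value G ν T 0
  have h0 : ∫⁻ h, A.value G ν T (A.state 0 h) ∂(historyLaw G ν A.policy 0) =
      A.value G ν T (A.fresh A.start fun _ => A.start) := by
    simp [state]
  simp only [h0, zero_add] at h1
  have h2 : ENNReal.ofReal (regret G ν A.policy T) =
      A.value G ν T (A.fresh A.start fun _ => A.start) := by
    rw [h1, regret_eq_sum G _ ν hν, ENNReal.ofReal_sum_of_nonneg fun t _ =>
      integral_nonneg fun h => sum_playProb_mul_nonneg _ h (gap_nonneg _)]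
    refine Finset.sum_congr rfl fun t _ => ?_
    rw [expectedGap, ofReal_integral_eq_lintegral_ofReal (integrable_sum_playProb _ _ _)
      (Filter.Eventually.of_forall fun h => sum_playProb_mul_nonneg _ h (gap_nonneg _))]
    refine lintegral_congr fun h => ?_
    have h3 : ∀ a, playProb A.policy h a = if A.act (A.state t h) = a then 1 else 0 := fun a => by
      rw [playProb, measureReal_def]
      simp only [policy]
      rw [Kernel.deterministic_apply, Measure.dirac_apply' _ (measurableSet_singleton a)]
      simp only [Set.indicator, Set.mem_singleton_iff, Pi.one_apply]
      split_ifs <;> simp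
    simp [h3]
  rw [← h2] at h
  exact (ENNReal.ofReal_le_ofReal_iff hb).1 h

end BatchAlg

/-- The expectation of a function of the sums of the observed rewards, when the arms of a list are
played. -/
noncomputable def evolve (G : SimpleGraph (Fin K)) (ν : Measure (Fin K → ℝ)) :
    List (Fin K) → ((Fin K → ℝ) → ENNReal) → (Fin K → ℝ) → ENNReal
  | [], f, u => f u
  | a :: l, f, u => ∫⁻ r, evolve G ν l f (u + (feedback G (a, r)).2) ∂ν

variable (G : SimpleGraph (Fin K)) (ν : Measure (Fin K → ℝ))

theorem evolve_mono (l : List (Fin K)) {f g : (Fin K → ℝ) → ENNReal} (h : ∀ u, f u ≤ g u) :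
    ∀ u, evolve G ν l f u ≤ evolve G ν l g u := by
  induction l with
  | nil => exact h
  | cons a l ih => exact fun u => lintegral_mono fun r => ih _

theorem measurable_evolve [IsProbabilityMeasure ν] (l : List (Fin K))
    {f : (Fin K → ℝ) → ENNReal} (hf : Measurable f) : Measurable (evolve G ν l f) := by
  induction l with
  | nil => exact hf
  | cons a l ih =>
    refine Measurable.lintegral_prod_right' (f := fun p : (Fin K → ℝ) × (Fin K → ℝ) =>
      evolve G ν l f (p.1 + (feedback G (a, p.2)).2)) ?_
    exact ih.comp (measurable_fst.add
      (measurable_snd.comp ((measurable_feedback_arm G a).comp measurable_snd)))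

theorem measurable_evolve_feedback [IsProbabilityMeasure ν] (l : List (Fin K))
    {f : (Fin K → ℝ) → ENNReal} (hf : Measurable f) (a : Fin K) (u : Fin K → ℝ) :
    Measurable fun r : Fin K → ℝ => evolve G ν l f (u + (feedback G (a, r)).2) :=
  (measurable_evolve G ν l hf).comp
    (measurable_const.add (measurable_snd.comp (measurable_feedback_arm G a)))

theorem evolve_const [IsProbabilityMeasure ν] (l : List (Fin K)) (c : ENNReal) :
    ∀ u, evolve G ν l (fun _ => c) u = c := by
  induction l with
  | nil => exact fun u => rfl
  | cons a l ih => intro u; simp [evolve, ih]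

theorem evolve_add [IsProbabilityMeasure ν] (l : List (Fin K)) {f g : (Fin K → ℝ) → ENNReal}
    (hf : Measurable f) : ∀ u, evolve G ν l (fun u => f u + g u) u =
      evolve G ν l f u + evolve G ν l g u := by
  induction l with
  | nil => exact fun u => rfl
  | cons a l ih =>
    intro u
    simp only [evolve, ih]
    exact lintegral_add_left (measurable_evolve_feedback G ν l hf a u) _

theorem evolve_const_mul [IsProbabilityMeasure ν] (l : List (Fin K)) (c : ENNReal)
    {f : (Fin K → ℝ) → ENNReal} (hf : Measurable f) : ∀ u, evolve G ν l (fun u => c * f u) u =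
      c * evolve G ν l f u := by
  induction l with
  | nil => exact fun u => rfl
  | cons a l ih =>
    intro u
    simp only [evolve, ih]
    exact lintegral_const_mul c (measurable_evolve_feedback G ν l hf a u)

theorem evolve_sum [IsProbabilityMeasure ν] {ι : Type*} (s : Finset ι) (l : List (Fin K))
    {f : ι → (Fin K → ℝ) → ENNReal} (hf : ∀ i, Measurable (f i)) (u : Fin K → ℝ) :
    evolve G ν l (fun u => ∑ i ∈ s, f i u) u = ∑ i ∈ s, evolve G ν l (f i) u := by
  classical
  induction s using Finset.induction_on with
  | empty => simp [evolve_const]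
  | insert i s hi ih =>
    simp only [Finset.sum_insert hi]
    rw [evolve_add G ν l (hf i), ih]

/-- The number of observations of arm `i` when the arms of a list are played. -/
noncomputable def obsCount (l : List (Fin K)) (i : Fin K) : ℝ := (l.map (obs G i)).sum

variable {ν} in
/-- The exponential moments of the sum of the observed rewards of a sub-Gaussian arm. -/
theorem evolve_exp_le [IsProbabilityMeasure ν] (hsub : IsSubGaussian ν) (i : Fin K) (θ : ℝ)
    (l : List (Fin K)) : ∀ (c : ℝ) (u : Fin K → ℝ),
      evolve G ν l (fun u => ENNReal.ofReal (Real.exp (θ * u i + c))) u ≤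
        ENNReal.ofReal (Real.exp (θ * u i + c +
          obsCount G l i * (θ * means ν i + θ ^ 2 / 2))) := by
  classical
  induction l with
  | nil => intro c u; simp [evolve, obsCount]
  | cons a l ih =>
    intro c u
    rw [evolve]
    refine (lintegral_mono fun r => ih c _).trans ?_
    by_cases hi : i ∈ nbhd G a
    · have h1 : ∀ r : Fin K → ℝ, θ * (u + (feedback G (a, r)).2) i + c +
          obsCount G l i * (θ * means ν i + θ ^ 2 / 2) = (θ * u i + c + θ * means ν i +
          obsCount G l i * (θ * means ν i + θ ^ 2 / 2)) + θ * (r i - means ν i) := fun r => by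
        simp only [Pi.add_apply, feedback, hi, if_true]; ring
      simp only [h1]
      simp_rw [Real.exp_add _ (θ * (_ - means ν i))]
      simp_rw [ENNReal.ofReal_mul (Real.exp_pos _).le]
      rw [lintegral_const_mul' _ _ ENNReal.ofReal_ne_top,
        ← ofReal_integral_eq_lintegral_ofReal ((hsub i).integrable_exp_mul θ)
          (Filter.Eventually.of_forall fun r => (Real.exp_pos _).le),
        ← ENNReal.ofReal_mul (Real.exp_pos _).le]
      refine ENNReal.ofReal_le_ofReal ?_
      have h2 := (hsub i).mgf_le θ
      rw [mgf] at h2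
      refine (mul_le_mul_of_nonneg_left h2 (Real.exp_pos _).le).trans (le_of_eq ?_)
      rw [← Real.exp_add]
      congr 1
      simp only [obsCount, List.map_cons, List.sum_cons, obs, hi, if_true, NNReal.coe_one]
      ring
    · have h1 : ∀ r : Fin K → ℝ, θ * (u + (feedback G (a, r)).2) i + c +
          obsCount G l i * (θ * means ν i + θ ^ 2 / 2) = θ * u i + c +
          obsCount G l i * (θ * means ν i + θ ^ 2 / 2) := fun r => by
        simp only [Pi.add_apply, feedback, hi, if_false, add_zero]
      simp only [h1, lintegral_const, measure_univ, mul_one]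
      simp [obsCount, obs, hi]

variable {ν} in
/-- The failure probability of a batch: if `W` is at most `g` when the empirical means of the
arms in `S` have precision `w`, and at most `g + H` otherwise, then its expectation exceeds `g` by
at most `H` times a union bound. -/
theorem evolve_le_of_clean [IsProbabilityMeasure ν] (hsub : IsSubGaussian ν)
    (S : Finset (Fin K)) (w : Fin K → ℝ) (l : List (Fin K))
    {W : (Fin K → ℝ) → ENNReal} {g H : ENNReal}
    (hclean : ∀ u, (∀ i ∈ S, |u i - obsCount G l i * means ν i| ≤ obsCount G l i * w i) → W u ≤ g)
    (hdirty : ∀ u, W u ≤ g + H) (hw : ∀ i ∈ S, 0 ≤ w i) :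
    evolve G ν l W 0 ≤ g + H * ∑ i ∈ S,
      2 * ENNReal.ofReal (Real.exp (-(obsCount G l i * w i ^ 2 / 2))) := by
  set e : ℝ → Fin K → (Fin K → ℝ) → ENNReal := fun b i u =>
    ENNReal.ofReal (Real.exp (b * w i * u i +
      (-(b * w i * (obsCount G l i * means ν i)) - obsCount G l i * w i ^ 2))) with he
  have hem : ∀ b i, Measurable (e b i) := fun b i => by
    refine ENNReal.measurable_ofReal.comp (Real.measurable_exp.comp ?_)
    exact ((measurable_pi_apply i).const_mul _).add_const _
  have hbound : ∀ u, W u ≤ g + H * ∑ i ∈ S, (e 1 i u + e (-1) i u) := fun u => by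
    by_cases hc : ∀ i ∈ S, |u i - obsCount G l i * means ν i| ≤ obsCount G l i * w i
    · exact (hclean u hc).trans le_self_add
    · push Not at hc
      obtain ⟨i, hi, hlt⟩ := hc
      refine (hdirty u).trans (add_le_add le_rfl (le_mul_of_one_le_right zero_le ?_))
      refine le_trans ?_ (Finset.single_le_sum (f := fun i => e 1 i u + e (-1) i u)
        (fun _ _ => zero_le) hi)
      have hwi := hw i hi
      rcases lt_abs.1 hlt with h | h
      · refine le_trans ?_ le_self_add
        simp only [he]
        rw [ENNReal.one_le_ofReal, Real.one_le_exp_iff]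
        nlinarith [mul_le_mul_of_nonneg_left h.le hwi]
      · refine le_trans ?_ le_add_self
        simp only [he]
        rw [ENNReal.one_le_ofReal, Real.one_le_exp_iff]
        nlinarith [mul_le_mul_of_nonneg_left h.le hwi]
  refine (evolve_mono G ν l hbound 0).trans ?_
  have hms : Measurable fun u => ∑ i ∈ S, (e 1 i u + e (-1) i u) :=
    Finset.measurable_sum _ fun i _ => (hem 1 i).add (hem (-1) i)
  rw [evolve_add G ν l measurable_const, evolve_const, evolve_const_mul G ν l H hms,
    evolve_sum G ν S l (f := fun i u => e 1 i u + e (-1) i u)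
      fun i => (hem 1 i).add (hem (-1) i)]
  gcongr with i hi
  rw [evolve_add G ν l (hem 1 i), two_mul]
  have hone : ∀ b : ℝ, b ^ 2 = 1 → evolve G ν l (e b i) 0 ≤
      ENNReal.ofReal (Real.exp (-(obsCount G l i * w i ^ 2 / 2))) := fun b hb => by
    refine (evolve_exp_le G hsub i (b * w i) l _ 0).trans
      (ENNReal.ofReal_le_ofReal (Real.exp_le_exp.2 (le_of_eq ?_)))
    rw [mul_pow, hb]
    simp only [Pi.zero_apply]
    ring
  exact add_le_add (hone 1 (by norm_num)) (hone (-1) (by norm_num))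

/-- The value of a batch in progress is at most the gaps of the arms that remain to be played and
the expected value at the start of the next batch. -/
theorem BatchAlg.value_le [IsProbabilityMeasure ν] (s : ℕ) (lev : Fin K → ℕ)
    {W : (Fin K → ℕ) → ENNReal}
    (l : List (Fin K)) : ∀ (n : ℕ) (a : Fin K) (u : Fin K → ℝ),
      (∀ n' lev', n' + (l.length + 1) ≤ n ∨ n' = 0 →
        A.value G ν n' (A.fresh (s + 1) lev') ≤ W lev') →
      A.value G ν n ((s, lev, a :: l), u) ≤
        ENNReal.ofReal (((a :: l).map (gap (means ν))).sum) +
          evolve G ν (a :: l) (fun u => W (A.next s lev u)) u := by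
  induction l with
  | nil =>
    intro n a u hW
    rcases n with _ | n
    · exact zero_le
    · simp only [value, evolve, List.map_cons, List.map_nil, List.sum_cons, List.sum_nil, add_zero]
      refine add_le_add le_rfl (lintegral_mono fun r => ?_)
      exact hW n _ (Or.inl (by simp))
  | cons b l ih =>
    intro n a u hW
    rcases n with _ | n
    · exact zero_le
    · have hsum : 0 ≤ ((b :: l).map (gap (means ν))).sum := by
        refine List.sum_nonneg fun x hx => ?_
        obtain ⟨i, -, rfl⟩ := List.mem_map.1 hx
        exact gap_nonneg _ i
      rw [List.map_cons, List.sum_cons, ENNReal.ofReal_add (gap_nonneg _ _) hsum, value, evolve,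
        add_assoc]
      refine add_le_add le_rfl ?_
      have h1 : ∀ r : Fin K → ℝ, A.value G ν n (A.update (((s, lev, a :: b :: l), u),
          feedback G (a, r))) ≤ ENNReal.ofReal (((b :: l).map (gap (means ν))).sum) +
            evolve G ν (b :: l) (fun u => W (A.next s lev u)) (u + (feedback G (a, r)).2) :=
        fun r => ih n b _ fun n' lev' hn => hW n' lev' (by
          rcases hn with hn | hn
          · left; simp only [List.length_cons]; omega
          · right; exact hn)
      refine (lintegral_mono h1).trans ?_
      rw [lintegral_add_left measurable_const]
      simp

end Batch

/-! ### Near-optimal solutions of covering programs -/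

section Covering

variable {K : ℕ} (G : SimpleGraph (Fin K))

/-- A covering LP has a solution that is optimal up to a factor `2`. -/
theorem exists_near_min {w : Fin K → ℝ} (hw : ∀ i, 0 < w i) (S : Finset (Fin K)) {R : Fin K → ℝ}
    (hR : ∀ i, 0 < R i) : ∃ x : Fin K → ℝ, (∀ i, 0 ≤ x i) ∧
      (∀ i ∈ S, R i ≤ ∑ j ∈ nbhd G i, x j) ∧
      ∀ y : Fin K → ℝ, (∀ i, 0 ≤ y i) → (∀ i ∈ S, R i ≤ ∑ j ∈ nbhd G i, y j) →
        ∑ i, w i * x i ≤ 2 * ∑ i, w i * y i := by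
  rcases S.eq_empty_or_nonempty with rfl | ⟨i₀, hi₀⟩
  · exact ⟨0, fun _ => le_rfl, by simp, fun y hy _ => by
      simpa using Finset.sum_nonneg fun i _ => mul_nonneg (hw i).le (hy i)⟩
  · obtain ⟨k, -, hk⟩ := Finset.exists_min_image Finset.univ w ⟨i₀, Finset.mem_univ _⟩
    set V : Set ℝ := {v | ∃ y : Fin K → ℝ, (∀ i, 0 ≤ y i) ∧
      (∀ i ∈ S, R i ≤ ∑ j ∈ nbhd G i, y j) ∧ v = ∑ i, w i * y i} with hV
    have hlow : ∀ v ∈ V, w k * R i₀ ≤ v := by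
      rintro _ ⟨y, hy, hc, rfl⟩
      calc w k * R i₀ ≤ w k * ∑ j ∈ nbhd G i₀, y j :=
            mul_le_mul_of_nonneg_left (hc i₀ hi₀) (hw k).le
        _ ≤ w k * ∑ j, y j := mul_le_mul_of_nonneg_left
            (Finset.sum_le_sum_of_subset_of_nonneg (Finset.subset_univ _) fun j _ _ => hy j)
            (hw k).le
        _ ≤ ∑ j, w j * y j := by
            rw [Finset.mul_sum]
            exact Finset.sum_le_sum fun j hj => mul_le_mul_of_nonneg_right (hk j hj) (hy j)
    have hne : V.Nonempty := ⟨_, R, fun i => (hR i).le, fun i _ =>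
      Finset.single_le_sum (fun j _ => (hR j).le) (self_mem_nbhd G i), rfl⟩
    have hpos : 0 < sInf V := (mul_pos (hw k) (hR i₀)).trans_le (le_csInf hne hlow)
    obtain ⟨v, ⟨x, hx, hc, rfl⟩, hv⟩ := exists_lt_of_csInf_lt hne
      (by linarith : sInf V < 2 * sInf V)
    refine ⟨x, hx, hc, fun y hy hyc => hv.le.trans ?_⟩
    have : sInf V ≤ ∑ i, w i * y i := csInf_le ⟨_, hlow⟩ ⟨y, hy, hyc, rfl⟩
    linarith

/-- Playing an arm more often than the largest requirement is useless. -/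
theorem cover_min {S : Finset (Fin K)} {R x : Fin K → ℝ} {M : ℝ} (hx : ∀ i, 0 ≤ x i)
    (hM : ∀ i ∈ S, R i ≤ M) (hM0 : 0 ≤ M) (hc : ∀ i ∈ S, R i ≤ ∑ j ∈ nbhd G i, x j) :
    ∀ i ∈ S, R i ≤ ∑ j ∈ nbhd G i, min (x j) M := by
  intro i hi
  by_cases h : ∃ j ∈ nbhd G i, M ≤ x j
  · obtain ⟨j, hj, hjM⟩ := h
    calc R i ≤ M := hM i hi
      _ = min (x j) M := (min_eq_right hjM).symm
      _ ≤ _ := Finset.single_le_sum (f := fun j => min (x j) M)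
          (fun j _ => le_min (hx j) hM0) hj
  · push Not at h
    refine (hc i hi).trans (le_of_eq (Finset.sum_congr rfl fun j hj => ?_))
    exact (min_eq_left (h j hj).le).symm

open scoped Classical in
/-- Instead of playing arms outside of `S`, one can play the arms of `S` that they observe. -/
noncomputable def pushInto (S : Finset (Fin K)) (x : Fin K → ℝ) (a : Fin K) : ℝ :=
  if a ∈ S then x a + ∑ j ∈ nbhd G a with j ∉ S, x j else 0

theorem pushInto_nonneg {S : Finset (Fin K)} {x : Fin K → ℝ} (hx : ∀ i, 0 ≤ x i) (a : Fin K) :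
    0 ≤ pushInto G S x a := by
  unfold pushInto
  split_ifs
  · exact add_nonneg (hx a) (Finset.sum_nonneg fun j _ => hx j)
  · exact le_rfl

theorem cover_pushInto {S : Finset (Fin K)} {R x : Fin K → ℝ} (hx : ∀ i, 0 ≤ x i)
    (hc : ∀ i ∈ S, R i ≤ ∑ j ∈ nbhd G i, x j) :
    ∀ i ∈ S, R i ≤ ∑ j ∈ nbhd G i, pushInto G S x j := by
  classical
  intro i hi
  refine (hc i hi).trans ?_
  rw [← Finset.sum_filter_add_sum_filter_not (nbhd G i) (fun j => j ∈ S) x,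
    ← Finset.sum_filter_add_sum_filter_not (nbhd G i) (fun j => j ∈ S) (pushInto G S x)]
  have e2 : ∑ j ∈ nbhd G i with j ∉ S, pushInto G S x j = 0 :=
    Finset.sum_eq_zero fun j hj => by simp [pushInto, (Finset.mem_filter.1 hj).2]
  rw [e2, add_zero]
  have hmem : i ∈ (nbhd G i).filter (fun j => j ∈ S) :=
    Finset.mem_filter.2 ⟨self_mem_nbhd G i, hi⟩
  rw [Finset.sum_eq_sum_sdiff_singleton_add hmem x,
    Finset.sum_eq_sum_sdiff_singleton_add hmem (pushInto G S x), add_assoc]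
  refine add_le_add (Finset.sum_le_sum fun j hj => ?_) (le_of_eq ?_)
  · have hj' := (Finset.mem_filter.1 (Finset.mem_sdiff.1 hj).1).2
    simp only [pushInto, hj', if_true]
    linarith [Finset.sum_nonneg fun k (_ : k ∈ (nbhd G j).filter fun j => j ∉ S) => hx k]
  · simp only [pushInto, hi, if_true]

/-- An arm outside of `S` is at least as costly as all arms of `S` that replace it. -/
theorem sum_pushInto_le {S : Finset (Fin K)} {x w : Fin K → ℝ} {ε : ℝ} (hx : ∀ i, 0 ≤ x i)
    (hε : 0 ≤ ε) (hS : ∀ i ∈ S, w i = ε) (hout : ∀ i, i ∉ S → S.card * ε ≤ w i) :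
    ∑ i, w i * pushInto G S x i ≤ ∑ i, w i * x i := by
  classical
  rw [← Finset.sum_filter_add_sum_filter_not Finset.univ (fun j => j ∈ S) (fun i => w i * x i),
    ← Finset.sum_filter_add_sum_filter_not Finset.univ (fun j => j ∈ S)
      (fun i => w i * pushInto G S x i)]
  have e2 : ∑ j with j ∉ S, w j * pushInto G S x j = 0 :=
    Finset.sum_eq_zero fun j hj => by simp [pushInto, (Finset.mem_filter.1 hj).2]
  rw [e2, add_zero]
  have e1 : ∑ j with j ∈ S, w j * pushInto G S x j = ∑ j with j ∈ S, w j * x j +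
      ∑ j with j ∈ S, ε * ∑ k ∈ nbhd G j with k ∉ S, x k := by
    rw [← Finset.sum_add_distrib]
    refine Finset.sum_congr rfl fun j hj => ?_
    have hj' := (Finset.mem_filter.1 hj).2
    simp only [pushInto, hj', if_true, mul_add, hS j hj']
  rw [e1]
  refine add_le_add le_rfl ?_
  calc ∑ j with j ∈ S, ε * ∑ k ∈ nbhd G j with k ∉ S, x k
      ≤ ∑ j with j ∈ S, ε * ∑ k with k ∉ S, x k := by
        refine Finset.sum_le_sum fun j _ => mul_le_mul_of_nonneg_left
          (Finset.sum_le_sum_of_subset_of_nonneg ?_ fun k _ _ => hx k) hε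
        exact Finset.filter_subset_filter _ (Finset.subset_univ _)
    _ = S.card * ε * ∑ k with k ∉ S, x k := by
        rw [Finset.sum_const, nsmul_eq_mul, mul_assoc]
        congr 2
        simp
    _ ≤ _ := by
        rw [Finset.mul_sum]
        exact Finset.sum_le_sum fun k hk =>
          mul_le_mul_of_nonneg_right (hout k (Finset.mem_filter.1 hk).2) (hx k)

end Covering

/-! ### Integer plans for refinement and verification -/

section Plans

variable {K : ℕ} (G : SimpleGraph (Fin K))

/-- The arms whose gap is not yet distinguished from `0` at stage `s`. -/
def candidates (s : ℕ) (lev : Fin K → ℕ) : Finset (Fin K) := {i | s ≤ lev i}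

theorem mem_candidates {s : ℕ} {lev : Fin K → ℕ} {i : Fin K} :
    i ∈ candidates s lev ↔ s ≤ lev i := by simp [candidates]

/-- The cost of an arm as estimated from the levels; candidates count as much as the scale
of phase `s + r`. -/
noncomputable def estCost (s r : ℕ) (lev : Fin K → ℕ) (i : Fin K) : ℝ :=
  if lev i < s then scale (lev i) else scale (s + r)

theorem estCost_pos (s r : ℕ) (lev : Fin K → ℕ) (i : Fin K) : 0 < estCost s r lev i := by
  unfold estCost; split_ifs <;> exact scale_pos _

theorem estCost_le_one (s r : ℕ) (lev : Fin K → ℕ) (i : Fin K) : estCost s r lev i ≤ 1 := by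
  unfold estCost; split_ifs <;> exact scale_le_one _

/-- Integer numbers of plays that observe every candidate `N * 4 ^ s` times, at nearly minimal
cost; candidates only are played if the other arms are more costly than all candidates together. -/
theorem exists_refineCount {s N : ℕ} (r : ℕ) (lev : Fin K → ℕ) (hK : K ≤ 4 ^ s) (hN : 1 ≤ N) :
    ∃ n : Fin K → ℕ,
      (∀ i ∈ candidates s lev, N * 4 ^ s ≤ ∑ j ∈ nbhd G i, n j) ∧
      (∀ a, n a ≤ 2 * N * 4 ^ s) ∧
      (∀ y : Fin K → ℝ, (∀ i, 0 ≤ y i) →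
        (∀ i ∈ candidates s lev, (4 : ℝ) ^ s ≤ ∑ j ∈ nbhd G i, y j) →
        ∑ i, estCost s r lev i * n i ≤ 4 * N * ∑ i, estCost s r lev i * y i) ∧
      ((∀ i, lev i < s → (candidates s lev).card * scale (s + r) ≤ scale (lev i)) →
        ∀ i, lev i < s → n i = 0) := by
  classical
  set S := candidates s lev with hS
  set w := estCost s r lev with hw
  have hwpos : ∀ i, 0 < w i := estCost_pos s r lev
  obtain ⟨x₀, hx₀, hc₀, hmin₀⟩ := exists_near_min G hwpos S (R := fun _ => (4 : ℝ) ^ s)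
    fun _ => by positivity
  -- a solution that avoids the arms outside if this is cheaper
  obtain ⟨x, hx, hc, hmin, hzero⟩ : ∃ x : Fin K → ℝ, (∀ i, 0 ≤ x i) ∧
      (∀ i ∈ S, (4 : ℝ) ^ s ≤ ∑ j ∈ nbhd G i, x j) ∧
      (∀ y : Fin K → ℝ, (∀ i, 0 ≤ y i) → (∀ i ∈ S, (4 : ℝ) ^ s ≤ ∑ j ∈ nbhd G i, y j) →
        ∑ i, w i * x i ≤ 2 * ∑ i, w i * y i) ∧
      ((∀ i, lev i < s → S.card * scale (s + r) ≤ scale (lev i)) →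
        ∀ i, lev i < s → x i = 0) := by
    by_cases hcase : ∀ i, lev i < s → S.card * scale (s + r) ≤ scale (lev i)
    · refine ⟨pushInto G S x₀, pushInto_nonneg G hx₀, cover_pushInto G hx₀ hc₀,
        fun y hy hyc => le_trans ?_ (hmin₀ y hy hyc), fun _ i hi => ?_⟩
      · refine sum_pushInto_le G hx₀ (scale_pos (s + r)).le (fun i hi => ?_) fun i hi => ?_
        · rw [hS, mem_candidates] at hi
          simp [hw, estCost, not_lt.2 hi]
        · rw [hS, mem_candidates, not_le] at hi
          simpa [hw, estCost, hi] using hcase i hi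
      · have : i ∉ S := by rw [hS, mem_candidates]; omega
        simp [pushInto, this]
    · exact ⟨x₀, hx₀, hc₀, hmin₀, fun h => absurd h hcase⟩
  have hx' : ∀ a, 0 ≤ min (x a) (4 ^ s) := fun a => le_min (hx a) (by positivity)
  have hN' : (1 : ℝ) ≤ N := by exact_mod_cast hN
  refine ⟨fun a => ⌊2 * N * min (x a) (4 ^ s)⌋₊, fun i hi => ?_, fun a => ?_, fun y hy hyc => ?_,
    fun h i hi => ?_⟩
  · have h1 := cover_min G (M := 4 ^ s) hx (fun _ _ => le_rfl) (by positivity) hc i hi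
    have h2 : ∑ j ∈ nbhd G i, (2 * N * min (x j) (4 ^ s) - 1) ≤
        ∑ j ∈ nbhd G i, (⌊2 * N * min (x j) (4 ^ s)⌋₊ : ℝ) :=
      Finset.sum_le_sum fun j _ => (Nat.sub_one_lt_floor _).le
    have h3 : ((nbhd G i).card : ℝ) ≤ 4 ^ s := by
      have : (nbhd G i).card ≤ 4 ^ s := (by simpa using Finset.card_le_univ (nbhd G i) :
        (nbhd G i).card ≤ K).trans hK
      exact_mod_cast this
    rw [Finset.sum_sub_distrib, ← Finset.mul_sum, Finset.sum_const, nsmul_eq_mul, mul_one] at h2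
    have h4 : (4 : ℝ) ^ s ≤ N * 4 ^ s := le_mul_of_one_le_left (by positivity) hN'
    have h5 : (N : ℝ) * 4 ^ s ≤ N * ∑ j ∈ nbhd G i, min (x j) (4 ^ s) :=
      mul_le_mul_of_nonneg_left h1 (by linarith)
    have h6 : (N : ℝ) * 4 ^ s ≤ ∑ j ∈ nbhd G i, (⌊2 * N * min (x j) (4 ^ s)⌋₊ : ℝ) := by linarith
    exact_mod_cast h6
  · refine Nat.floor_le_of_le ?_
    push_cast
    exact mul_le_mul_of_nonneg_left (min_le_right _ _) (by positivity)
  · calc ∑ i, w i * (⌊2 * N * min (x i) (4 ^ s)⌋₊ : ℝ)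
        ≤ ∑ i, w i * (2 * N * x i) := by
          refine Finset.sum_le_sum fun i _ => mul_le_mul_of_nonneg_left ?_ (hwpos i).le
          refine (Nat.floor_le (mul_nonneg (by positivity) (hx' i))).trans ?_
          exact mul_le_mul_of_nonneg_left (min_le_left _ _) (by positivity)
      _ = 2 * N * ∑ i, w i * x i := by
          rw [Finset.mul_sum]; exact Finset.sum_congr rfl fun i _ => by ring
      _ ≤ 2 * N * (2 * ∑ i, w i * y i) :=
          mul_le_mul_of_nonneg_left (hmin y hy hyc) (by positivity)
      _ = _ := by ring
  · simp [hzero h i hi]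

/-- At stage `s` the remaining arms have gaps far larger than the scale, and each of them is
observed by some candidate. -/
def Separated (s : ℕ) (lev : Fin K → ℕ) : Prop :=
  ∀ i, lev i < s → 8 * lev i ≤ s ∧ ∃ j ∈ candidates s lev, j ∈ nbhd G i

/-- Integer numbers of plays that observe every arm `i` other than the candidates `N * 4 ^ lev i`
times. Separated levels allow to play candidates only, independently of the LP. -/
theorem exists_verifyCount {s N : ℕ} (lev : Fin K → ℕ) (hN : 1 ≤ N) :
    ∃ n : Fin K → ℕ,
      (∀ i, lev i < s → N * 4 ^ lev i ≤ ∑ j ∈ nbhd G i, n j) ∧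
      (∀ a, n a ≤ 2 * N * 4 ^ s) ∧
      (Separated G s lev → ∀ a, n a ≤ N * 4 ^ (s / 8) ∧ (lev a < s → n a = 0)) ∧
      (¬ Separated G s lev → ∀ y : Fin K → ℝ, (∀ i, 0 ≤ y i) →
        (∀ i, lev i < s → (4 : ℝ) ^ lev i ≤ ∑ j ∈ nbhd G i, y j) →
        ∑ i, estCost s 0 lev i * n i ≤ 2 * N * (∑ i, estCost s 0 lev i * y i) + K) ∧
      ((∀ i, s ≤ lev i) → ∀ a, n a = 0) := by
  classical
  by_cases hall : ∀ i, s ≤ lev i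
  · refine ⟨0, fun i hi => absurd hi (not_lt.2 (hall i)), fun a => Nat.zero_le _,
      fun _ a => ⟨Nat.zero_le _, fun _ => rfl⟩, fun _ y hy _ => ?_, fun _ a => rfl⟩
    have : 0 ≤ ∑ i, estCost s 0 lev i * y i :=
      Finset.sum_nonneg fun i _ => mul_nonneg (estCost_pos s 0 lev i).le (hy i)
    simp only [Pi.zero_apply, Nat.cast_zero, mul_zero, Finset.sum_const_zero]
    positivity
  by_cases hsep : Separated G s lev
  · refine ⟨fun a => if lev a < s then 0 else N * 4 ^ (s / 8), fun i hi => ?_, fun a => ?_,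
      fun _ a => ⟨?_, fun h => by simp [h]⟩, fun h => absurd hsep h,
      fun h => absurd h hall⟩
    · obtain ⟨h8, j, hj, hji⟩ := hsep i hi
      have hj' : ¬ lev j < s := not_lt.2 (mem_candidates.1 hj)
      calc N * 4 ^ lev i ≤ N * 4 ^ (s / 8) :=
            Nat.mul_le_mul_left _ (Nat.pow_le_pow_right (by norm_num) (by omega))
        _ = (if lev j < s then 0 else N * 4 ^ (s / 8)) := by simp [hj']
        _ ≤ _ := Finset.single_le_sum
            (f := fun a => if lev a < s then 0 else N * 4 ^ (s / 8)) (fun _ _ => Nat.zero_le _) hji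
    · dsimp only
      split_ifs
      · exact Nat.zero_le _
      · calc N * 4 ^ (s / 8) ≤ N * 4 ^ s :=
              Nat.mul_le_mul_left _ (Nat.pow_le_pow_right (by norm_num) (by omega))
          _ ≤ 2 * N * 4 ^ s := Nat.mul_le_mul_right _ (by omega)
    · dsimp only
      split_ifs
      · exact Nat.zero_le _
      · exact le_rfl
  · set S : Finset (Fin K) := {i | lev i < s} with hS
    have hmS : ∀ i, i ∈ S ↔ lev i < s := fun i => by simp [hS]
    obtain ⟨x, hx, hc, hmin⟩ := exists_near_min G (estCost_pos s 0 lev) S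
      (R := fun i => (4 : ℝ) ^ lev i) fun _ => by positivity
    have hx' : ∀ a, 0 ≤ min (x a) (4 ^ s) := fun a => le_min (hx a) (by positivity)
    have hN' : (1 : ℝ) ≤ N := by exact_mod_cast hN
    have hcov := cover_min G (S := S) (M := 4 ^ s) hx (fun i hi =>
      pow_le_pow_right₀ (by norm_num) ((hmS i).1 hi).le) (by positivity) hc
    refine ⟨fun a => ⌈N * min (x a) (4 ^ s)⌉₊, fun i hi => ?_, fun a => ?_,
      fun h => absurd h hsep, fun _ y hy hyc => ?_, fun h => absurd h hall⟩
    · have h1 := hcov i ((hmS i).2 hi)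
      have h2 : (N : ℝ) * 4 ^ lev i ≤ ∑ j ∈ nbhd G i, (⌈N * min (x j) (4 ^ s)⌉₊ : ℝ) := by
        calc (N : ℝ) * 4 ^ lev i ≤ N * ∑ j ∈ nbhd G i, min (x j) (4 ^ s) :=
              mul_le_mul_of_nonneg_left h1 (by linarith)
          _ ≤ _ := by
              rw [Finset.mul_sum]
              exact Finset.sum_le_sum fun j _ => Nat.le_ceil _
      exact_mod_cast h2
    · refine Nat.ceil_le.2 ?_
      push_cast
      calc (N : ℝ) * min (x a) (4 ^ s) ≤ N * 4 ^ s :=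
            mul_le_mul_of_nonneg_left (min_le_right _ _) (by linarith)
        _ ≤ 2 * N * 4 ^ s := by
            have : (0 : ℝ) ≤ N * 4 ^ s := by positivity
            linarith
    · have h0 := hmin y hy fun i hi => hyc i ((hmS i).1 hi)
      calc ∑ i, estCost s 0 lev i * (⌈N * min (x i) (4 ^ s)⌉₊ : ℝ)
          ≤ ∑ i, (N * (estCost s 0 lev i * x i) + 1) := by
            refine Finset.sum_le_sum fun i _ => ?_
            have h1 := Nat.ceil_lt_add_one (mul_nonneg (by linarith : (0 : ℝ) ≤ N) (hx' i))
            have h2 : (N : ℝ) * min (x i) (4 ^ s) ≤ N * x i :=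
              mul_le_mul_of_nonneg_left (min_le_left _ _) (by linarith)
            have h3 := estCost_pos s 0 lev i
            have h4 := estCost_le_one s 0 lev i
            calc _ ≤ estCost s 0 lev i * (N * x i + 1) :=
                  mul_le_mul_of_nonneg_left (by linarith) h3.le
              _ ≤ _ := by linarith
        _ = N * (∑ i, estCost s 0 lev i * x i) + K := by
            rw [Finset.sum_add_distrib, Finset.mul_sum]; simp
        _ ≤ _ := by nlinarith

end Plans

/-! ### Levels and their update -/

section Levels

variable {K : ℕ}

/-- The levels of stage `s` describe the gaps up to constant factors, down to the scale of `s`. -/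
def Valid (m : Fin K → ℝ) (s : ℕ) (lev : Fin K → ℕ) : Prop :=
  ∀ i, lev i ≤ s ∧ gap m i ≤ 2 * scale (lev i) ∧ (lev i < s → scale (lev i) / 2 ≤ gap m i)

/-- Levels that can occur at stage `s`, whether they are correct or not. -/
def Proper (s : ℕ) (lev : Fin K → ℕ) : Prop := (∀ i, lev i ≤ s) ∧ (candidates s lev).Nonempty

open scoped Classical in
/-- The new level of arm `i` for the empirical means `x`: the number of `d ≤ s` for which the
empirical gap to the best candidate is at most `3 / 4 * 2 ^ (-d)`. -/
noncomputable def newLevel (s : ℕ) (lev : Fin K → ℕ) (x : Fin K → ℝ) (i : Fin K) : ℕ :=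
  {d ∈ Finset.range (s + 1) | ∀ j ∈ candidates s lev, x j - x i ≤ 3 / 4 * scale d}.card

variable {s : ℕ} {lev : Fin K → ℕ} {x : Fin K → ℝ} {i : Fin K}

theorem newLevel_le : newLevel s lev x i ≤ s + 1 := by
  classical
  exact (Finset.card_filter_le _ _).trans (Finset.card_range _).le

theorem scale_anti {a b : ℕ} (h : a ≤ b) : scale b ≤ scale a := by
  unfold scale
  gcongr
  norm_num

/-- The empirical gap is small at the scales below the new level only. -/
theorem lt_newLevel_iff {d : ℕ} (hd : d ≤ s) : d < newLevel s lev x i ↔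
    ∀ j ∈ candidates s lev, x j - x i ≤ 3 / 4 * scale d := by
  classical
  set F : Finset ℕ := {d ∈ Finset.range (s + 1) | ∀ j ∈ candidates s lev,
    x j - x i ≤ 3 / 4 * scale d} with hF
  have hcard : newLevel s lev x i = F.card := by rw [newLevel]
  have hmem : ∀ d, d ∈ F ↔ d ≤ s ∧ ∀ j ∈ candidates s lev, x j - x i ≤ 3 / 4 * scale d :=
    fun d => by simp [hF]
  have hdown : ∀ d e, d ≤ e → e ∈ F → d ∈ F := fun d e hde he => by
    rw [hmem] at he ⊢
    exact ⟨hde.trans he.1, fun j hj => (he.2 j hj).trans (by linarith [scale_anti hde])⟩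
  have hiff : d < F.card ↔ d ∈ F := by
    constructor
    · intro h
      by_contra hd'
      have : F ⊆ Finset.range d := fun e he => Finset.mem_range.2 (by
        by_contra hle
        exact hd' (hdown d e (not_lt.1 hle) he))
      have := Finset.card_le_card this
      rw [Finset.card_range] at this
      omega
    · intro h
      have : Finset.range (d + 1) ⊆ F := fun e he =>
        hdown e d (Nat.lt_succ_iff.1 (Finset.mem_range.1 he)) h
      have := Finset.card_le_card this
      rw [Finset.card_range] at this
      omega
  rw [hcard, hiff, hmem]
  exact ⟨fun h => h.2, fun h => ⟨hd, h⟩⟩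

variable {m : Fin K → ℝ}

/-- New levels computed from precise empirical means are correct. -/
theorem newLevel_spec (hm : ∀ i, m i ∈ Set.Icc (0 : ℝ) 1) {o : Fin K} (ho : m o = best m)
    (hoc : o ∈ candidates s lev)
    (hclean : ∀ j ∈ candidates s lev, |x j - m j| ≤ scale s / 32)
    (hi : (|x i - m i| ≤ scale s / 32) ∨ (lev i ≤ s ∧ |x i - m i| ≤ scale (lev i) / 32 ∧
      ∃ j ∈ candidates s lev, scale (lev i) / 4 ≤ x j - x i)) :
    gap m i ≤ 2 * scale (newLevel s lev x i) ∧
      (newLevel s lev x i < s + 1 → scale (newLevel s lev x i) / 2 ≤ gap m i) := by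
  have hs := scale_pos s
  obtain ⟨b, hb, hbmax⟩ := Finset.exists_max_image (candidates s lev) x ⟨o, hoc⟩
  have hxo := abs_le.1 (hclean o hoc)
  have hxb := abs_le.1 (hclean b hb)
  have hbb := hbmax o hoc
  have hbest := le_best m b
  have hgap : gap m i = m o - m i := by rw [gap, ho]
  -- the empirical gap is accurate up to a sixteenth of the scale or up to a quarter of itself
  have herr : |x b - x i - gap m i| ≤ scale s / 16 ∨
      |x b - x i - gap m i| ≤ (x b - x i) / 4 := by
    rcases hi with hi | ⟨hls, hi, j, hj, hpass⟩
    · left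
      have hi' := abs_le.1 hi
      rw [abs_le, hgap]
      constructor <;> linarith
    · right
      have hi' := abs_le.1 hi
      have hsl := scale_anti hls
      have := hbmax j hj
      rw [abs_le, hgap]
      constructor <;> linarith
  set d := newLevel s lev x i with hd
  constructor
  · rcases Nat.eq_zero_or_pos d with h0 | hpos
    · rw [h0]
      have := gap_le_one hm i
      have h1 : scale 0 = 1 := by simp [scale]
      linarith
    · have hds : d - 1 ≤ s := by have := newLevel_le (s := s) (lev := lev) (x := x) (i := i); omega
      have h1 := (lt_newLevel_iff (lev := lev) (x := x) (i := i) hds).1 (by omega) b hb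
      have h2 : scale d = scale (d - 1) / 2 := by
        rw [← scale_succ]; congr 1; omega
      have h3 := scale_anti hds
      rcases herr with h | h <;> have := abs_le.1 h <;> linarith
  · intro hlt
    have h1 := (lt_newLevel_iff (lev := lev) (x := x) (i := i)
      (Nat.lt_succ_iff.1 hlt)).not.1 (lt_irrefl _)
    push Not at h1
    obtain ⟨j, hj, hjlt⟩ := h1
    have h2 := hbmax j hj
    have h3 := scale_anti (Nat.lt_succ_iff.1 hlt)
    rcases herr with h | h <;> have := abs_le.1 h <;> linarith

/-- The empirical means confirm that the arms other than the candidates are suboptimal. -/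
def Confirmed (s : ℕ) (lev : Fin K → ℕ) (x : Fin K → ℝ) : Prop :=
  ∀ i, lev i < s → ∃ j ∈ candidates s lev, scale (lev i) / 4 ≤ x j - x i

open scoped Classical in
/-- The levels of stage `s + 1` for the empirical means `x` of the batch of stage `s`. If `check`
holds, then all arms were observed; a failed confirmation erases all knowledge. Otherwise, only the
candidates were observed. -/
noncomputable def nextLevels (check : Prop) (s : ℕ) (lev : Fin K → ℕ) (x : Fin K → ℝ)
    (i : Fin K) : ℕ :=
  if check then (if Confirmed s lev x then newLevel s lev x i else s + 1)
  else if lev i < s then lev i else newLevel s lev x i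

variable {check : Prop}

theorem proper_nextLevels (h : Proper s lev) : Proper (s + 1) (nextLevels check s lev x) := by
  classical
  obtain ⟨b, hb, hbmax⟩ := Finset.exists_max_image (candidates s lev) x h.2
  have hbn : newLevel s lev x b = s + 1 := by
    refine le_antisymm newLevel_le ((lt_newLevel_iff le_rfl).2 fun j hj => ?_)
    have := hbmax j hj
    have := scale_pos s
    linarith
  refine ⟨fun i => ?_, b, mem_candidates.2 ?_⟩
  · unfold nextLevels
    split_ifs with h1 h2 h3
    · exact newLevel_le
    · exact le_rfl
    · omega
    · exact newLevel_le
  · have : ¬ lev b < s := not_lt.2 (mem_candidates.1 hb)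
    unfold nextLevels
    split_ifs
    · exact hbn.ge
    · exact le_rfl
    · exact hbn.ge

theorem valid_proper (hK : 1 ≤ K) (h : Valid m s lev) : Proper s lev := by
  obtain ⟨o, ho⟩ := exists_eq_best m hK
  refine ⟨fun i => (h i).1, o, mem_candidates.2 ?_⟩
  by_contra hlt
  have := (h o).2.2 (not_le.1 hlt)
  have h0 : gap m o = 0 := by simp [gap, ho]
  linarith [scale_pos (lev o)]

/-- Correct levels stay correct if the observed arms have precise empirical means. -/
theorem valid_nextLevels (hK : 1 ≤ K) (hm : ∀ i, m i ∈ Set.Icc (0 : ℝ) 1) (h : Valid m s lev)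
    (hclean : ∀ i, (check ∨ i ∈ candidates s lev) → |x i - m i| ≤ scale (lev i) / 32) :
    Valid m (s + 1) (nextLevels check s lev x) := by
  classical
  obtain ⟨o, ho⟩ := exists_eq_best m hK
  have hgo : gap m o = 0 := by simp [gap, ho]
  have hoc : o ∈ candidates s lev := by
    rw [mem_candidates]
    by_contra hlt
    have := (h o).2.2 (not_le.1 hlt)
    linarith [scale_pos (lev o)]
  have hcand : ∀ j ∈ candidates s lev, |x j - m j| ≤ scale s / 32 := fun j hj => by
    have := hclean j (Or.inr hj)
    rwa [le_antisymm (h j).1 (mem_candidates.1 hj)] at this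
  intro i
  refine ⟨(proper_nextLevels (valid_proper hK h)).1 i, ?_⟩
  by_cases hc : check
  · have hconf : Confirmed s lev x := fun k hk => ⟨o, hoc, by
      have h1 := abs_le.1 (hcand o hoc)
      have h2 := abs_le.1 (hclean k (Or.inl hc))
      have h3 := (h k).2.2 hk
      have h4 := scale_anti hk.le
      rw [gap, ← ho] at h3
      linarith⟩
    have e : nextLevels check s lev x i = newLevel s lev x i := by simp [nextLevels, hc, hconf]
    rw [e]
    refine newLevel_spec hm ho hoc hcand ?_
    by_cases hi : lev i < s
    · exact Or.inr ⟨hi.le, hclean i (Or.inl hc), hconf i hi⟩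
    · exact Or.inl (hcand i (mem_candidates.2 (not_lt.1 hi)))
  · by_cases hi : lev i < s
    · have e : nextLevels check s lev x i = lev i := by simp [nextLevels, hc, hi]
      rw [e]
      exact ⟨(h i).2.1, fun _ => (h i).2.2 hi⟩
    · have e : nextLevels check s lev x i = newLevel s lev x i := by simp [nextLevels, hc, hi]
      rw [e]
      exact newLevel_spec hm ho hoc hcand (Or.inl (hcand i (mem_candidates.2 (not_lt.1 hi))))

/-- After a check with precise empirical means, the levels are correct or all knowledge is
erased. -/
theorem valid_or_erased (hK : 1 ≤ K) (hm : ∀ i, m i ∈ Set.Icc (0 : ℝ) 1) (hc : check)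
    (h : Proper s lev) (hclean : ∀ i, |x i - m i| ≤ scale (lev i) / 32) :
    Valid m (s + 1) (nextLevels check s lev x) ∨
      nextLevels check s lev x = fun _ => s + 1 := by
  classical
  by_cases hconf : Confirmed s lev x
  · left
    obtain ⟨o, ho⟩ := exists_eq_best m hK
    have hcand : ∀ j ∈ candidates s lev, |x j - m j| ≤ scale s / 32 := fun j hj => by
      have := hclean j
      rwa [le_antisymm (h.1 j) (mem_candidates.1 hj)] at this
    have hoc : o ∈ candidates s lev := by
      rw [mem_candidates]
      by_contra hlt
      obtain ⟨j, hj, hjx⟩ := hconf o (not_le.1 hlt)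
      have h1 := abs_le.1 (hcand j hj)
      have h2 := abs_le.1 (hclean o)
      have h3 := le_best m j
      have h4 := scale_anti (not_le.1 hlt).le
      have h5 := scale_pos (lev o)
      linarith
    intro i
    refine ⟨(proper_nextLevels h).1 i, ?_⟩
    have e : nextLevels check s lev x i = newLevel s lev x i := by simp [nextLevels, hc, hconf]
    rw [e]
    refine newLevel_spec hm ho hoc hcand ?_
    by_cases hi : lev i < s
    · exact Or.inr ⟨hi.le, hclean i, hconf i hi⟩
    · exact Or.inl (hcand i (mem_candidates.2 (not_lt.1 hi)))
  · right
    funext i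
    simp [nextLevels, hc, hconf]

/-- A batch that starts without knowledge ends with correct levels if the empirical means are
precise. -/
theorem valid_of_erased (hK : 1 ≤ K) (hm : ∀ i, m i ∈ Set.Icc (0 : ℝ) 1)
    (hclean : ∀ i, |x i - m i| ≤ scale s / 32) :
    Valid m (s + 1) (nextLevels check s (fun _ => s) x) := by
  classical
  obtain ⟨o, ho⟩ := exists_eq_best m hK
  have hmem : ∀ i, i ∈ candidates s (fun _ : Fin K => s) := fun i => mem_candidates.2 le_rfl
  have hP : Proper s (fun _ : Fin K => s) := ⟨fun _ => le_rfl, o, hmem o⟩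
  intro i
  refine ⟨(proper_nextLevels hP).1 i, ?_⟩
  have e : nextLevels check s (fun _ => s) x i = newLevel s (fun _ => s) x i := by
    have : Confirmed s (fun _ : Fin K => s) x := fun k hk => absurd hk (lt_irrefl _)
    simp [nextLevels, this]
  rw [e]
  exact newLevel_spec hm ho (hmem o) (fun j _ => hclean j) (Or.inl (hclean i))

theorem measurable_newLevel (s : ℕ) (lev : Fin K → ℕ) (i : Fin K) :
    Measurable fun x : Fin K → ℝ => newLevel s lev x i := by
  classical
  simp only [newLevel, Finset.card_filter]
  refine Finset.measurable_sum _ fun d _ => Measurable.ite ?_ measurable_const measurable_const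
  have : {x : Fin K → ℝ | ∀ j ∈ candidates s lev, x j - x i ≤ 3 / 4 * scale d} =
      ⋂ j ∈ candidates s lev, {x | x j - x i ≤ 3 / 4 * scale d} := by
    ext x; simp
  rw [this]
  exact Finset.measurableSet_biInter _ fun j _ => measurableSet_le
    ((measurable_pi_apply j).sub (measurable_pi_apply i)) measurable_const

theorem measurable_nextLevels (check : Prop) (s : ℕ) (lev : Fin K → ℕ) :
    Measurable (nextLevels check s lev) := by
  classical
  refine measurable_pi_lambda _ fun i => ?_
  unfold nextLevels
  split_ifs
  · refine Measurable.ite ?_ (measurable_newLevel s lev i) measurable_const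
    have : {x : Fin K → ℝ | Confirmed s lev x} = ⋂ i, ⋂ (_ : lev i < s),
        ⋃ j ∈ candidates s lev, {x | scale (lev i) / 4 ≤ x j - x i} := by
      ext x; simp [Confirmed]
    rw [this]
    exact MeasurableSet.iInter fun i => MeasurableSet.iInter fun _ =>
      Finset.measurableSet_biUnion _ fun j _ => measurableSet_le measurable_const
        ((measurable_pi_apply j).sub (measurable_pi_apply i))
  · exact measurable_const
  · exact measurable_newLevel s lev i

end Levels

/-! ### The algorithm -/

section Algorithm

variable {K : ℕ}

/-- The list in which every arm `a` occurs `n a` times. -/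
def playList (n : Fin K → ℕ) : List (Fin K) :=
  (List.finRange K).flatMap fun a => List.replicate (n a) a

theorem sum_map_playList (n : Fin K → ℕ) (f : Fin K → ℝ) :
    ((playList n).map f).sum = ∑ a, n a * f a := by
  rw [Fin.sum_univ_def, playList, List.map_flatMap, List.flatMap, List.sum_flatten, List.map_map]
  simp [Function.comp_def]

theorem length_playList (n : Fin K → ℕ) : (playList n).length = ∑ a, n a := by
  rw [Fin.sum_univ_def, playList, List.length_flatMap]
  simp

theorem obsCount_playList (G : SimpleGraph (Fin K)) (n : Fin K → ℕ) (i : Fin K) :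
    obsCount G (playList n) i = ∑ a ∈ nbhd G i, (n a : ℝ) := by
  classical
  rw [obsCount, sum_map_playList]
  simp only [obs, mul_ite, mul_one, mul_zero]
  rw [← Finset.sum_filter]
  refine Finset.sum_congr ?_ fun _ _ => rfl
  ext a
  simp [mem_nbhd_comm (i := i) (j := a)]

/-- The first stage `B`, chosen such that `4 ^ B` is at least `K`, and of order `K`. -/
def baseStage (K : ℕ) : ℕ := 8 + Nat.clog 4 K

theorem le_baseStage : 8 ≤ baseStage K := by unfold baseStage; omega

theorem le_four_pow {s : ℕ} (hs : baseStage K ≤ s) : K ≤ 4 ^ s :=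
  (Nat.le_pow_clog (by norm_num) K).trans
    (Nat.pow_le_pow_right (by norm_num) (by unfold baseStage at hs; omega))

/-- The number of observations, in units of `4 ^ s`, that stage `s` requires of a candidate. The
constant is `2 * 32 ^ 2 * 90`: empirical means of precision `2 ^ (-s) / 32` then fail with
probability `2 * exp (-90 s)`. -/
def sampleFactor (s : ℕ) : ℕ := 184320 * s

/-- The stages at which all arms are observed, and wrong levels are detected. -/
def IsCheck (K s : ℕ) : Prop := ∃ k, s = baseStage K * 4 ^ k

open scoped Classical in
/-- How far below the scale of the stage the refinement assumes the gaps of the candidates to be. As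
long as the other arms have large gaps this is about `log₂ log₂ K`; afterwards it is zero. -/
noncomputable def lag (s : ℕ) (lev : Fin K → ℕ) : ℕ :=
  if ∀ i, lev i < s → 4 * lev i ≤ baseStage K then Nat.log 2 (baseStage K) else 0

variable (G : SimpleGraph (Fin K))

open scoped Classical in
/-- The numbers of plays that refine the estimates of the candidates. -/
noncomputable def refineCount (s : ℕ) (lev : Fin K → ℕ) : Fin K → ℕ :=
  if h : K ≤ 4 ^ s ∧ 1 ≤ sampleFactor s then
    (exists_refineCount G (lag s lev) lev h.1 h.2).choose else 0

open scoped Classical in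
/-- The numbers of plays that verify the levels of the arms other than the candidates. -/
noncomputable def verifyCount (s : ℕ) (lev : Fin K → ℕ) : Fin K → ℕ :=
  if h : 1 ≤ sampleFactor s then (exists_verifyCount G (s := s) lev h).choose else 0

open scoped Classical in
/-- The numbers of plays in the batch of a stage. -/
noncomputable def planCount (s : ℕ) (lev : Fin K → ℕ) (a : Fin K) : ℕ :=
  refineCount G s lev a + if IsCheck K s then verifyCount G s lev a else 0

theorem one_le_sampleFactor {s : ℕ} (hs : baseStage K ≤ s) : 1 ≤ sampleFactor s := by
  have := le_baseStage (K := K)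
  unfold sampleFactor
  omega

theorem refineCount_spec {s : ℕ} (hs : baseStage K ≤ s) (lev : Fin K → ℕ) :
    (∀ i ∈ candidates s lev, sampleFactor s * 4 ^ s ≤ ∑ j ∈ nbhd G i, refineCount G s lev j) ∧
      (∀ a, refineCount G s lev a ≤ 2 * sampleFactor s * 4 ^ s) ∧
      (∀ y : Fin K → ℝ, (∀ i, 0 ≤ y i) →
        (∀ i ∈ candidates s lev, (4 : ℝ) ^ s ≤ ∑ j ∈ nbhd G i, y j) →
        ∑ i, estCost s (lag s lev) lev i * refineCount G s lev i ≤
          4 * sampleFactor s * ∑ i, estCost s (lag s lev) lev i * y i) ∧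
      ((∀ i, lev i < s → (candidates s lev).card * scale (s + lag s lev) ≤ scale (lev i)) →
        ∀ i, lev i < s → refineCount G s lev i = 0) := by
  have h : K ≤ 4 ^ s ∧ 1 ≤ sampleFactor s := ⟨le_four_pow hs, one_le_sampleFactor hs⟩
  have e : refineCount G s lev = (exists_refineCount G (lag s lev) lev h.1 h.2).choose := by
    rw [refineCount, dif_pos h]
  rw [e]
  exact (exists_refineCount G (lag s lev) lev h.1 h.2).choose_spec

theorem verifyCount_spec {s : ℕ} (hs : baseStage K ≤ s) (lev : Fin K → ℕ) :
    (∀ i, lev i < s → sampleFactor s * 4 ^ lev i ≤ ∑ j ∈ nbhd G i, verifyCount G s lev j) ∧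
      (∀ a, verifyCount G s lev a ≤ 2 * sampleFactor s * 4 ^ s) ∧
      (Separated G s lev → ∀ a, verifyCount G s lev a ≤ sampleFactor s * 4 ^ (s / 8) ∧
        (lev a < s → verifyCount G s lev a = 0)) ∧
      (¬ Separated G s lev → ∀ y : Fin K → ℝ, (∀ i, 0 ≤ y i) →
        (∀ i, lev i < s → (4 : ℝ) ^ lev i ≤ ∑ j ∈ nbhd G i, y j) →
        ∑ i, estCost s 0 lev i * verifyCount G s lev i ≤
          2 * sampleFactor s * (∑ i, estCost s 0 lev i * y i) + K) ∧
      ((∀ i, s ≤ lev i) → ∀ a, verifyCount G s lev a = 0) := by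
  have e : verifyCount G s lev =
      (exists_verifyCount G (s := s) lev (one_le_sampleFactor hs)).choose := by
    rw [verifyCount, dif_pos (one_le_sampleFactor hs)]
  rw [e]
  exact (exists_verifyCount G (s := s) lev (one_le_sampleFactor hs)).choose_spec

/-- The algorithm: in every stage, the planned numbers of plays, in any order; then new levels from
the empirical means of the batch. It starts with the levels that express no knowledge. -/
noncomputable def stageAlg (hK : 1 ≤ K) : BatchAlg K where
  plan s lev := playList (planCount G s lev)
  next s lev u := nextLevels (IsCheck K s) s lev
    fun i => u i / obsCount G (playList (planCount G s lev)) i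
  measurable_next s lev := (measurable_nextLevels _ s lev).comp
    (measurable_pi_lambda _ fun i => (measurable_pi_apply i).div_const _)
  start := baseStage K
  dflt := ⟨0, hK⟩

/-- Every arm that is judged in a stage has been observed sufficiently often. -/
theorem le_obsCount {s : ℕ} (hs : baseStage K ≤ s) {lev : Fin K → ℕ} (h : Proper s lev)
    {i : Fin K} (hi : IsCheck K s ∨ i ∈ candidates s lev) :
    (sampleFactor s : ℝ) * 4 ^ lev i ≤ obsCount G (playList (planCount G s lev)) i := by
  classical
  rw [obsCount_playList]
  by_cases hc : i ∈ candidates s lev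
  · rw [le_antisymm (h.1 i) (mem_candidates.1 hc)]
    have h1 := (refineCount_spec G hs lev).1 i hc
    have h2 : ∑ j ∈ nbhd G i, refineCount G s lev j ≤ ∑ j ∈ nbhd G i, planCount G s lev j :=
      Finset.sum_le_sum fun j _ => Nat.le_add_right _ _
    exact_mod_cast h1.trans h2
  · have hch := hi.resolve_right hc
    have hlt : lev i < s := not_le.1 (mt mem_candidates.2 hc)
    have h1 := (verifyCount_spec G hs lev).1 i hlt
    have h2 : ∑ j ∈ nbhd G i, verifyCount G s lev j ≤ ∑ j ∈ nbhd G i, planCount G s lev j :=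
      Finset.sum_le_sum fun j _ => by simp [planCount, hch]
    exact_mod_cast h1.trans h2

theorem four_pow_le_length {s : ℕ} (hs : baseStage K ≤ s) {lev : Fin K → ℕ} (h : Proper s lev) :
    4 ^ s ≤ (playList (planCount G s lev)).length := by
  obtain ⟨i, hi⟩ := h.2
  rw [length_playList]
  calc 4 ^ s ≤ sampleFactor s * 4 ^ s := Nat.le_mul_of_pos_left _ (one_le_sampleFactor hs)
    _ ≤ ∑ j ∈ nbhd G i, refineCount G s lev j := (refineCount_spec G hs lev).1 i hi
    _ ≤ ∑ j ∈ nbhd G i, planCount G s lev j := Finset.sum_le_sum fun j _ => Nat.le_add_right _ _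
    _ ≤ ∑ j, planCount G s lev j := Finset.sum_le_sum_of_subset (Finset.subset_univ _)

/-- The regret of the batch of a stage. -/
noncomputable def batchCost (m : Fin K → ℝ) (s : ℕ) (lev : Fin K → ℕ) : ℝ :=
  ∑ a, planCount G s lev a * gap m a

/-- A crude bound for the cost of a batch, whether the levels are correct or not. -/
theorem batchCost_le {m : Fin K → ℝ} (hm : ∀ i, m i ∈ Set.Icc (0 : ℝ) 1) {s : ℕ}
    (hs : baseStage K ≤ s) (lev : Fin K → ℕ) : batchCost G m s lev ≤ 256 ^ s := by
  classical
  have h8 := le_baseStage (K := K)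
  have hplan : ∀ a, (planCount G s lev a : ℝ) * gap m a ≤ (4 * sampleFactor s * 4 ^ s : ℕ) := by
    intro a
    have h1 : planCount G s lev a ≤ 4 * sampleFactor s * 4 ^ s := by
      have := (refineCount_spec G hs lev).2.1 a
      have := (verifyCount_spec G hs lev).2.1 a
      unfold planCount
      have e : 4 * sampleFactor s * 4 ^ s = 2 * sampleFactor s * 4 ^ s +
        2 * sampleFactor s * 4 ^ s := by ring
      rw [e]
      split_ifs <;> omega
    calc (planCount G s lev a : ℝ) * gap m a ≤ planCount G s lev a * 1 :=
          mul_le_mul_of_nonneg_left (gap_le_one hm a) (Nat.cast_nonneg _)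
      _ ≤ _ := by rw [mul_one]; exact_mod_cast h1
  have hsum : batchCost G m s lev ≤ (K * (4 * sampleFactor s * 4 ^ s) : ℕ) := by
    refine (Finset.sum_le_sum fun a _ => hplan a).trans (le_of_eq ?_)
    simp
  refine hsum.trans ?_
  have h1 : s < 2 ^ s := Nat.lt_two_pow_self
  have h3 : 4 * sampleFactor s ≤ 2 ^ 20 * 2 ^ s := by unfold sampleFactor; omega
  have h2 : K * (4 * sampleFactor s * 4 ^ s) ≤ 256 ^ s := by
    calc K * (4 * sampleFactor s * 4 ^ s) ≤ 4 ^ s * (2 ^ 20 * 2 ^ s * 4 ^ s) := by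
          gcongr
          exact le_four_pow hs
      _ = 2 ^ (20 + 5 * s) := by
          rw [show (4 : ℕ) = 2 ^ 2 by norm_num, ← pow_mul]; ring
      _ ≤ 2 ^ (8 * s) := Nat.pow_le_pow_right (by norm_num) (by omega)
      _ = 256 ^ s := by rw [pow_mul]; norm_num
  exact_mod_cast h2

variable {G} {ν : Measure (Fin K → ℝ)}

/-- The value at the start of a stage, given bounds `g` for the value of the next stage after
precise estimates and `g + H` in general. -/
theorem value_fresh_le [IsProbabilityMeasure ν] (hsub : IsSubGaussian ν) (hK : 1 ≤ K) {s : ℕ}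
    (hs : baseStage K ≤ s) {lev : Fin K → ℕ} (h : Proper s lev) (n : ℕ) {g H : ENNReal}
    (hclean : ∀ x : Fin K → ℝ, (∀ i, (IsCheck K s ∨ i ∈ candidates s lev) →
        |x i - means ν i| ≤ scale (lev i) / 32) → ∀ n', n' + 4 ^ s ≤ n ∨ n' = 0 →
      (stageAlg G hK).value G ν n' ((stageAlg G hK).fresh (s + 1)
        (nextLevels (IsCheck K s) s lev x)) ≤ g)
    (hdirty : ∀ lev', Proper (s + 1) lev' → ∀ n', n' + 4 ^ s ≤ n ∨ n' = 0 →
      (stageAlg G hK).value G ν n' ((stageAlg G hK).fresh (s + 1) lev') ≤ g + H) :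
    (stageAlg G hK).value G ν n ((stageAlg G hK).fresh s lev) ≤
      ENNReal.ofReal (batchCost G (means ν) s lev) +
        (g + H * ENNReal.ofReal (2 * K * Real.exp (-(90 * s)))) := by
  classical
  set A := stageAlg G hK with hA
  set l := playList (planCount G s lev) with hl
  have hlen : 4 ^ s ≤ l.length := four_pow_le_length G hs h
  obtain ⟨a, l', hal⟩ : ∃ a l', l = a :: l' := by
    rcases hll : l with _ | ⟨a, l'⟩
    · rw [hll] at hlen
      have : 0 < 4 ^ s := by positivity
      simp at hlen
    · exact ⟨a, l', rfl⟩
  have hfresh : A.fresh s lev = ((s, lev, a :: l'), 0) := by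
    rw [← hal]; rfl
  -- the exact value at the start of the next stage, over the possible numbers of remaining rounds
  set W : (Fin K → ℕ) → ENNReal := fun lev' =>
    ⨆ n', ⨆ (_ : n' + 4 ^ s ≤ n ∨ n' = 0), A.value G ν n' (A.fresh (s + 1) lev') with hW
  rw [hfresh]
  refine (A.value_le G ν s lev (W := W) l' n a 0 fun n' lev' hn => ?_).trans ?_
  · refine le_iSup₂_of_le n' ?_ le_rfl
    rw [hal, List.length_cons] at hlen
    omega
  rw [← hal, hl, sum_map_playList]
  refine add_le_add le_rfl ?_
  set S : Finset (Fin K) := {i | IsCheck K s ∨ i ∈ candidates s lev} with hS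
  have hobs : ∀ i ∈ S, (sampleFactor s : ℝ) * 4 ^ lev i ≤ obsCount G l i := fun i hi =>
    le_obsCount G hs h (by simpa [hS] using hi)
  have hpos : ∀ i ∈ S, 0 < obsCount G l i := fun i hi => by
    refine lt_of_lt_of_le ?_ (hobs i hi)
    have : (1 : ℝ) ≤ sampleFactor s := by exact_mod_cast one_le_sampleFactor hs
    positivity
  refine (evolve_le_of_clean G hsub S (fun i => scale (lev i) / 32) l (g := g) (H := H)
    (fun u hu => iSup₂_le fun n' hn' => ?_) (fun u => iSup₂_le fun n' hn' => ?_)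
    fun i _ => by have := scale_pos (lev i); positivity).trans ?_
  · refine hclean _ (fun i hi => ?_) n' hn'
    have hiS : i ∈ S := by simpa [hS] using hi
    have hp := hpos i hiS
    have h1 := hu i hiS
    have e : u i / obsCount G l i - means ν i =
        (u i - obsCount G l i * means ν i) / obsCount G l i := by
      field_simp
    rw [← hl, e, abs_div, abs_of_pos hp, div_le_iff₀ hp]
    linarith
  · exact hdirty _ (proper_nextLevels h) n' hn'
  · gcongr
    calc ∑ i ∈ S, 2 * ENNReal.ofReal (Real.exp (-(obsCount G l i * (scale (lev i) / 32) ^ 2 / 2)))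
        ≤ ∑ i ∈ S, 2 * ENNReal.ofReal (Real.exp (-(90 * s))) := by
          gcongr with i hi
          have h1 := hobs i hi
          have h2 := four_pow_mul_scale_sq (lev i)
          have h3 : (sampleFactor s : ℝ) = 184320 * s := by unfold sampleFactor; push_cast; ring
          have h4 := mul_le_mul_of_nonneg_right h1 (sq_nonneg (scale (lev i)))
          rw [mul_assoc, h2, h3] at h4
          linarith
      _ ≤ ∑ i : Fin K, 2 * ENNReal.ofReal (Real.exp (-(90 * s))) :=
          Finset.sum_le_sum_of_subset (Finset.subset_univ _)
      _ = ENNReal.ofReal (2 * K * Real.exp (-(90 * s))) := by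
          rw [Finset.sum_const, Finset.card_univ, Fintype.card_fin, nsmul_eq_mul,
            ENNReal.ofReal_mul (by positivity), ENNReal.ofReal_mul (by norm_num)]
          simp
          ring

end Algorithm

/-! ### Value of the algorithm in terms of the costs of its stages -/

section Recursion

variable {K : ℕ} {G : SimpleGraph (Fin K)} {ν : Measure (Fin K → ℝ)}

/-- The next check is not later than stage `4 s`. -/
theorem exists_check {s : ℕ} (hs : baseStage K ≤ s) :
    ∃ t, s ≤ t ∧ IsCheck K t ∧ t ≤ 4 * s := by
  classical
  have hB := le_baseStage (K := K)
  have hex : ∃ k, s ≤ baseStage K * 4 ^ k := ⟨s, by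
    have h1 : s < 4 ^ s := Nat.lt_pow_self (by norm_num)
    nlinarith⟩
  refine ⟨_, Nat.find_spec hex, ⟨_, rfl⟩, ?_⟩
  rcases hk : Nat.find hex with _ | k
  · omega
  · have := Nat.find_min hex (m := k) (by omega)
    rw [pow_succ, ← mul_assoc]
    omega

/-- A bound for the regret until the next check, in terms of the crude bound `256 ^ s` for the
regret of a stage. The probability of a failure is small enough to make it negligible. -/
theorem exists_debt (K : ℕ) : ∃ X : ℕ → ENNReal,
    (∀ s, baseStage K ≤ s → ¬ IsCheck K s → ENNReal.ofReal (256 ^ s) + X (s + 1) ≤ X s) ∧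
    (∀ s, baseStage K ≤ s → IsCheck K s →
      ENNReal.ofReal (256 ^ s) + (ENNReal.ofReal (256 ^ (s + 1)) + 2) ≤ X s) ∧
    (∀ s, baseStage K ≤ s → X (s + 1) * ENNReal.ofReal (2 * K * Real.exp (-(90 * s))) ≤
      ENNReal.ofReal ((1 / 2) ^ s)) := by
  classical
  have hB := le_baseStage (K := K)
  have hex : ∀ s, ∃ t, s ≤ t ∧ IsCheck K t := fun s => by
    obtain ⟨t, h1, h2, -⟩ := exists_check (K := K) (le_max_left (baseStage K) s)
    exact ⟨t, (le_max_right _ _).trans h1, h2⟩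
  set N : ℕ → ℕ := fun s => Nat.find (hex s) with hN
  have hN1 : ∀ s, s ≤ N s := fun s => (Nat.find_spec (hex s)).1
  have hN2 : ∀ s, baseStage K ≤ s → N s ≤ 4 * s := fun s hs => by
    obtain ⟨t, h1, h2, h3⟩ := exists_check hs
    exact (Nat.find_min' (hex s) ⟨h1, h2⟩).trans h3
  have hpow : ∀ s : ℕ, (256 : ℝ) ^ (s + 1) = 256 * 256 ^ s := fun s => by ring
  have hone : ∀ s : ℕ, (1 : ℝ) ≤ 256 ^ s := fun s => one_le_pow₀ (by norm_num)
  refine ⟨fun s => ENNReal.ofReal (256 ^ (N s + 2) - 256 ^ s), fun s hs hns => ?_,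
    fun s hs hc => ?_, fun s hs => ?_⟩
  · have e : N (s + 1) = N s := by
      refine le_antisymm (Nat.find_min' _ ⟨?_, (Nat.find_spec (hex s)).2⟩)
        (Nat.find_min' _ ⟨(Nat.le_succ s).trans (hN1 (s + 1)), (Nat.find_spec (hex (s + 1))).2⟩)
      refine Nat.succ_le_of_lt (lt_of_le_of_ne (hN1 s) fun h => hns ?_)
      rw [h]
      exact (Nat.find_spec (hex s)).2
    have h1 : (256 : ℝ) ^ (s + 1) ≤ 256 ^ (N s + 2) :=
      pow_le_pow_right₀ (by norm_num) (by have := hN1 s; omega)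
    dsimp only
    rw [e, ← ENNReal.ofReal_add (by positivity) (by linarith)]
    refine ENNReal.ofReal_le_ofReal ?_
    have := hpow s
    have := hone s
    linarith
  · have e : N s = s := le_antisymm (Nat.find_min' _ ⟨le_rfl, hc⟩) (hN1 s)
    have h2 : (2 : ENNReal) = ENNReal.ofReal 2 := by simp
    dsimp only
    rw [e, h2, ← ENNReal.ofReal_add (by positivity) (by norm_num),
      ← ENNReal.ofReal_add (by positivity) (by positivity)]
    refine ENNReal.ofReal_le_ofReal ?_
    have := hpow s
    have := hpow (s + 1)
    have := hone s
    have e2 : (256 : ℝ) ^ (s + 2) = 256 ^ (s + 1 + 1) := by ring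
    linarith
  · have h1 : (256 : ℝ) ^ (N (s + 1) + 2) - 256 ^ (s + 1) ≤ 2 ^ (32 * s + 48) := by
      have h2 : (256 : ℝ) ^ (N (s + 1) + 2) ≤ 256 ^ (4 * s + 6) :=
        pow_le_pow_right₀ (by norm_num) (by have := hN2 (s + 1) (by omega); omega)
      have h3 : (256 : ℝ) ^ (4 * s + 6) = 2 ^ (32 * s + 48) := by
        rw [show (256 : ℝ) = 2 ^ 8 by norm_num, ← pow_mul]
        congr 1
        ring
      have := hone (s + 1)
      linarith
    have hexp : Real.exp (-(90 * s)) ≤ ((2 : ℝ) ^ (90 * s))⁻¹ := by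
      rw [Real.exp_neg]
      gcongr
      have : (2 : ℝ) ≤ Real.exp 1 := by have := Real.add_one_le_exp (1 : ℝ); linarith
      calc (2 : ℝ) ^ (90 * s) ≤ Real.exp 1 ^ (90 * s) := by gcongr
        _ = Real.exp (90 * s) := by rw [← Real.exp_nat_mul]; push_cast; ring_nf
    have hK : (K : ℝ) ≤ 4 ^ s := by exact_mod_cast le_four_pow hs
    dsimp only
    refine (mul_le_mul_left (ENNReal.ofReal_le_ofReal h1) _).trans ?_
    rw [← ENNReal.ofReal_mul (by positivity)]
    refine ENNReal.ofReal_le_ofReal ?_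
    calc (2 : ℝ) ^ (32 * s + 48) * (2 * K * Real.exp (-(90 * s)))
        ≤ 2 ^ (32 * s + 48) * (2 * 4 ^ s * ((2 : ℝ) ^ (90 * s))⁻¹) := by gcongr
      _ = 2 ^ (34 * s + 49) * ((2 : ℝ) ^ (90 * s))⁻¹ := by
          rw [show (4 : ℝ) = 2 ^ 2 by norm_num, ← pow_mul]; ring
      _ ≤ 2 ^ (89 * s) * ((2 : ℝ) ^ (90 * s))⁻¹ := by
          gcongr
          · norm_num
          · omega
      _ = (1 / 2) ^ s := by
          rw [show 90 * s = 89 * s + s by ring, pow_add, mul_inv, ← mul_assoc,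
            mul_inv_cancel₀ (by positivity), one_mul, one_div, inv_pow]

/-- The regret of the algorithm is at most the sum of the costs of the stages under correct levels,
up to a constant for failures. -/
theorem regret_stageAlg_le [IsProbabilityMeasure ν] (hsub : IsSubGaussian ν) (hK : 1 ≤ K)
    (hm : ∀ i, means ν i ∈ Set.Icc (0 : ℝ) 1) {T S : ℕ} (hS : baseStage K < S)
    (hT : T ≤ 4 ^ (S - 1)) {b : ℕ → ℝ} (hb0 : ∀ s, 0 ≤ b s)
    (hstart : batchCost G (means ν) (baseStage K) (fun _ => baseStage K) ≤ b (baseStage K))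
    (hb : ∀ s, baseStage K < s → s < S → ∀ lev, Valid (means ν) s lev →
      batchCost G (means ν) s lev ≤ b s) :
    regret G ν (stageAlg G hK).policy T ≤ ∑ s ∈ Finset.Ico (baseStage K) S, b s + 1 := by
  classical
  obtain ⟨X, hX0, hX1, hX2⟩ := exists_debt K
  set A := stageAlg G hK with hA
  set B := baseStage K with hB
  have hB8 : 8 ≤ B := le_baseStage
  set V : ℕ → ENNReal := fun s => ∑ t ∈ Finset.Ico s S, ENNReal.ofReal (b t + (1 / 2) ^ t) with hV
  have hVs : ∀ s, s < S → V s = ENNReal.ofReal (b s + (1 / 2) ^ s) + V (s + 1) := fun s hs =>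
    Finset.sum_eq_sum_Ico_succ_bot hs _
  have hVmono : ∀ s, V (s + 1) ≤ V s := fun s =>
    Finset.sum_le_sum_of_subset (Finset.Ico_subset_Ico_left (Nat.le_succ s))
  have heps : ∀ s : ℕ, ENNReal.ofReal ((1 / 2) ^ s) ≤ 1 := fun s => by
    rw [← ENNReal.ofReal_one]
    exact ENNReal.ofReal_le_ofReal (pow_le_one₀ (by norm_num) (by norm_num))
  -- correct levels, erased levels and arbitrary levels, by downward induction on the stage `s`; the
  -- earlier batches take `4 ^ (s - 1)` rounds at least, which leaves no rounds for stage `S`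
  have key : ∀ k s, s + k = S → B ≤ s → ∀ n, (n = 0 ∨ n + (if s = B then 0 else 4 ^ (s - 1)) ≤ T) →
      (B < s → ∀ lev, Valid (means ν) s lev → A.value G ν n (A.fresh s lev) ≤ V s) ∧
      (A.value G ν n (A.fresh s fun _ => s) ≤
        ENNReal.ofReal (batchCost G (means ν) s fun _ => s) +
          (V (s + 1) + ENNReal.ofReal ((1 / 2) ^ s))) ∧
      (∀ lev, Proper s lev → A.value G ν n (A.fresh s lev) ≤ X s + V s) := by
    intro k
    induction k with
    | zero =>
      intro s hs hBs n hn
      have hsB : s ≠ B := by omega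
      have h0 : ∀ σ, A.value G ν n σ = 0 := by
        have hn0 : n = 0 := by
          rcases hn with h | h
          · exact h
          · simp only [hsB, if_false] at h
            have : s = S := by omega
            subst this
            omega
        subst hn0
        exact fun σ => rfl
      simp [h0]
    | succ k ih =>
      intro s hs hBs n hn
      have hnext : ∀ n', n' + 4 ^ s ≤ n ∨ n' = 0 →
          (n' = 0 ∨ n' + (if s + 1 = B then 0 else 4 ^ (s + 1 - 1)) ≤ T) := fun n' hn' => by
        rw [if_neg (by omega), Nat.add_sub_cancel]
        rcases hn' with h | h
        · rcases hn with h2 | h2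
          · exact Or.inl (Nat.le_zero.1 ((Nat.le_add_right _ _).trans (h.trans h2.le)))
          · exact Or.inr (h.trans ((Nat.le_add_right _ _).trans h2))
        · exact Or.inl h
      have hsS : s < S := by omega
      have IH := fun n' hn' => ih (s + 1) (by omega) (by omega) n' (hnext n' hn')
      refine ⟨fun hBlt lev hlev => ?_, ?_, fun lev hlev => ?_⟩
      · refine (value_fresh_le hsub hK hBs (valid_proper hK hlev) n (g := V (s + 1))
          (H := X (s + 1)) (fun x hx n' hn' => ?_) fun lev' hlev' n' hn' => ?_).trans ?_
        · exact (IH n' hn').1 (by omega) _ (valid_nextLevels hK hm hlev hx)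
        · rw [add_comm (V _)]
          exact (IH n' hn').2.2 lev' hlev'
        · rw [hVs s hsS, ENNReal.ofReal_add (hb0 s) (by positivity), add_assoc,
            add_comm (ENNReal.ofReal ((1 / 2) ^ s))]
          gcongr
          · exact hb s hBlt hsS lev hlev
          · exact hX2 s hBs
      · have hP : Proper s (fun _ : Fin K => s) :=
          ⟨fun _ => le_rfl, ⟨0, hK⟩, mem_candidates.2 le_rfl⟩
        refine (value_fresh_le hsub hK hBs hP n (g := V (s + 1))
          (H := X (s + 1)) (fun x hx n' hn' => ?_) fun lev' hlev' n' hn' => ?_).trans ?_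
        · exact (IH n' hn').1 (by omega) _ (valid_of_erased hK hm fun i =>
            hx i (Or.inr (mem_candidates.2 le_rfl)))
        · rw [add_comm (V _)]
          exact (IH n' hn').2.2 lev' hlev'
        · gcongr
          exact hX2 s hBs
      · by_cases hc : IsCheck K s
        · refine (value_fresh_le hsub hK hBs hlev n
            (g := V (s + 1) + (ENNReal.ofReal (256 ^ (s + 1)) + 1))
            (H := X (s + 1)) (fun x hx n' hn' => ?_) fun lev' hlev' n' hn' => ?_).trans ?_
          · rcases valid_or_erased (check := IsCheck K s) hK hm hc hlev
              (fun i => hx i (Or.inl hc)) with h | h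
            · exact ((IH n' hn').1 (by omega) _ h).trans le_self_add
            · rw [h]
              refine ((IH n' hn').2.1).trans ?_
              calc _ ≤ ENNReal.ofReal (256 ^ (s + 1)) + (V (s + 1) + 1) := by
                    gcongr
                    · exact batchCost_le G hm (by omega) _
                    · exact hVmono _
                    · exact heps _
                _ = _ := by ring
          · refine ((IH n' hn').2.2 lev' hlev').trans ?_
            rw [add_comm]
            gcongr
            exact le_self_add
          · calc _ ≤ ENNReal.ofReal (256 ^ s) +
                  (V s + (ENNReal.ofReal (256 ^ (s + 1)) + 1) + 1) := by
                  gcongr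
                  · exact batchCost_le G hm hBs _
                  · exact hVmono s
                  · exact (hX2 s hBs).trans (heps s)
              _ = ENNReal.ofReal (256 ^ s) + (ENNReal.ofReal (256 ^ (s + 1)) + 2) + V s := by
                  ring
              _ ≤ _ := by
                  gcongr
                  exact hX1 s hBs hc
        · refine (value_fresh_le hsub hK hBs hlev n (g := X (s + 1) + V (s + 1))
            (H := 0) (fun x hx n' hn' => ?_) fun lev' hlev' n' hn' => ?_).trans ?_
          · exact (IH n' hn').2.2 _ (proper_nextLevels hlev)
          · rw [add_zero]
            exact (IH n' hn').2.2 lev' hlev'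
          · rw [zero_mul, add_zero, ← add_assoc]
            gcongr
            · refine le_trans ?_ (hX0 s hBs hc)
              gcongr
              exact batchCost_le G hm hBs _
            · exact hVmono s
  have hsum0 : 0 ≤ ∑ s ∈ Finset.Ico B S, b s := Finset.sum_nonneg fun s _ => hb0 s
  refine A.regret_le_of_value_le G ν (fun i => ?_) (by linarith) ?_
  · have h1 := (hsub i).integrable
    have h2 := h1.add (integrable_const (means ν i))
    refine h2.congr (Filter.Eventually.of_forall fun r => ?_)
    simp
  · have h1 := (key (S - B) B (by omega) le_rfl T (Or.inr (by simp))).2.1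
    refine h1.trans ?_
    have hgeo : ∑ s ∈ Finset.Ico B S, (1 / 2 : ℝ) ^ s ≤ 1 := by
      have h2 : ∀ M, 1 ≤ M → ∑ s ∈ Finset.Ico 1 M, (1 / 2 : ℝ) ^ s ≤ 1 - (1 / 2) ^ (M - 1) := by
        intro M hM
        induction M, hM using Nat.le_induction with
        | base => simp
        | succ M hM ih =>
          rw [Finset.sum_Ico_succ_top hM]
          have : (1 / 2 : ℝ) ^ (M - 1) = 2 * (1 / 2) ^ M := by
            obtain ⟨j, rfl⟩ := Nat.exists_eq_add_of_le' hM
            rw [Nat.add_sub_cancel, pow_succ]; ring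
          rw [Nat.add_sub_cancel]
          linarith
      have h3 : ∑ s ∈ Finset.Ico B S, (1 / 2 : ℝ) ^ s ≤ ∑ s ∈ Finset.Ico 1 S, (1 / 2 : ℝ) ^ s :=
        Finset.sum_le_sum_of_subset_of_nonneg (Finset.Ico_subset_Ico_left (by omega))
          fun _ _ _ => by positivity
      have h4 := h2 S (by omega)
      have h5 : (0 : ℝ) ≤ (1 / 2) ^ (S - 1) := by positivity
      linarith
    have e : V (B + 1) = ENNReal.ofReal (∑ t ∈ Finset.Ico (B + 1) S, (b t + (1 / 2) ^ t)) :=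
      (ENNReal.ofReal_sum_of_nonneg fun t _ => add_nonneg (hb0 t) (by positivity)).symm
    have hs0 : 0 ≤ ∑ t ∈ Finset.Ico (B + 1) S, (b t + (1 / 2) ^ t) :=
      Finset.sum_nonneg fun t _ => add_nonneg (hb0 t) (by positivity)
    have hc0 : 0 ≤ batchCost G (means ν) B fun _ => B :=
      Finset.sum_nonneg fun a _ => mul_nonneg (Nat.cast_nonneg _) (gap_nonneg _ a)
    rw [e, ← ENNReal.ofReal_add hs0 (by positivity), ← ENNReal.ofReal_add hc0 (by positivity)]
    refine ENNReal.ofReal_le_ofReal ?_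
    rw [Finset.sum_eq_sum_Ico_succ_bot hS] at hgeo ⊢
    rw [Finset.sum_add_distrib]
    linarith

end Recursion

/-! ### The phase of the smallest positive gap -/

section GapLevel

variable {K : ℕ} {G : SimpleGraph (Fin K)} {m : Fin K → ℝ}

/-- The first phase whose scale is at most the smallest positive gap. -/
noncomputable def gapLevel (m : Fin K → ℝ) : ℕ := sInf {n | scale n ≤ gapMin m}

theorem one_div_scale_sq (s : ℕ) : 1 / scale s ^ 2 = 4 ^ s := by
  rw [div_eq_iff (by have := scale_pos s; positivity), four_pow_mul_scale_sq]

theorem scale_add (a b : ℕ) : scale (a + b) = scale a / 2 ^ b := by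
  unfold scale
  rw [pow_add, mul_inv, div_eq_mul_inv]

theorem scale_gapLevel_le (h : ∃ i, 0 < gap m i) : scale (gapLevel m) ≤ gapMin m := by
  have hne : {n | scale n ≤ gapMin m}.Nonempty := by
    obtain ⟨n, hn⟩ := exists_pow_lt_of_lt_one (gapMin_pos h) (by norm_num : (1 / 2 : ℝ) < 1)
    refine ⟨n, ?_⟩
    rw [Set.mem_ofPred_eq, scale, ← inv_pow]
    norm_num at hn ⊢
    exact hn.le
  exact Nat.sInf_mem hne

theorem gapMin_lt_scale {s : ℕ} (hs : s < gapLevel m) : gapMin m < scale s :=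
  not_le.1 (Nat.notMem_of_lt_sInf hs)

theorem mem_phases_of_lt (hK : 1 ≤ K) (h : ∃ i, 0 < gap m i) {s : ℕ} (hs : s < gapLevel m) :
    s ∈ phases m := by
  rw [mem_phases hK h]
  have h1 : (1 : ℝ) ≤ (optArms m).card := by exact_mod_cast card_optArms_pos hK
  have h2 := (gapMin_lt_scale hs).le
  calc gapMin m * 2 ^ s ≤ scale s * 2 ^ s := by gcongr
    _ = 1 := by unfold scale; exact inv_mul_cancel₀ (by positivity)
    _ ≤ _ := h1

theorem phaseValue_succ_le (G : SimpleGraph (Fin K)) (m : Fin K → ℝ) (s : ℕ) :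
    phaseValue G m (s + 1) ≤ 4 * phaseValue G m s := by
  have h0 := scale_pos s
  have h1 : phaseValue G m (s + 1) / 4 ≤ phaseValue G m s := by
    refine le_phaseValue G m s fun x hx hc => ?_
    have h2 := phaseValue_le G m (s + 1) (x := fun i => 4 * x i)
      (fun i => mul_nonneg (by norm_num) (hx i)) fun i hi => by
        have h3 := hc i (by rw [scale_succ] at hi; linarith)
        rw [one_div_scale_sq] at h3 ⊢
        rw [← Finset.mul_sum, pow_succ]
        linarith
    have h3 : ∑ i, clippedGap m (s + 1) i * (4 * x i) ≤ 4 * ∑ i, clippedGap m s i * x i := by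
      rw [Finset.mul_sum]
      refine Finset.sum_le_sum fun i _ => ?_
      have h4 : clippedGap m (s + 1) i ≤ clippedGap m s i :=
        max_le_max (scale_anti (Nat.le_succ s)) le_rfl
      have := mul_le_mul_of_nonneg_right h4 (hx i)
      linarith
    linarith
  linarith

theorem phaseValue_pos (hK : 1 ≤ K) (s : ℕ) : 0 < phaseValue G m s :=
  (by have := scale_pos s; positivity : 0 < 1 / scale s).trans_le
    (one_div_scale_le_phaseValue G m s hK)

/-- Phases up to that of the smallest positive gap cost as much as `dStar` at most. The last two of
them need not belong to `phases m`, but are comparable to earlier ones. -/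
theorem phaseValue_le_of_le (hK : 1 ≤ K) (hm : ∀ i, m i ∈ Set.Icc (0 : ℝ) 1)
    (h : ∃ i, 0 < gap m i) {s : ℕ} (hs : s ≤ gapLevel m + 1) :
    phaseValue G m s ≤ 16 * dStar G m := by
  have h0 := phaseValue_le_dStar (G := G) (zero_mem_phases hK hm h)
  have hpos := phaseValue_pos (G := G) (m := m) hK 0
  match s, hs with
  | 0, _ => linarith
  | 1, _ =>
    have := phaseValue_succ_le G m 0
    linarith
  | s + 2, hs =>
    have h1 := phaseValue_succ_le G m s
    have h2 := phaseValue_succ_le G m (s + 1)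
    have h3 := phaseValue_le_dStar (G := G) (mem_phases_of_lt hK h (s := s) (by omega))
    linarith

theorem one_le_dStar (hK : 1 ≤ K) (hm : ∀ i, m i ∈ Set.Icc (0 : ℝ) 1)
    (h : ∃ i, 0 < gap m i) : 1 ≤ dStar G m := by
  have h1 := one_div_scale_le_phaseValue G m 0 hK
  have h2 := phaseValue_le_dStar (G := G) (zero_mem_phases hK hm h)
  simp only [scale, pow_zero, inv_one, div_one] at h1
  linarith

/-- `dStar` is at least of the order of the inverse of the smallest positive gap. -/
theorem two_pow_gapLevel_le (hK : 1 ≤ K) (hm : ∀ i, m i ∈ Set.Icc (0 : ℝ) 1)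
    (h : ∃ i, 0 < gap m i) : (2 : ℝ) ^ gapLevel m ≤ 2 * dStar G m := by
  rcases hl : gapLevel m with _ | l
  · have := one_le_dStar (G := G) hK hm h
    rw [pow_zero]; linarith
  · have h1 := one_div_scale_le_phaseValue G m l hK
    have h2 := phaseValue_le_dStar (G := G) (mem_phases_of_lt hK h (s := l) (by omega))
    rw [scale, one_div, inv_inv] at h1
    rw [pow_succ]; linarith

theorem gapLevel_le_logb (h : ∃ i, 0 < gap m i) :
    (gapLevel m : ℝ) + 1 ≤ 3 * max 1 (Real.logb 2 (1 / gapMin m)) := by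
  have h1 := le_max_left 1 (Real.logb 2 (1 / gapMin m))
  have h2 := le_max_right 1 (Real.logb 2 (1 / gapMin m))
  have hg := gapMin_pos h
  rcases hl : gapLevel m with _ | l
  · push_cast; linarith
  · have h3 := gapMin_lt_scale (m := m) (s := l) (by omega)
    have h4 : (l : ℝ) ≤ Real.logb 2 (1 / gapMin m) := by
      rw [Real.le_logb_iff_rpow_le (by norm_num) (by positivity), Real.rpow_natCast,
        le_div_iff₀ hg]
      have : scale l * 2 ^ l = 1 := by unfold scale; exact inv_mul_cancel₀ (by positivity)
      nlinarith [pow_pos (by norm_num : (0 : ℝ) < 2) l]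
    push_cast
    linarith

end GapLevel

/-! ### Cost of one refinement -/

section StageCosts

variable {K : ℕ} {G : SimpleGraph (Fin K)} {m : Fin K → ℝ} {s : ℕ} {lev : Fin K → ℕ}

theorem Valid.gap_le_of_candidate (h : Valid m s lev) {i : Fin K} (hi : i ∈ candidates s lev) :
    gap m i ≤ 2 * scale s := by
  have h1 := (h i).2.1
  rwa [le_antisymm (h i).1 (mem_candidates.1 hi)] at h1

theorem Valid.gap_pos (h : Valid m s lev) {i : Fin K} (hi : lev i < s) : 0 < gap m i := by
  have h1 := (h i).2.2 hi
  linarith [scale_pos (lev i)]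

theorem Valid.lev_le (h : Valid m s lev) (hg : ∃ i, 0 < gap m i) {i : Fin K} (hi : lev i < s) :
    lev i ≤ gapLevel m + 1 := by
  by_contra hlt
  have h1 := scale_gapLevel_le hg
  have h2 := gapMin_le (h.gap_pos hi)
  have h3 := (h i).2.1
  have h4 := scale_anti (show gapLevel m + 1 + 1 ≤ lev i by omega)
  rw [scale_succ, scale_succ] at h4
  linarith [scale_pos (gapLevel m)]

/-- Once the scale is small against the smallest positive gap, correct levels single out the
optimal arms. -/
theorem Valid.candidates_eq (h : Valid m s lev) (hg : ∃ i, 0 < gap m i)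
    (hs : gapLevel m + 2 ≤ s) : candidates s lev = optArms m := by
  ext i
  rw [mem_optArms]
  constructor
  · intro hi
    by_contra hne
    have hpos : 0 < gap m i := lt_of_le_of_ne (gap_nonneg m i) (Ne.symm hne)
    have h1 := scale_gapLevel_le hg
    have h2 := gapMin_le hpos
    have h3 := h.gap_le_of_candidate hi
    have h4 := scale_anti hs
    rw [scale_succ, scale_succ] at h4
    linarith [scale_pos (gapLevel m)]
  · intro hi
    rw [mem_candidates]
    by_contra hlt
    have := h.gap_pos (not_le.1 hlt)
    linarith

theorem Valid.estCost_le (h : Valid m s lev) (r : ℕ) (i : Fin K) :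
    estCost s r lev i ≤ 2 * clippedGap m (s + r) i := by
  have h0 := clippedGap_pos m (s + r) i
  unfold estCost
  split_ifs with hi
  · linarith [(h i).2.2 hi, gap_le_clippedGap m (s + r) i]
  · linarith [scale_le_clippedGap m (s + r) i]

theorem Valid.gap_le_estCost (h : Valid m s lev) (r : ℕ) (i : Fin K) :
    gap m i ≤ 2 * 2 ^ r * estCost s r lev i := by
  unfold estCost
  split_ifs with hi
  · have h1 : (1 : ℝ) ≤ 2 ^ r := one_le_pow₀ (by norm_num)
    have := (h i).2.1
    nlinarith [scale_pos (lev i)]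
  · rw [scale_add, mul_assoc, mul_div_cancel₀ _ (by positivity)]
    exact h.gap_le_of_candidate (mem_candidates.2 (not_lt.1 hi))

/-- The cost of the refinement in terms of the LP of a later phase `s + k`, whose solutions observe
the arms `4 ^ k` times more often than required. -/
theorem refineCost_le (hs : baseStage K ≤ s) (lev : Fin K → ℕ) (k : ℕ) {c₁ c₂ : ℝ} (h₁ : 0 ≤ c₁)
    (h₂ : 0 < c₂) (hgap : ∀ a, gap m a ≤ c₁ * estCost s (lag s lev) lev a)
    (hest : ∀ a, estCost s (lag s lev) lev a ≤ c₂ * clippedGap m (s + k) a)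
    (hcand : ∀ i ∈ candidates s lev, gap m i ≤ 2 * scale (s + k)) :
    ∑ a, refineCount G s lev a * gap m a ≤
      4 * sampleFactor s * c₁ * c₂ / 4 ^ k * phaseValue G m (s + k) := by
  set w := estCost s (lag s lev) lev with hw
  have h3 : (∑ a, refineCount G s lev a * gap m a) ≤ c₁ * ∑ a, w a * refineCount G s lev a := by
    rw [Finset.mul_sum]
    refine Finset.sum_le_sum fun a _ => ?_
    have := mul_le_mul_of_nonneg_left (hgap a) (Nat.cast_nonneg (α := ℝ) (refineCount G s lev a))
    linarith
  have h4 : (∑ a, w a * refineCount G s lev a) ≤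
      4 * sampleFactor s * c₂ / 4 ^ k * phaseValue G m (s + k) := by
    have hpos : (0 : ℝ) < sampleFactor s := by
      exact_mod_cast one_le_sampleFactor hs
    rw [← div_le_iff₀' (by positivity)]
    refine le_phaseValue G m (s + k) fun x hx hc => ?_
    rw [div_le_iff₀' (by positivity)]
    have h5 := (refineCount_spec G hs lev).2.2.1 (fun a => x a / 4 ^ k)
      (fun a => div_nonneg (hx a) (by positivity)) fun i hi => by
        have h6 := hc i (hcand i hi)
        rw [one_div_scale_sq, pow_add] at h6
        rw [← Finset.sum_div, le_div_iff₀ (by positivity)]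
        exact h6
    refine h5.trans ?_
    have h6 : ∑ a, w a * (x a / 4 ^ k) ≤ c₂ / 4 ^ k * ∑ a, clippedGap m (s + k) a * x a := by
      rw [Finset.mul_sum]
      refine Finset.sum_le_sum fun a _ => ?_
      have := mul_le_mul_of_nonneg_right (hest a) (div_nonneg (hx a)
        (by positivity : (0 : ℝ) ≤ 4 ^ k))
      calc w a * (x a / 4 ^ k) ≤ c₂ * clippedGap m (s + k) a * (x a / 4 ^ k) := this
        _ = _ := by ring
    calc 4 * (sampleFactor s : ℝ) * ∑ a, w a * (x a / 4 ^ k)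
        ≤ 4 * sampleFactor s * (c₂ / 4 ^ k * ∑ a, clippedGap m (s + k) a * x a) := by gcongr
      _ = _ := by ring
  calc _ ≤ c₁ * ∑ a, w a * refineCount G s lev a := h3
    _ ≤ c₁ * (4 * sampleFactor s * c₂ / 4 ^ k * phaseValue G m (s + k)) := by gcongr
    _ = _ := by ring

theorem lag_cases (s : ℕ) (lev : Fin K → ℕ) :
    (lag s lev = 0 ∧ ∃ i, lev i < s ∧ baseStage K < 4 * lev i) ∨
      (lag s lev = Nat.log 2 (baseStage K) ∧ ∀ i, lev i < s → 4 * lev i ≤ baseStage K) := by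
  classical
  by_cases h : ∀ i, lev i < s → 4 * lev i ≤ baseStage K
  · exact Or.inr ⟨by rw [lag, if_pos h], h⟩
  · refine Or.inl ⟨by rw [lag, if_neg h], ?_⟩
    push Not at h
    exact h

theorem two_pow_log_le : (2 : ℝ) ^ Nat.log 2 (baseStage K) ≤ baseStage K := by
  have h8 := le_baseStage (K := K)
  exact_mod_cast Nat.pow_log_le_self 2 (by omega)

theorem sq_lt_four_pow_log : ((baseStage K : ℝ)) ^ 2 ≤ 4 * 4 ^ Nat.log 2 (baseStage K) := by
  have h1 : baseStage K ≤ 2 * 2 ^ Nat.log 2 (baseStage K) := by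
    have := (Nat.lt_pow_succ_log_self (b := 2) (by norm_num) (baseStage K)).le
    rwa [pow_succ, mul_comm] at this
  have h2 : (baseStage K : ℝ) ≤ 2 * 2 ^ Nat.log 2 (baseStage K) := by exact_mod_cast h1
  calc ((baseStage K : ℝ)) ^ 2 ≤ (2 * 2 ^ Nat.log 2 (baseStage K)) ^ 2 := by gcongr
    _ = _ := by
      rw [mul_pow, ← pow_mul, mul_comm (Nat.log 2 _) 2, pow_mul]; norm_num

/-- The cost of a late refinement, when the candidates are the optimal arms. It vanishes unless
playing a suboptimal arm seems cheaper than playing all optimal arms; then the phase of the LP is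
still relevant for `dStar`. -/
theorem Valid.refineCost_le_late (h : Valid m s lev) (hK : 1 ≤ K) (hg : ∃ i, 0 < gap m i)
    (hs : baseStage K ≤ s) (hl : gapLevel m + 2 ≤ s) :
    (∑ a, refineCount G s lev a * gap m a ≤
        64 * sampleFactor s / 4 ^ lag s lev * dStar G m ∧
      ∃ i, lev i < s ∧ scale (lev i) < K * scale (s + lag s lev)) ∨
    ∑ a, refineCount G s lev a * gap m a ≤ 0 := by
  have hcand := h.candidates_eq hg hl
  have hzero : ∀ i ∈ candidates s lev, gap m i = 0 := fun i hi => by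
    rw [hcand] at hi; exact mem_optArms.1 hi
  set r := lag s lev with hr
  by_cases hcase : ∀ i, lev i < s → (candidates s lev).card * scale (s + r) ≤ scale (lev i)
  · right
    refine Finset.sum_nonpos fun a _ => ?_
    by_cases ha : lev a < s
    · simp [(refineCount_spec G hs lev).2.2.2 hcase a ha]
    · rw [hzero a (mem_candidates.2 (not_lt.1 ha)), mul_zero]
  · left
    push Not at hcase
    obtain ⟨i, hi, hlt⟩ := hcase
    have hsp := scale_pos (s + r)
    refine ⟨?_, i, hi, hlt.trans_le ?_⟩
    · have h1 : ∑ a, refineCount G s lev a * gap m a ≤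
          4 * sampleFactor s * 2 * 2 / 4 ^ r * phaseValue G m (s + r) := by
        refine refineCost_le hs lev r (by norm_num) (by norm_num) (fun a => ?_)
          (h.estCost_le r) fun j hj => by rw [hzero j hj]; positivity
        by_cases ha : lev a < s
        · have := (h a).2.1
          rw [estCost, if_pos ha]
          exact this
        · rw [hzero a (mem_candidates.2 (not_lt.1 ha))]
          have := estCost_pos s r lev a
          positivity
      have h2 : s + r - 1 ∈ phases m := by
        rw [mem_phases hK hg, ← hcand]
        have h3 := gapMin_le (h.gap_pos hi)
        have h4 := (h i).2.1
        have h5 : scale (s + r) = scale (s + r - 1) / 2 := by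
          rw [← scale_succ]; congr 1; omega
        have h6 : scale (s + r - 1) * 2 ^ (s + r - 1) = 1 := by
          unfold scale; exact inv_mul_cancel₀ (by positivity)
        have h7 : gapMin m ≤ (candidates s lev).card * scale (s + r - 1) := by
          rw [h5] at hlt
          linarith
        calc gapMin m * 2 ^ (s + r - 1)
            ≤ (candidates s lev).card * scale (s + r - 1) * 2 ^ (s + r - 1) := by gcongr
          _ = _ := by rw [mul_assoc, h6, mul_one]
      have h3 : phaseValue G m (s + r) ≤ 4 * dStar G m := by
        have h4 := phaseValue_succ_le G m (s + r - 1)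
        rw [show s + r - 1 + 1 = s + r by omega] at h4
        linarith [phaseValue_le_dStar (G := G) h2]
      calc _ ≤ 4 * sampleFactor s * 2 * 2 / 4 ^ r * phaseValue G m (s + r) := h1
        _ ≤ 4 * sampleFactor s * 2 * 2 / 4 ^ r * (4 * dStar G m) := by gcongr
        _ = _ := by ring
    · gcongr
      simpa using Finset.card_le_univ (candidates s lev)

end StageCosts

/-! ### Total cost of the refinements -/

section RefineTotal

variable {K : ℕ} {G : SimpleGraph (Fin K)} {m : Fin K → ℝ} {s : ℕ} {lev : Fin K → ℕ}

theorem sum_ite_lt_le {f : ℕ → ℝ} {M : ℕ} {v : ℝ} (F : Finset ℕ) (hv : 0 ≤ v)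
    (hf : ∀ s, s < M → f s ≤ v) : ∑ s ∈ F, (if s < M then f s else 0) ≤ M * v := by
  rw [← Finset.sum_filter]
  calc ∑ s ∈ F with s < M, f s ≤ ∑ s ∈ F with s < M, v :=
        Finset.sum_le_sum fun s hs => hf s (Finset.mem_filter.1 hs).2
    _ = (F.filter (· < M)).card * v := by rw [Finset.sum_const, nsmul_eq_mul]
    _ ≤ M * v := by
        gcongr
        calc (F.filter (· < M)).card ≤ (Finset.range M).card :=
              Finset.card_le_card fun s hs => Finset.mem_range.2 (Finset.mem_filter.1 hs).2
          _ = M := Finset.card_range M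

/-- Scales that differ by a factor below `K` at most belong to stages at distance `O(log K)`. -/
theorem lt_of_scale_lt {a b : ℕ} (h : scale a < K * scale b) :
    b < a + 2 * baseStage K := by
  by_contra hle
  have h1 : (K : ℝ) ≤ 2 ^ (2 * baseStage K) := by
    have := le_four_pow (K := K) le_rfl
    rw [pow_mul]
    exact_mod_cast this
  have h2 := scale_anti (not_lt.1 hle)
  rw [scale_add, le_div_iff₀ (by positivity)] at h2
  have h3 := mul_le_mul_of_nonneg_right h1 (scale_pos b).le
  linarith

/-- The cost of an early refinement with lag. As long as the refinement lags, the candidates are the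
arms whose gap is below a threshold that does not depend on the stage. The LP of observing these
arms at stage `s` is cheaper than at stage `s + k` by a factor `2 ^ k` at least. -/
theorem Valid.refineCost_le_early (h : Valid m s lev) (hK : 1 ≤ K)
    (hm : ∀ i, m i ∈ Set.Icc (0 : ℝ) 1) (hg : ∃ i, 0 < gap m i) (hs : baseStage K < s)
    (hr : lag s lev = Nat.log 2 (baseStage K)) {k : ℕ} (hk : s + k ≤ gapLevel m + 1)
    (hgood : ∀ i, gap m i < scale (baseStage K / 4) / 2 → gap m i ≤ 2 * scale (s + k)) :
    ∑ a, refineCount G s lev a * gap m a ≤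
      256 * sampleFactor s * baseStage K * (1 / 2) ^ k * dStar G m := by
  have h8 := le_baseStage (K := K)
  set B := baseStage K with hB
  set r := lag s lev with hrdef
  have h1 : ∑ a, refineCount G s lev a * gap m a ≤
      4 * sampleFactor s * (2 * 2 ^ r) * (2 * 2 ^ k) / 4 ^ k * phaseValue G m (s + k) := by
    refine refineCost_le hs.le lev k (by positivity) (by positivity) (h.gap_le_estCost r)
      (fun a => (h.estCost_le r a).trans ?_) fun i hi => hgood i ?_
    · have h2 : clippedGap m (s + r) a ≤ clippedGap m s a :=
        max_le_max (scale_anti (by omega)) le_rfl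
      have h3 : clippedGap m s a ≤ 2 ^ k * clippedGap m (s + k) a := by
        have h4 : (1 : ℝ) ≤ 2 ^ k := one_le_pow₀ (by norm_num)
        refine max_le ?_ ?_
        · calc scale s = 2 ^ k * scale (s + k) := by
                rw [scale_add, mul_div_cancel₀ _ (by positivity)]
            _ ≤ _ := by gcongr; exact scale_le_clippedGap m (s + k) a
        · have h5 := gap_le_clippedGap m (s + k) a
          have h6 := gap_nonneg m a
          nlinarith
      linarith
    · have h2 := h.gap_le_of_candidate hi
      have h3 := scale_anti (show B / 4 + 3 ≤ s by omega)
      rw [scale_add] at h3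
      have := scale_pos (B / 4)
      linarith
  refine h1.trans ?_
  have h2 : (2 : ℝ) ^ r ≤ B := by rw [hr]; exact two_pow_log_le
  have h3 := phaseValue_le_of_le (G := G) hK hm hg hk
  have hd : 0 ≤ dStar G m := zero_le_one.trans (one_le_dStar hK hm hg)
  have hD := (phaseValue_pos (G := G) (m := m) hK (s + k)).le
  have h4 : (2 : ℝ) ^ k / 4 ^ k = (1 / 2) ^ k := by rw [← div_pow]; norm_num
  calc 4 * sampleFactor s * (2 * 2 ^ r) * (2 * 2 ^ k) / 4 ^ k * phaseValue G m (s + k)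
      = 16 * sampleFactor s * 2 ^ r * (2 ^ k / 4 ^ k) * phaseValue G m (s + k) := by ring
    _ ≤ 16 * sampleFactor s * B * (1 / 2) ^ k * (16 * dStar G m) := by rw [h4]; gcongr
    _ = _ := by ring

/-- The total cost of all refinements with correct levels. -/
theorem exists_refineBound (hK : 1 ≤ K) (hm : ∀ i, m i ∈ Set.Icc (0 : ℝ) 1)
    (hg : ∃ i, 0 < gap m i) : ∃ b : ℕ → ℝ, (∀ s, 0 ≤ b s) ∧
      (∀ s, baseStage K < s → ∀ lev, Valid m s lev →
        ∑ a, refineCount G s lev a * gap m a ≤ b s) ∧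
      ∀ S, ∑ s ∈ Finset.Ico (baseStage K + 1) S, b s ≤
        184320 * 25000 * (gapLevel m + 1 : ℝ) ^ 2 * dStar G m := by
  classical
  have h8 := le_baseStage (K := K)
  have h8' : (8 : ℝ) ≤ baseStage K := by exact_mod_cast h8
  have hd : 0 ≤ dStar G m := zero_le_one.trans (one_le_dStar hK hm hg)
  set B := baseStage K with hB
  set p := gapLevel m + 1 with hp
  set d := dStar G m with hdef
  have hpc : (gapLevel m + 1 : ℝ) = p := by rw [hp]; push_cast; ring
  have hp1 : (1 : ℝ) ≤ p := by
    rw [hp]; push_cast; linarith [(Nat.cast_nonneg (gapLevel m) : (0 : ℝ) ≤ _)]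
  set Q : ℕ → Prop := fun s => ∀ i, gap m i < scale (B / 4) / 2 → gap m i ≤ 2 * scale s with hQ
  -- the last stage that is not later than `p` and at which the refinement may lag
  set t := Nat.findGreatest Q p with ht
  have htp : t ≤ p := Nat.findGreatest_le p
  -- refinements without lag, early ones with lag, and late ones with lag
  set b₁ : ℕ → ℝ := fun s => if s < 9 * p then 256 * (184320 * s) * d else 0 with hb₁
  set b₂ : ℕ → ℝ := fun s =>
    if s < t + 1 then 256 * (184320 * s) * B * (1 / 2) ^ (t - s) * d else 0 with hb₂
  set b₃ : ℕ → ℝ := fun s => if s < 3 * B then 64 * (184320 * s) * (4 / B ^ 2) * d else 0 with hb₃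
  have n₁ : ∀ s, 0 ≤ b₁ s := fun s => by simp only [hb₁]; split_ifs <;> positivity
  have n₂ : ∀ s, 0 ≤ b₂ s := fun s => by simp only [hb₂]; split_ifs <;> positivity
  have n₃ : ∀ s, 0 ≤ b₃ s := fun s => by simp only [hb₃]; split_ifs <;> positivity
  have hN : ∀ s, (sampleFactor s : ℝ) = 184320 * s := fun s => by
    unfold sampleFactor; push_cast; ring
  refine ⟨fun s => b₁ s + b₂ s + b₃ s, fun s => by linarith [n₁ s, n₂ s, n₃ s],
    fun s hs lev h => ?_, fun S => ?_⟩
  · have m₁ := n₁ s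
    have m₂ := n₂ s
    have m₃ := n₃ s
    rcases Nat.lt_or_ge (gapLevel m + 1) s with hl | hl
    · rcases h.refineCost_le_late (G := G) hK hg hs.le hl with ⟨hcost, i, hi, hlt⟩ | h0
      · have hsr := lt_of_scale_lt hlt
        rcases lag_cases s lev with ⟨hr, j, hj, hjB⟩ | ⟨hr, hlag⟩
        · have hli := h.lev_le hg hi
          have hlj := h.lev_le hg hj
          have e : b₁ s = 256 * (184320 * s) * d := if_pos (by omega)
          rw [hr, pow_zero, div_one, hN] at hcost
          have : 0 ≤ (184320 * s : ℝ) * d := by positivity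
          linarith
        · have hli := hlag i hi
          have e : b₃ s = 64 * (184320 * s) * (4 / B ^ 2) * d := if_pos (by omega)
          have h2 := sq_lt_four_pow_log (K := K)
          rw [hr, hN] at hcost
          have h3 : (1 : ℝ) / 4 ^ Nat.log 2 B ≤ 4 / B ^ 2 := by
            rw [div_le_div_iff₀ (by positivity) (by positivity)]
            linarith
          have h4 : 64 * (184320 * s : ℝ) / 4 ^ Nat.log 2 B * d ≤
              64 * (184320 * s) * (4 / B ^ 2) * d := by
            rw [div_eq_mul_one_div]
            gcongr
          linarith
      · linarith
    · rcases lag_cases s lev with ⟨hr, -⟩ | ⟨hr, hlag⟩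
      · have e : b₁ s = 256 * (184320 * s) * d := if_pos (by omega)
        have h1 := refineCost_le (G := G) hs.le lev 0 (c₁ := 2) (c₂ := 2) (by norm_num)
          (by norm_num) (fun a => by have := h.gap_le_estCost 0 a; rw [hr]; simpa using this)
          (fun a => by have := h.estCost_le 0 a; rw [hr]; exact this)
          fun i hi => h.gap_le_of_candidate hi
        have h2 := phaseValue_le_of_le (G := G) hK hm hg hl
        rw [pow_zero, div_one, hN, add_zero] at h1
        have h3 : 4 * (184320 * s : ℝ) * 2 * 2 * phaseValue G m s ≤
          4 * (184320 * s : ℝ) * 2 * 2 * (16 * d) := by gcongr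
        linarith
      · have hQs : Q s := fun i hi => by
          refine h.gap_le_of_candidate (mem_candidates.2 ?_)
          by_contra hlt
          have h1 := (h i).2.2 (not_le.1 hlt)
          have h2 := scale_anti (show lev i ≤ B / 4 by have := hlag i (not_le.1 hlt); omega)
          linarith
        have hst : s ≤ t := Nat.le_findGreatest hl hQs
        have hQt : Q t := Nat.findGreatest_spec (P := Q) hl hQs
        have e : b₂ s = 256 * (184320 * s) * B * (1 / 2) ^ (t - s) * d := if_pos (by omega)
        have e2 : s + (t - s) = t := by omega
        have h1 := h.refineCost_le_early (G := G) hK hm hg hs hr (k := t - s)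
          (by rw [e2]; exact htp) (by rw [e2]; exact hQt)
        rw [hN] at h1
        linarith
  · rw [Finset.sum_add_distrib, Finset.sum_add_distrib, hpc]
    have s₁ : ∑ s ∈ Finset.Ico (B + 1) S, b₁ s ≤
        (9 * p : ℕ) * (256 * (184320 * (9 * p)) * d) := by
      refine sum_ite_lt_le _ (by positivity) fun s hs => ?_
      have : (s : ℝ) ≤ 9 * p := by exact_mod_cast hs.le
      gcongr
    have s₃ : ∑ s ∈ Finset.Ico (B + 1) S, b₃ s ≤
        (3 * B : ℕ) * (64 * (184320 * (3 * B)) * (4 / B ^ 2) * d) := by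
      refine sum_ite_lt_le _ (by positivity) fun s hs => ?_
      have : (s : ℝ) ≤ 3 * B := by exact_mod_cast hs.le
      gcongr
    have s₂ : ∑ s ∈ Finset.Ico (B + 1) S, b₂ s ≤ 256 * 184320 * p ^ 2 * d * 2 := by
      calc ∑ s ∈ Finset.Ico (B + 1) S, b₂ s
          ≤ ∑ s ∈ Finset.Ico (B + 1) S,
              (if s < t + 1 then 256 * 184320 * p ^ 2 * d * (1 / 2) ^ (t - s) else 0) := by
            refine Finset.sum_le_sum fun s hs => ?_
            simp only [hb₂]
            split_ifs with hst
            · have h1 : (s : ℝ) ≤ p := by exact_mod_cast (by omega : s ≤ p)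
              have h2 : (B : ℝ) ≤ p := by
                have := (Finset.mem_Ico.1 hs).1
                exact_mod_cast (by omega : B ≤ p)
              calc 256 * (184320 * s) * B * (1 / 2) ^ (t - s) * d
                  ≤ 256 * (184320 * p) * p * (1 / 2) ^ (t - s) * d := by gcongr
                _ = _ := by ring
            · exact le_rfl
        _ ≤ ∑ s ∈ Finset.range (t + 1), 256 * 184320 * p ^ 2 * d * (1 / 2) ^ (t - s) := by
            rw [← Finset.sum_filter]
            refine Finset.sum_le_sum_of_subset_of_nonneg (fun s hs => ?_)
              fun _ _ _ => by positivity
            exact Finset.mem_range.2 (Finset.mem_filter.1 hs).2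
        _ = 256 * 184320 * p ^ 2 * d * ∑ s ∈ Finset.range (t + 1), (1 / 2 : ℝ) ^ s := by
            rw [← Finset.mul_sum, ← Finset.sum_range_reflect]
            congr 1
            refine Finset.sum_congr rfl fun s hs => ?_
            rw [Finset.mem_range] at hs
            congr 1
            omega
        _ ≤ _ := by
            gcongr
            rw [geom_sum_eq (by norm_num)]
            have : (0 : ℝ) ≤ (1 / 2) ^ (t + 1) := by positivity
            rw [div_le_iff_of_neg (by norm_num)]
            linarith
    have e₃ : ((3 * B : ℕ) : ℝ) * (64 * (184320 * (3 * B)) * (4 / B ^ 2) * d) =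
        184320 * 2304 * d := by
      push_cast
      field_simp
      ring
    have hpd : d ≤ p ^ 2 * d := le_mul_of_one_le_left hd (one_le_pow₀ hp1)
    push_cast at s₁ s₃ e₃
    nlinarith

end RefineTotal

/-! ### Cost of the verifications -/

section VerifyTotal

variable {K : ℕ} {G : SimpleGraph (Fin K)} {m : Fin K → ℝ} {s : ℕ} {lev : Fin K → ℕ}

theorem exists_phase_solution (hK : 1 ≤ K) (G : SimpleGraph (Fin K)) (m : Fin K → ℝ) (s : ℕ) :
    ∃ x : Fin K → ℝ, (∀ i, 0 ≤ x i) ∧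
      (∀ i, gap m i ≤ 2 * scale s → 1 / scale s ^ 2 ≤ ∑ j ∈ nbhd G i, x j) ∧
      ∑ i, clippedGap m s i * x i ≤ 2 * phaseValue G m s := by
  by_contra hno
  push Not at hno
  have h1 := le_phaseValue G m s (v := 2 * phaseValue G m s) fun x hx hc => (hno x hx hc).le
  linarith [phaseValue_pos (G := G) (m := m) hK s]

theorem le_cStar {v : ℝ} (h : ∀ x : Fin K → ℝ, (∀ i, 0 ≤ x i) →
    (∀ i, i ∉ optArms m → 1 / gap m i ^ 2 ≤ ∑ j ∈ nbhd G i, x j) →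
      v ≤ ∑ i, x i * gap m i) : v ≤ cStar G m := by
  refine le_csInf ⟨_, fun i => 1 / gap m i ^ 2, fun _ => by positivity, fun i _ => ?_, rfl⟩ ?_
  · exact Finset.single_le_sum (f := fun i => 1 / gap m i ^ 2) (fun _ _ => by positivity)
      (self_mem_nbhd G i)
  · rintro _ ⟨y, hy, hc, rfl⟩
    exact h y hy hc

theorem cStar_nonneg : 0 ≤ cStar G m :=
  le_cStar fun _ hx _ => Finset.sum_nonneg fun i _ => mul_nonneg (hx i) (gap_nonneg m i)

theorem Valid.verifyCost_le_estCost (h : Valid m s lev) :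
    ∑ a, verifyCount G s lev a * gap m a ≤
      2 * ∑ a, estCost s 0 lev a * verifyCount G s lev a := by
  rw [Finset.mul_sum]
  refine Finset.sum_le_sum fun a _ => ?_
  have h1 := h.gap_le_estCost 0 a
  rw [pow_zero, mul_one] at h1
  have := mul_le_mul_of_nonneg_left h1 (Nat.cast_nonneg (α := ℝ) (verifyCount G s lev a))
  linarith

/-- If every suboptimal arm has an optimal neighbor, then optimal arms verify all others for
free. -/
theorem Valid.verifyCost_le_zero (h : Valid m s lev) (hg : ∃ i, 0 < gap m i)
    (hs : baseStage K ≤ s) (hl : gapLevel m + 2 ≤ s) (hsep : Separated G s lev) :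
    ∑ a, verifyCount G s lev a * gap m a ≤ 0 := by
  refine Finset.sum_nonpos fun a _ => ?_
  by_cases ha : lev a < s
  · simp [((verifyCount_spec G hs lev).2.2.1 hsep a).2 ha]
  · have h1 : a ∈ candidates s lev := mem_candidates.2 (not_lt.1 ha)
    rw [h.candidates_eq hg hl, mem_optArms] at h1
    rw [h1, mul_zero]

/-- The cost of a verification: the arms of level `v` are observed by a solution of the LP of phase
`v`. -/
theorem Valid.verifyCost_le (h : Valid m s lev) (hK : 1 ≤ K)
    (hm : ∀ i, m i ∈ Set.Icc (0 : ℝ) 1) (hg : ∃ i, 0 < gap m i) (hs : 4 * baseStage K ≤ s) :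
    ∑ a, verifyCount G s lev a * gap m a ≤
      512 * sampleFactor s * (gapLevel m + 1) * dStar G m + 2 * K := by
  classical
  have hsB : baseStage K ≤ s := by omega
  have hd := one_le_dStar (G := G) hK hm hg
  have hN : (1 : ℝ) ≤ sampleFactor s := by exact_mod_cast one_le_sampleFactor hsB
  have hl0 : (0 : ℝ) ≤ gapLevel m := Nat.cast_nonneg _
  by_cases hsep : Separated G s lev
  · rcases Nat.lt_or_ge s (gapLevel m + 2) with hl | hl
    · have h1 : ∀ a, (verifyCount G s lev a : ℝ) * gap m a ≤
          sampleFactor s * 4 ^ (s / 8) * (2 * scale s) := fun a => by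
        obtain ⟨h2, h3⟩ := (verifyCount_spec G hsB lev).2.2.1 hsep a
        have hsc := scale_pos s
        by_cases ha : lev a < s
        · rw [h3 ha]
          simp only [Nat.cast_zero, zero_mul]
          positivity
        · have h4 := h.gap_le_of_candidate (mem_candidates.2 (not_lt.1 ha))
          have h5 : (verifyCount G s lev a : ℝ) ≤ sampleFactor s * 4 ^ (s / 8) := by
            exact_mod_cast h2
          gcongr
          exact gap_nonneg m a
      have h2 : (K : ℝ) * 4 ^ (s / 8) ≤ 2 ^ s := by
        have h3 : K ≤ 4 ^ (s / 4) := le_four_pow (by omega)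
        have h4 : K * 4 ^ (s / 8) ≤ 2 ^ s := by
          calc K * 4 ^ (s / 8) ≤ 4 ^ (s / 4) * 4 ^ (s / 8) := Nat.mul_le_mul_right _ h3
            _ = 2 ^ (2 * (s / 4 + s / 8)) := by rw [pow_mul, ← pow_add]; norm_num
            _ ≤ 2 ^ s := Nat.pow_le_pow_right (by norm_num) (by omega)
        exact_mod_cast h4
      have h3 : (2 : ℝ) ^ s * scale s = 1 := by unfold scale; exact mul_inv_cancel₀ (by positivity)
      calc ∑ a, (verifyCount G s lev a : ℝ) * gap m a
          ≤ ∑ _a : Fin K, sampleFactor s * 4 ^ (s / 8) * (2 * scale s) :=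
            Finset.sum_le_sum fun a _ => h1 a
        _ = 2 * sampleFactor s * ((K * 4 ^ (s / 8)) * scale s) := by
            rw [Finset.sum_const, Finset.card_univ, Fintype.card_fin, nsmul_eq_mul]; ring
        _ ≤ 2 * sampleFactor s * (2 ^ s * scale s) := by
            gcongr; exact (scale_pos s).le
        _ = 2 * sampleFactor s * 1 * 1 := by rw [h3]; ring
        _ ≤ 512 * sampleFactor s * (gapLevel m + 1) * dStar G m := by
            gcongr
            · norm_num
            · linarith
        _ ≤ _ := by
            have : (0 : ℝ) ≤ K := Nat.cast_nonneg _
            linarith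
    · refine (h.verifyCost_le_zero hg hsB hl hsep).trans ?_
      positivity
  · -- only the `O(gapLevel m)` levels that occur are summed over
    choose x hx hc hcost using exists_phase_solution hK G m
    set V := Finset.range (min (gapLevel m + 2) s) with hV
    have h1 := (verifyCount_spec G hsB lev).2.2.2.1 hsep (fun a => ∑ v ∈ V, x v a)
      (fun a => Finset.sum_nonneg fun v _ => hx v a) fun i hi => by
        have h2 : lev i ∈ V := Finset.mem_range.2 (by have := h.lev_le hg hi; omega)
        have h3 := hc (lev i) i (h i).2.1
        rw [one_div_scale_sq] at h3
        refine h3.trans (Finset.sum_le_sum fun j _ => ?_)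
        exact Finset.single_le_sum (f := fun v => x v j) (fun v _ => hx v j) h2
    have h2 : ∑ a, estCost s 0 lev a * ∑ v ∈ V, x v a ≤
        128 * (gapLevel m + 1) * dStar G m := by
      calc ∑ a, estCost s 0 lev a * ∑ v ∈ V, x v a
          = ∑ v ∈ V, ∑ a, estCost s 0 lev a * x v a := by
            simp only [Finset.mul_sum]
            exact Finset.sum_comm
        _ ≤ ∑ v ∈ V, 64 * dStar G m := by
            refine Finset.sum_le_sum fun v hv => ?_
            have hv' := Finset.mem_range.1 hv
            have h3 : ∑ a, estCost s 0 lev a * x v a ≤ 2 * ∑ a, clippedGap m v a * x v a := by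
              rw [Finset.mul_sum]
              refine Finset.sum_le_sum fun a _ => ?_
              have h4 := h.estCost_le 0 a
              have h5 : clippedGap m (s + 0) a ≤ clippedGap m v a :=
                max_le_max (scale_anti (by omega)) le_rfl
              rw [← mul_assoc]
              exact mul_le_mul_of_nonneg_right (by linarith) (hx v a)
            have h4 := hcost v
            have h5 := phaseValue_le_of_le (G := G) hK hm hg (s := v) (by omega)
            linarith
        _ = V.card * (64 * dStar G m) := by rw [Finset.sum_const, nsmul_eq_mul]
        _ ≤ (2 * (gapLevel m + 1)) * (64 * dStar G m) := by
            gcongr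
            have : V.card ≤ 2 * (gapLevel m + 1) := by rw [hV, Finset.card_range]; omega
            exact_mod_cast this
        _ = _ := by ring
    refine h.verifyCost_le_estCost.trans ?_
    have h3 : 2 * (sampleFactor s : ℝ) * (∑ a, estCost s 0 lev a * ∑ v ∈ V, x v a) ≤
        2 * sampleFactor s * (128 * (gapLevel m + 1) * dStar G m) := by gcongr
    linarith

/-- The cost of a late verification. It vanishes if every suboptimal arm has an optimal neighbor;
otherwise `cStar` is at least the smallest positive gap. -/
theorem Valid.verifyCost_le_late (h : Valid m s lev) (hm : ∀ i, m i ∈ Set.Icc (0 : ℝ) 1)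
    (hg : ∃ i, 0 < gap m i) (hsB : baseStage K ≤ s) (hl : 8 * (gapLevel m + 2) ≤ s) :
    ∑ a, verifyCount G s lev a * gap m a ≤ 0 ∨ (gapMin m ≤ cStar G m ∧
      ∑ a, verifyCount G s lev a * gap m a ≤ 32 * sampleFactor s * cStar G m + 1500000 * K) := by
  classical
  by_cases hsep : Separated G s lev
  · exact Or.inl (h.verifyCost_le_zero hg hsB (by omega) hsep)
  right
  have hcand := h.candidates_eq hg (by omega : gapLevel m + 2 ≤ s)
  have hopt : ∀ i, lev i < s ↔ i ∉ optArms m := fun i => by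
    rw [← hcand, mem_candidates, not_le]
  constructor
  · obtain ⟨i, hi⟩ := not_forall.1 hsep
    rw [Classical.not_imp, not_and] at hi
    obtain ⟨hi, hno⟩ := hi
    have hno := hno (by have := h.lev_le hg hi; omega)
    push Not at hno
    refine le_cStar fun x hx hc => ?_
    have h1 := hc i ((hopt i).1 hi)
    have hpos := h.gap_pos hi
    have h2 : 1 ≤ 1 / gap m i ^ 2 := by
      rw [le_div_iff₀ (by positivity), one_mul]
      exact pow_le_one₀ hpos.le (gap_le_one hm i)
    have hgm := gapMin_pos hg
    calc gapMin m ≤ (∑ j ∈ nbhd G i, x j) * gapMin m :=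
          le_mul_of_one_le_left hgm.le (h2.trans h1)
      _ = ∑ j ∈ nbhd G i, x j * gapMin m := Finset.sum_mul _ _ _
      _ ≤ ∑ j ∈ nbhd G i, x j * gap m j := by
          refine Finset.sum_le_sum fun j hj => mul_le_mul_of_nonneg_left (gapMin_le ?_) (hx j)
          refine gap_pos_iff.2 fun hjo => ?_
          rw [← hcand] at hjo
          exact hno j hjo hj
      _ ≤ _ := Finset.sum_le_sum_of_subset_of_nonneg (Finset.subset_univ _) fun j _ _ =>
          mul_nonneg (hx j) (gap_nonneg m j)
  · have hN : (1 : ℝ) ≤ sampleFactor s := by exact_mod_cast one_le_sampleFactor hsB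
    set p := gapLevel m + 1 with hp
    -- capped at `4 ^ p`, the plays of the candidates have negligible estimated cost
    have hsmall : (sampleFactor s : ℝ) * (scale s * 4 ^ p) ≤ 368640 := by
      have h1 : s * 4 ^ p ≤ 2 * 2 ^ s := by
        have h2 : s / 2 < 2 ^ (s / 2) := Nat.lt_two_pow_self
        calc s * 4 ^ p ≤ (2 * 2 ^ (s / 2)) * 4 ^ (s / 8) := by
              refine Nat.mul_le_mul (by omega) (Nat.pow_le_pow_right (by norm_num) (by omega))
          _ = 2 * 2 ^ (s / 2 + 2 * (s / 8)) := by
              rw [pow_add, pow_mul 2 2]; norm_num; ring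
          _ ≤ 2 * 2 ^ s :=
              Nat.mul_le_mul_left _ (Nat.pow_le_pow_right (by norm_num) (by omega))
      have h1' : (s : ℝ) * 4 ^ p ≤ 2 * 2 ^ s := by exact_mod_cast h1
      have h3 : (2 : ℝ) ^ s * scale s = 1 := by unfold scale; exact mul_inv_cancel₀ (by positivity)
      calc (sampleFactor s : ℝ) * (scale s * 4 ^ p) = 184320 * (s * 4 ^ p * scale s) := by
            unfold sampleFactor; push_cast; ring
        _ ≤ 184320 * (2 * 2 ^ s * scale s) := by gcongr; exact (scale_pos s).le
        _ = 368640 := by rw [mul_assoc 2, h3]; norm_num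
    have key : ((∑ a, verifyCount G s lev a * gap m a) - 1500000 * K) / (32 * sampleFactor s) ≤
        cStar G m := by
      refine le_cStar fun x hx hc => ?_
      rw [div_le_iff₀ (by positivity)]
      have h0 : ∀ i, lev i < s → (4 : ℝ) ^ lev i ≤ ∑ j ∈ nbhd G i, 4 * x j := fun i hi => by
        have h1 := hc i ((hopt i).1 hi)
        have hpos := h.gap_pos hi
        have h2 := (h i).2.1
        have h3 : 4 ^ lev i / 4 ≤ 1 / gap m i ^ 2 := by
          rw [div_le_div_iff₀ (by norm_num) (by positivity)]
          have h4 : gap m i ^ 2 ≤ (2 * scale (lev i)) ^ 2 := by gcongr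
          have h5 := four_pow_mul_scale_sq (lev i)
          calc (4 : ℝ) ^ lev i * gap m i ^ 2 ≤ 4 ^ lev i * (2 * scale (lev i)) ^ 2 := by gcongr
            _ = 4 * (4 ^ lev i * scale (lev i) ^ 2) := by ring
            _ ≤ 1 * 4 := by rw [h5]; norm_num
        rw [← Finset.mul_sum]
        linarith
      have h1 := cover_min G (S := Finset.univ.filter fun i => lev i < s) (M := 4 ^ p)
        (fun i => mul_nonneg (by norm_num : (0 : ℝ) ≤ 4) (hx i))
        (fun i hi => pow_le_pow_right₀ (by norm_num)
          (h.lev_le hg (Finset.mem_filter.1 hi).2)) (by positivity)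
        fun i hi => h0 i (Finset.mem_filter.1 hi).2
      have h2 := (verifyCount_spec G hsB lev).2.2.2.1 hsep (fun a => min (4 * x a) (4 ^ p))
        (fun a => le_min (mul_nonneg (by norm_num) (hx a)) (by positivity))
        fun i hi => h1 i (Finset.mem_filter.2 ⟨Finset.mem_univ _, hi⟩)
      have h3 : ∑ a, estCost s 0 lev a * min (4 * x a) (4 ^ p) ≤
          8 * (∑ a, x a * gap m a) + K * (scale s * 4 ^ p) := by
        calc ∑ a, estCost s 0 lev a * min (4 * x a) (4 ^ p)
            ≤ ∑ a, (8 * (x a * gap m a) + scale s * 4 ^ p) := by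
              refine Finset.sum_le_sum fun a _ => ?_
              have h4 := mul_nonneg (hx a) (gap_nonneg m a)
              have h5 := scale_pos s
              unfold estCost
              split_ifs with ha
              · have h6 := (h a).2.2 ha
                have h7 : (0 : ℝ) ≤ scale s * 4 ^ p := by positivity
                calc scale (lev a) * min (4 * x a) (4 ^ p) ≤ (2 * gap m a) * (4 * x a) := by
                      refine mul_le_mul (by linarith) (min_le_left _ _) (le_min ?_ ?_) ?_
                      · linarith [hx a]
                      · positivity
                      · linarith [gap_nonneg m a]
                  _ = 8 * (x a * gap m a) := by ring
                  _ ≤ _ := by linarith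
              · rw [add_zero]
                calc scale s * min (4 * x a) (4 ^ p) ≤ scale s * 4 ^ p := by
                      gcongr; exact min_le_right _ _
                  _ ≤ _ := by linarith
          _ = _ := by
              rw [Finset.sum_add_distrib, ← Finset.mul_sum]; simp
      have h4 := h.verifyCost_le_estCost (G := G)
      have h5 : 2 * (sampleFactor s : ℝ) * (∑ a, estCost s 0 lev a * min (4 * x a) (4 ^ p)) ≤
          2 * sampleFactor s * (8 * (∑ a, x a * gap m a) + K * (scale s * 4 ^ p)) := by gcongr
      have h6 := mul_le_mul_of_nonneg_left hsmall (Nat.cast_nonneg (α := ℝ) K)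
      linarith
    rw [div_le_iff₀ (by positivity)] at key
    linarith

open scoped Classical in
/-- Check stages grow geometrically. -/
theorem exists_card_checks (K : ℕ) {M : ℕ} (hM : 1 ≤ M) : ∃ n : ℕ, 4 ^ n ≤ M ∧
    {s ∈ Finset.range M | IsCheck K s}.card ≤ n ∧
    ∑ s ∈ Finset.range M with IsCheck K s, s ≤ 2 * M := by
  have hB := le_baseStage (K := K)
  have hex : ∃ n, M ≤ baseStage K * 4 ^ n := ⟨M, by
    have h1 : M < 4 ^ M := Nat.lt_pow_self (by norm_num)
    nlinarith⟩
  set n := Nat.find hex with hn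
  have hspec : M ≤ baseStage K * 4 ^ n := Nat.find_spec hex
  have hsub : {s ∈ Finset.range M | IsCheck K s} ⊆
      (Finset.range n).image fun k => baseStage K * 4 ^ k := fun s hs => by
    obtain ⟨hsM, k, rfl⟩ := Finset.mem_filter.1 hs
    refine Finset.mem_image.2 ⟨k, Finset.mem_range.2 ?_, rfl⟩
    by_contra hle
    have := Nat.mul_le_mul_left (baseStage K)
      (Nat.pow_le_pow_right (by norm_num : 0 < 4) (not_lt.1 hle))
    have := Finset.mem_range.1 hsM
    omega
  have hsum : ∀ j, 3 * ∑ k ∈ Finset.range j, baseStage K * 4 ^ k ≤ baseStage K * 4 ^ j := by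
    intro j
    induction j with
    | zero => simp
    | succ j ih => rw [Finset.sum_range_succ, pow_succ, ← mul_assoc]; omega
  have hle : ∑ s ∈ Finset.range M with IsCheck K s, s ≤
      ∑ k ∈ Finset.range n, baseStage K * 4 ^ k :=
    (Finset.sum_le_sum_of_subset hsub).trans
      (Finset.sum_image_le_of_nonneg fun _ _ => Nat.zero_le _)
  refine ⟨n, ?_, (Finset.card_le_card hsub).trans (Finset.card_image_le.trans
    (Finset.card_range n).le), hle.trans ?_⟩
  · rcases hn' : n with _ | k
    · simpa using hM
    · have h1 := Nat.find_min hex (m := k) (by omega)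
      have h2 : 4 * 4 ^ k ≤ baseStage K * 4 ^ k := Nat.mul_le_mul_right _ (by omega)
      rw [pow_succ]
      omega
  · have h3 := hsum n
    rcases hn' : n with _ | k
    · simp
    · have h1 := Nat.find_min hex (m := k) (by omega)
      rw [hn', pow_succ, ← mul_assoc] at h3
      omega

end VerifyTotal

/-! ### Upper bound -/

section Total

variable {K : ℕ} {G : SimpleGraph (Fin K)} {m : Fin K → ℝ}

theorem natCast_le_log_of_four_pow_le {n M : ℕ} (h : 4 ^ n ≤ M) : (n : ℝ) ≤ Real.log M := by
  have h1 : (Real.exp 1) ^ n ≤ (M : ℝ) := by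
    have h2 : Real.exp 1 ≤ 4 := by linarith [Real.exp_one_lt_d9]
    calc (Real.exp 1) ^ n ≤ 4 ^ n := by gcongr
      _ ≤ M := by exact_mod_cast h
  rw [← Real.exp_nat_mul, mul_one] at h1
  rwa [← Real.le_log_iff_exp_le ((Real.exp_pos _).trans_le h1)] at h1

theorem log_one_div_gapMin_le (hg : ∃ i, 0 < gap m i) :
    Real.log (1 / gapMin m) ≤ gapLevel m + 1 := by
  have h1 := scale_gapLevel_le hg
  have h2 : 1 / gapMin m ≤ 2 ^ gapLevel m := by
    rw [div_le_iff₀ (gapMin_pos hg)]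
    have h3 : (2 : ℝ) ^ gapLevel m * scale (gapLevel m) = 1 := by
      unfold scale; exact mul_inv_cancel₀ (by positivity)
    rw [← h3]
    gcongr
  calc Real.log (1 / gapMin m) ≤ Real.log (2 ^ gapLevel m) :=
        Real.log_le_log (by have := gapMin_pos hg; positivity) h2
    _ = gapLevel m * Real.log 2 := Real.log_pow _ _
    _ ≤ gapLevel m * 1 := by gcongr; linarith [Real.log_two_lt_d9]
    _ ≤ _ := by linarith

/-- A logarithmic number of rounding errors `y` is absorbed by `x * z` and `y * log y`. -/
theorem log_le_split {x y z : ℝ} (hx : 0 < x) (hy : 0 < y) (hz : 0 < z) :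
    y * Real.log x ≤ x * z + y * Real.log y + y * Real.log (1 / z) := by
  have h1 := Real.log_le_sub_one_of_pos (x := x * z / y) (by positivity)
  rw [Real.log_div (by positivity) hy.ne', Real.log_mul hx.ne' hz.ne'] at h1
  rw [one_div, Real.log_inv]
  have h2 : y * (x * z / y) = x * z := by field_simp
  nlinarith [mul_le_mul_of_nonneg_left h1 hy.le]

/-- The number of checks before the gaps are resolved is paid for, since `dStar` is exponentially
large in the logarithm of the smallest positive gap. -/
theorem card_mul_gapLevel_le (hK : 2 ≤ K) (hm : ∀ i, m i ∈ Set.Icc (0 : ℝ) 1)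
    (hg : ∃ i, 0 < gap m i) :
    K * (gapLevel m + 1 : ℝ) ≤ 3 * (K * Real.log K) + 8 * dStar G m := by
  have hd := two_pow_gapLevel_le (G := G) (by omega : 1 ≤ K) hm hg
  have hd1 := one_le_dStar (G := G) (by omega : 1 ≤ K) hm hg
  set p := gapLevel m + 1 with hp
  have hpc : (gapLevel m + 1 : ℝ) = p := by rw [hp]; push_cast; ring
  rw [hpc]
  have hd2 : (2 : ℝ) ^ p ≤ 4 * dStar G m := by rw [hp, pow_succ]; linarith
  have hK' : (2 : ℝ) ≤ K := by exact_mod_cast hK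
  have hlog : 0 ≤ Real.log K := Real.log_nonneg (by linarith)
  rcases le_total ((2 : ℝ) ^ p) (K ^ 2) with h | h
  · have h1 := Real.log_le_log (by positivity) h
    rw [Real.log_pow, Real.log_pow] at h1
    have h2 := Real.log_two_gt_d9
    have h3 : (p : ℝ) ≤ 3 * Real.log K := by
      have : (0 : ℝ) ≤ p := Nat.cast_nonneg _
      push_cast at h1
      nlinarith
    have h4 := mul_le_mul_of_nonneg_left h3 (by linarith : (0 : ℝ) ≤ K)
    linarith
  · have h1 : ∀ q : ℕ, q ^ 2 ≤ 2 * 2 ^ q := fun q => by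
      induction q with
      | zero => simp
      | succ q ih =>
        rcases Nat.lt_or_ge q 3 with hq | hq
        · interval_cases q <;> norm_num
        · rw [pow_succ 2 q]; nlinarith
    have h2 : (p : ℝ) ^ 2 ≤ 2 * 2 ^ p := by exact_mod_cast h1 p
    have h3 : (K * p : ℝ) ^ 2 ≤ (2 * 2 ^ p) ^ 2 := by
      calc (K * p : ℝ) ^ 2 = K ^ 2 * p ^ 2 := by ring
        _ ≤ 2 ^ p * (2 * 2 ^ p) := by gcongr
        _ ≤ _ := by nlinarith [pow_pos (by norm_num : (0 : ℝ) < 2) p]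
    have h4 := (pow_le_pow_iff_left₀ (by positivity) (by positivity) two_ne_zero).1 h3
    have h5 : 0 ≤ (K : ℝ) * Real.log K := by positivity
    linarith

open scoped Classical in
/-- The total cost of all verifications with correct levels. -/
theorem exists_verifyBound (hK : 2 ≤ K) (hm : ∀ i, m i ∈ Set.Icc (0 : ℝ) 1)
    (hg : ∃ i, 0 < gap m i) : ∃ b : ℕ → ℝ, (∀ s, 0 ≤ b s) ∧
      (∀ s, baseStage K < s → IsCheck K s → ∀ lev, Valid m s lev →
        ∑ a, verifyCount G s lev a * gap m a ≤ b s) ∧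
      ∀ S, 1 ≤ S → ∑ s ∈ Finset.Ico (baseStage K + 1) S, (if IsCheck K s then b s else 0) ≤
        184320 * 16384 * (gapLevel m + 1 : ℝ) ^ 2 * dStar G m +
          1600000 * (K * Real.log K + K * (gapLevel m + 1)) + 184320 * 80 * S * cStar G m := by
  have hK1 : 1 ≤ K := by omega
  have hKr : (2 : ℝ) ≤ K := by exact_mod_cast hK
  have hlogK : 0 ≤ Real.log K := Real.log_nonneg (by linarith)
  have hd : 0 ≤ dStar G m := zero_le_one.trans (one_le_dStar hK1 hm hg)
  have hc : 0 ≤ cStar G m := cStar_nonneg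
  have hgm := gapMin_pos hg
  have hlog := log_one_div_gapMin_le hg
  set p := gapLevel m + 1 with hp
  set d := dStar G m with hdef
  set c := cStar G m with hcdef
  have hpc : (gapLevel m + 1 : ℝ) = p := by rw [hp]; push_cast; ring
  rw [hpc] at hlog
  have hN : ∀ s, (sampleFactor s : ℝ) = 184320 * s := fun s => by
    unfold sampleFactor; push_cast; ring
  -- checks before and after the optimal arms are identified with a margin
  set b₁ : ℕ → ℝ := fun s => if s < 16 * p then 512 * 184320 * p * d * s + 2 * K else 0 with hb₁
  set b₂ : ℕ → ℝ := fun s =>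
    if gapMin m ≤ c then 32 * 184320 * c * s + 1500000 * K else 0 with hb₂
  have n₁ : ∀ s, 0 ≤ b₁ s := fun s => by simp only [hb₁]; split_ifs <;> positivity
  have n₂ : ∀ s, 0 ≤ b₂ s := fun s => by simp only [hb₂]; split_ifs <;> positivity
  refine ⟨fun s => b₁ s + b₂ s, fun s => add_nonneg (n₁ s) (n₂ s), fun s hs hch lev h => ?_,
    fun S hS => ?_⟩
  · have h4 : 4 * baseStage K ≤ s := by
      obtain ⟨k, rfl⟩ := hch
      rcases k with _ | k
      · simp at hs
      · rw [pow_succ]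
        have : 1 ≤ 4 ^ k := Nat.one_le_pow _ _ (by norm_num)
        nlinarith
    rcases Nat.lt_or_ge s (16 * p) with hl | hl
    · have h1 := h.verifyCost_le (G := G) hK1 hm hg h4
      have e : b₁ s = 512 * 184320 * p * d * s + 2 * K := if_pos hl
      rw [hN, hpc] at h1
      linarith [n₂ s]
    · rcases h.verifyCost_le_late (G := G) hm hg hs.le (by omega) with h1 | ⟨h1, h2⟩
      · exact h1.trans (add_nonneg (n₁ s) (n₂ s))
      · have e : b₂ s = 32 * 184320 * c * s + 1500000 * K := if_pos h1
        rw [hN] at h2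
        linarith [n₁ s]
  · have hsplit : ∑ s ∈ Finset.Ico (baseStage K + 1) S, (if IsCheck K s then b₁ s + b₂ s else 0) ≤
        ∑ s ∈ Finset.range (16 * p) with IsCheck K s, (512 * 184320 * p * d * s + 2 * K) +
          ∑ s ∈ Finset.range S with IsCheck K s, b₂ s := by
      rw [← Finset.sum_filter, Finset.sum_add_distrib]
      refine add_le_add ?_ ?_
      · simp only [hb₁]
        rw [← Finset.sum_filter, Finset.filter_filter]
        refine Finset.sum_le_sum_of_subset_of_nonneg (fun s hs => ?_) fun _ _ _ => by positivity
        obtain ⟨h1, h2, h3⟩ := Finset.mem_filter.1 hs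
        exact Finset.mem_filter.2 ⟨Finset.mem_range.2 h3, h2⟩
      · refine Finset.sum_le_sum_of_subset_of_nonneg (fun s hs => ?_) fun s _ _ => n₂ s
        obtain ⟨h1, h2⟩ := Finset.mem_filter.1 hs
        exact Finset.mem_filter.2 ⟨Finset.mem_range.2 (Finset.mem_Ico.1 h1).2, h2⟩
    have hlin : ∀ (u v : ℝ) (M : ℕ), 1 ≤ M → 0 ≤ u → 0 ≤ v → ∃ n : ℕ, 4 ^ n ≤ M ∧
        ∑ s ∈ Finset.range M with IsCheck K s, (u * s + v) ≤ u * (2 * M) + n * v := by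
      intro u v M hM hu hv
      obtain ⟨n, h1, h2, h3⟩ := exists_card_checks K hM
      refine ⟨n, h1, ?_⟩
      rw [Finset.sum_add_distrib, ← Finset.mul_sum, Finset.sum_const, nsmul_eq_mul]
      have h3' : ∑ s ∈ Finset.range M with IsCheck K s, (s : ℝ) ≤ 2 * M := by
        rw [← Nat.cast_sum]
        exact_mod_cast h3
      gcongr
    obtain ⟨n, hn, hs1⟩ := hlin (512 * 184320 * p * d) (2 * K) (16 * p) (by omega)
      (by positivity) (by positivity)
    have hn' : (n : ℝ) ≤ 16 * p := by
      have h1 : n < 4 ^ n := Nat.lt_pow_self (by norm_num)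
      exact_mod_cast (by omega : n ≤ 16 * p)
    have hs1' : (n : ℝ) * (2 * K) ≤ 16 * p * (2 * K) := by gcongr
    have hs2 : ∑ s ∈ Finset.range S with IsCheck K s, b₂ s ≤
        184320 * 80 * S * c + 1500000 * (K * Real.log K + K * p) := by
      by_cases hgc : gapMin m ≤ c
      · have e : ∀ s, b₂ s = 32 * 184320 * c * s + 1500000 * K := fun s => if_pos hgc
        simp only [e]
        obtain ⟨n, hn, hs⟩ := hlin (32 * 184320 * c) (1500000 * K) S hS
          (by positivity) (by positivity)
        have hS' : (0 : ℝ) < S := by exact_mod_cast hS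
        have h1 := log_le_split hS' (by linarith : (0 : ℝ) < K) hgm
        have h2 := mul_le_mul_of_nonneg_left (natCast_le_log_of_four_pow_le hn)
          (by linarith : (0 : ℝ) ≤ K)
        have h3 := mul_le_mul_of_nonneg_left hgc hS'.le
        have h4 := mul_le_mul_of_nonneg_left hlog (by linarith : (0 : ℝ) ≤ K)
        have h5 : 0 ≤ (S : ℝ) * c := by positivity
        linarith
      · have e : ∀ s, b₂ s = 0 := fun s => if_neg hgc
        simp only [e, Finset.sum_const_zero]
        positivity
    have h6 : 0 ≤ (K : ℝ) * Real.log K := by positivity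
    have h7 : 0 ≤ (K : ℝ) * p := by positivity
    refine hsplit.trans ?_
    rw [hpc]
    push_cast at hs1
    linarith

theorem exists_dominating (G : SimpleGraph (Fin K)) :
    ∃ S : Finset (Fin K), IsDominating G S ∧ S.card = domNumber G :=
  Nat.sInf_mem (s := {n | ∃ S : Finset (Fin K), IsDominating G S ∧ S.card = n})
    ⟨_, Finset.univ, fun i hi => absurd (Finset.mem_univ i) hi, rfl⟩

theorem domNumber_pos (hK : 1 ≤ K) (G : SimpleGraph (Fin K)) : 1 ≤ domNumber G := by
  obtain ⟨S, hS, hc⟩ := exists_dominating G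
  rw [← hc, Nat.one_le_iff_ne_zero, Finset.card_ne_zero]
  by_contra hne
  obtain ⟨j, hj, -⟩ := hS ⟨0, hK⟩ fun h => hne ⟨_, h⟩
  exact hne ⟨j, hj⟩

theorem baseStage_le_log (hK : 2 ≤ K) : (baseStage K : ℝ) ≤ 15 * Real.log K := by
  have hK' : (2 : ℝ) ≤ K := by exact_mod_cast hK
  have h1 : ((Nat.clog 4 K).pred : ℝ) ≤ Real.log K :=
    natCast_le_log_of_four_pow_le (Nat.pow_pred_clog_lt_self (by norm_num) hK).le
  have h2 : Nat.clog 4 K ≤ (Nat.clog 4 K).pred + 1 := by rw [Nat.pred_eq_sub_one]; omega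
  have h2' : (Nat.clog 4 K : ℝ) ≤ ((Nat.clog 4 K).pred : ℝ) + 1 := by exact_mod_cast h2
  have h3 := Real.log_le_log (by norm_num) hK'
  have h4 := Real.log_two_gt_d9
  unfold baseStage
  push_cast
  linarith

/-- The cost of the first stage: without knowledge, a dominating set is played. -/
theorem batchCost_start_le (hK : 2 ≤ K) (hm : ∀ i, m i ∈ Set.Icc (0 : ℝ) 1) :
    batchCost G m (baseStage K) (fun _ => baseStage K) ≤
      184320 * 60 * 4 ^ 9 * (domNumber G * K * Real.log K) := by
  classical
  set B := baseStage K with hB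
  set lev : Fin K → ℕ := fun _ => B with hlev
  have hplan : ∀ a, planCount G B lev a = refineCount G B lev a := fun a => by
    rw [planCount, (verifyCount_spec G le_rfl lev).2.2.2.2 (fun _ => le_rfl) a]
    simp
  have hw : ∀ i, estCost B (lag B lev) lev i = scale (B + lag B lev) := fun i =>
    if_neg (lt_irrefl _)
  obtain ⟨S, hS, hcard⟩ := exists_dominating G
  have h1 := (refineCount_spec G (le_refl B) lev).2.2.1
    (fun i => if i ∈ S then 4 ^ B else 0)
    (fun i => by split_ifs <;> positivity) fun i _ => by
      obtain ⟨j, hj, hjS⟩ : ∃ j ∈ nbhd G i, j ∈ S := by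
        by_cases hi : i ∈ S
        · exact ⟨i, self_mem_nbhd G i, hi⟩
        · obtain ⟨j, hj, hadj⟩ := hS i hi
          exact ⟨j, by simp [nbhd, hadj], hj⟩
      calc (4 : ℝ) ^ B = if j ∈ S then 4 ^ B else 0 := (if_pos hjS).symm
        _ ≤ _ := Finset.single_le_sum (f := fun j => if j ∈ S then (4 : ℝ) ^ B else 0)
            (fun j _ => by split_ifs <;> positivity) hj
  simp only [hw, ← Finset.mul_sum] at h1
  have hsc := scale_pos (B + lag B lev)
  have h2 : ∑ i, (refineCount G B lev i : ℝ) ≤ 4 * sampleFactor B * (domNumber G * 4 ^ B) := by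
    have e : ∑ i, (if i ∈ S then (4 : ℝ) ^ B else 0) = domNumber G * 4 ^ B := by
      rw [← hcard]; simp
    rw [e] at h1
    refine le_of_mul_le_mul_left (h1.trans (le_of_eq ?_)) hsc
    ring
  have h3 : batchCost G m B lev ≤ ∑ i, (refineCount G B lev i : ℝ) := by
    refine Finset.sum_le_sum fun a _ => ?_
    rw [hplan]
    exact mul_le_of_le_one_right (Nat.cast_nonneg _) (gap_le_one hm a)
  have h4 : (4 : ℝ) ^ B ≤ 4 ^ 9 * K := by
    have h5 : 4 ^ (Nat.clog 4 K).pred ≤ K := (Nat.pow_pred_clog_lt_self (by norm_num) hK).le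
    have h6 : 0 < Nat.clog 4 K := Nat.clog_pos (by norm_num) hK
    have h7 : B = 9 + (Nat.clog 4 K).pred := by
      rw [hB, baseStage, Nat.pred_eq_sub_one]; omega
    rw [h7, pow_add]
    gcongr
    exact_mod_cast h5
  have h5 := baseStage_le_log hK
  have h6 : (sampleFactor B : ℝ) = 184320 * B := by unfold sampleFactor; push_cast; ring
  calc batchCost G m B lev ≤ 4 * sampleFactor B * (domNumber G * 4 ^ B) := h3.trans h2
    _ ≤ 4 * (184320 * (15 * Real.log K)) * (domNumber G * (4 ^ 9 * K)) := by
        rw [h6]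
        have : 0 ≤ Real.log K := Real.log_nonneg (by exact_mod_cast (by omega : 1 ≤ K))
        gcongr
    _ = _ := by ring

/-- The upper bound: the costs of the first batch, of the refinements and of the verifications,
where only `O(log T)` stages start before round `T`. -/
theorem upper_bound : ∃ C : ℝ, 0 < C ∧ ∀ (K : ℕ), 1 ≤ K → ∀ G : SimpleGraph (Fin K),
    ∃ π : Policy K, ∀ ν : Measure (Fin K → ℝ), IsProbabilityMeasure ν → IsSubGaussian ν →
      (∀ i, means ν i ∈ Set.Icc (0 : ℝ) 1) → (∃ i, 0 < gap (means ν) i) →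
      ∀ T : ℕ, regret G ν π T ≤
        C * ((max 1 (Real.logb 2 (1 / gapMin (means ν)))) ^ 2 * dStar G (means ν)
          + Real.log T * cStar G (means ν) + domNumber G * K * Real.log K) := by
  classical
  refine ⟨10 ^ 14, by norm_num, fun K hK1 G => ⟨(stageAlg G hK1).policy,
    fun ν hν hsub hm hg T => ?_⟩⟩
  set m := means ν with hmdef
  have hK : 2 ≤ K := by
    by_contra hlt
    obtain ⟨i, hi⟩ := hg
    obtain ⟨j, hj⟩ := exists_eq_best m hK1
    have : i = j := Fin.ext (by have := i.2; have := j.2; omega)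
    rw [gap, this, hj, sub_self] at hi
    exact lt_irrefl _ hi
  have hKr : (2 : ℝ) ≤ K := by exact_mod_cast hK
  have hlogK : 0 ≤ Real.log K := Real.log_nonneg (by linarith)
  have hd1 : 1 ≤ dStar G m := one_le_dStar hK1 hm hg
  have hc : 0 ≤ cStar G m := cStar_nonneg
  have hlogT : 0 ≤ Real.log T := Real.log_natCast_nonneg T
  have hγ : (1 : ℝ) ≤ domNumber G := by exact_mod_cast domNumber_pos hK1 G
  have hp := gapLevel_le_logb hg
  have hKp := card_mul_gapLevel_le (G := G) hK hm hg
  obtain ⟨b₁, hb₁0, hb₁, hsum₁⟩ := exists_refineBound (G := G) hK1 hm hg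
  obtain ⟨b₂, hb₂0, hb₂, hsum₂⟩ := exists_verifyBound (G := G) hK hm hg
  set B := baseStage K with hB
  -- stage `S` does not start before round `T`
  set S := max (B + 1) (Nat.clog 4 T + 1) with hS
  have hBS : B < S := by omega
  have hT : T ≤ 4 ^ (S - 1) := (Nat.le_pow_clog (by norm_num) T).trans
    (Nat.pow_le_pow_right (by norm_num) (by omega))
  set b : ℕ → ℝ := fun s => if s = B then 184320 * 60 * 4 ^ 9 * (domNumber G * K * Real.log K)
    else b₁ s + if IsCheck K s then b₂ s else 0 with hb
  have hb0 : ∀ s, 0 ≤ b s := fun s => by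
    simp only [hb]
    have := hb₁0 s
    have := hb₂0 s
    split_ifs <;> positivity
  have hreg := regret_stageAlg_le (G := G) hsub hK1 hm hBS hT hb0
    ((batchCost_start_le hK hm).trans (if_pos rfl).ge) fun s hs _ lev h => by
      have e : b s = b₁ s + if IsCheck K s then b₂ s else 0 := if_neg (by omega)
      have h1 := hb₁ s hs lev h
      rw [e, batchCost]
      by_cases hch : IsCheck K s
      · have h2 := hb₂ s hs hch lev h
        simp only [planCount, hch, if_true, Nat.cast_add, add_mul, Finset.sum_add_distrib]
        linarith
      · simp only [planCount, hch, if_false, add_zero]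
        exact h1
  have hsplit : ∑ s ∈ Finset.Ico B S, b s = 184320 * 60 * 4 ^ 9 * (domNumber G * K * Real.log K) +
      (∑ s ∈ Finset.Ico (B + 1) S, b₁ s +
        ∑ s ∈ Finset.Ico (B + 1) S, if IsCheck K s then b₂ s else 0) := by
    rw [Finset.sum_eq_sum_Ico_succ_bot hBS, ← Finset.sum_add_distrib]
    refine congrArg₂ _ (if_pos rfl) (Finset.sum_congr rfl fun s hs => if_neg ?_)
    have := (Finset.mem_Ico.1 hs).1
    omega
  set p : ℝ := gapLevel m + 1 with hpdef
  have hp1 : 1 ≤ p := by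
    rw [hpdef]; linarith [(Nat.cast_nonneg (gapLevel m) : (0 : ℝ) ≤ _)]
  have hverify : ∑ s ∈ Finset.Ico (B + 1) S, (if IsCheck K s then b₂ s else 0) ≤
      184320 * 16384 * p ^ 2 * dStar G m + 1600000 * (K * Real.log K + K * p) +
        184320 * 160 * (Real.log T * cStar G m) := by
    rcases Nat.lt_or_ge B (Nat.clog 4 T) with h | h
    · have e : S = Nat.clog 4 T + 1 := by omega
      have h8 := le_baseStage (K := K)
      have hT1 : 1 < T := by
        by_contra hle
        rw [Nat.clog_of_right_le_one (by omega)] at h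
        omega
      have h1 : ((Nat.clog 4 T).pred : ℝ) ≤ Real.log T :=
        natCast_le_log_of_four_pow_le (Nat.pow_pred_clog_lt_self (by norm_num) hT1).le
      have h2 : S ≤ 2 * (Nat.clog 4 T).pred := by rw [Nat.pred_eq_sub_one]; omega
      have h3 : (S : ℝ) ≤ 2 * Real.log T := by
        have : (S : ℝ) ≤ 2 * ((Nat.clog 4 T).pred : ℝ) := by exact_mod_cast h2
        linarith
      have h4 := hsum₂ S (by omega)
      have h5 := mul_le_mul_of_nonneg_right h3 hc
      linarith
    · have e : S = B + 1 := by omega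
      rw [e, Finset.Ico_self, Finset.sum_empty]
      positivity
  have hrefine := hsum₁ S
  set L := max 1 (Real.logb 2 (1 / gapMin m)) with hL
  have hL1 : 1 ≤ L := le_max_left _ _
  have hpL : p ^ 2 * dStar G m ≤ 9 * (L ^ 2 * dStar G m) := by
    have : p ^ 2 ≤ (3 * L) ^ 2 := by gcongr
    nlinarith
  have hdL : dStar G m ≤ L ^ 2 * dStar G m :=
    le_mul_of_one_le_left (by linarith) (one_le_pow₀ hL1)
  have hKγ : K * Real.log K ≤ domNumber G * K * Real.log K := by
    rw [mul_assoc]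
    exact le_mul_of_one_le_left (by positivity) hγ
  have hKl : 0 ≤ K * Real.log K := by positivity
  have hlc : 0 ≤ Real.log T * cStar G m := by positivity
  refine hreg.trans ?_
  rw [hsplit]
  norm_num
  linarith

end Total

end FeedbackGraph

theorem theorem2 :
    -- upper bound
    (∃ C : ℝ, 0 < C ∧ ∀ (K : ℕ), 1 ≤ K → ∀ G : SimpleGraph (Fin K), ∃ π : Policy K,
      ∀ ν : Measure (Fin K → ℝ), IsProbabilityMeasure ν → IsSubGaussian ν →
        (∀ i, means ν i ∈ Set.Icc (0 : ℝ) 1) → (∃ i, 0 < gap (means ν) i) →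
        ∀ T : ℕ, regret G ν π T ≤
          C * ((max 1 (Real.logb 2 (1 / gapMin (means ν)))) ^ 2 * dStar G (means ν)
            + Real.log T * cStar G (means ν) + domNumber G * K * Real.log K)) ∧
    -- lower bound
    (∃ c C : ℝ, 0 < c ∧ 0 < C ∧ ∀ (K : ℕ), 1 ≤ K → ∀ (G : SimpleGraph (Fin K)) (m : Fin K → ℝ),
      (∀ i, m i ∈ Set.Icc (0 : ℝ) 1) → (∃ i, 0 < gap m i) → ∀ π : Policy K,
        (∃ m' : Fin K → ℝ, (∀ i, m' i ∈ Set.Icc (0 : ℝ) 1) ∧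
          ∀ T : ℕ, C * (dStar G m * ((optArms m).card / gapMin m)) ≤ T →
            c * dStar G m ≤ regret G (gaussianEnv m') π T) ∧
        (∀ s ∈ phases m, best m ≤ 1 - 2 * scale s →
          ∃ m' : Fin K → ℝ, (∀ i, m' i ∈ Set.Icc (0 : ℝ) 1) ∧
            (∀ i, m' i ∈ Set.Icc (m i) (m i + 2 * clippedGap m s i)) ∧
            ∀ T : ℕ, C * (phaseValue G m s / scale s) ≤ T →
              c * phaseValue G m s ≤ regret G (gaussianEnv m') π T)) := by
  exact ⟨upper_bound, lower_bound⟩
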